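/- Consider a single server with a single-packet buffer. Packets are generated according to a Poisson process of rate $\lambda>0$ and reach the server immediately. The processing time of each packet is distributed as $H\ge 0$ and the length of each vacation as $V\ge 0$, where $P(V>0)>0$ and $E[V]<\infty$; all inter-arrival times, processing times and vacation lengths are mutually independent. The server follows the Conventional Buffer System with Preemption in Service (CBS-P): during vacations the buffer keeps only the most recent packet; on returning from a vacation the server takes another vacation if the buffer is empty, and otherwise starts processing the packet in the buffer; a packet that arrives during processing preempts and discards the packet in service, and its own processing starts at once; when a packet completes processing, the system is empty and a vacation begins. Let $C_l$ and $r_l$ ($l\ge 1$) be the completion time and the generation time of the $l$-th packet that completes processing. At time $0$ the system is empty, a vacation begins, and the age is some constant $a\ge 0$ (put $C_0=0$, $r_0=-a$). The age is $\Delta(t)=t-\max\{r_l : C_l\le t\}$, and its $l$-th peak, the left limit of $\Delta$ at $C_l$, is $A_l=C_l-r_{l-1}$ (almost surely, for all $l\ge1$). Write $X^*(s)=E[e^{-sX}]$ for $s\ge 0$ and $X^{*(n)}$ for the $n$-th derivative of $X^*$ on $[0,\infty)$ (one-sided at $0$). **PAoI.** The peaks are integrable, and almost surely $$\lim_{k\to\infty}\frac1k\sum_{l=1}^k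 A_l=\lim_{l\to\infty}E[A_l]=\frac{1-H^*(\lambda)-\lambda H^{*(1)}(\lambda)+H^*(\lambda)^2}{\lambda H^*(\lambda)}+\frac{H^*(\lambda)V^{*(1)}(\lambda)-V^{*(1)}(0)}{1-V^*(\lambda)}.$$ **AoI.** Suppose moreover that $E[V^2]<\infty$, and let $$\begin{aligned}\alpha={}&\frac{1}{2\left(-\frac{V^{*(1)}(0)}{1-V^*(\lambda)}+\frac{1-H^*(\lambda)}{\lambda H^*(\lambda)}\right)}\bigg\{\frac{V^{*(2)}(0)}{1-V^*(\lambda)}+2\frac{V^{*(1)}(0)V^{*(1)}(\lambda)}{(1-V^*(\lambda))^2}-2\frac{V^{*(1)}(0)}{1-V^*(\lambda)}\,\frac{1-H^*(\lambda)}{\lambda H^*(\lambda)}\\&+\frac{2}{\lambda H^*(\lambda)^2}\Big[\frac1\lambda-\frac{H^*(\lambda)}{\lambda}+H^{*(1)}(\lambda)\Big]\bigg\}-\frac{H^{*(1)}(\lambda)}{H^*(\lambda)}+H^*(\lambda)\Big(\frac1\lambda+\frac{V^{*(1)}(\lambda)}{1-V^*(\lambda)}\Big).\end{aligned}$$ Then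 almost surely $$\lim_{T\to\infty}\frac1T\int_0^T\Delta(t)\,dt=\alpha;$$ moreover $\Delta(t)$ is integrable for every $t\ge0$, and if $E[\Delta(t)]$ converges as $t\to\infty$, its limit is $\alpha$. -/

import Mathlib

open MeasureTheory ProbabilityTheory Filter Set Topology

namespace CBSP

/-- Laplace-Stieltjes transform `s ↦ E[exp (-s X)]` of a random variable `X` with law `μ`. -/
noncomputable def lst (μ : Measure ℝ) (s : ℝ) : ℝ := ∫ x, Real.exp (-(s * x)) ∂μ

/-- The `n`-th derivative of the Laplace-Stieltjes transform, as a function on `[0, ∞)`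
(so a two-sided derivative at `s > 0` and a right derivative at `s = 0`). -/
noncomputable def lstDeriv (n : ℕ) (μ : Measure ℝ) (s : ℝ) : ℝ :=
  iteratedDerivWithin n (lst μ) (Set.Ici 0) s

/-- Generation (= arrival) time of packet `j = 0, 1, 2, …`, where `X 0, X 1, …` are the
successive inter-arrival times. -/
noncomputable def arrivalTime (X : ℕ → ℝ) (j : ℕ) : ℝ := ∑ i ∈ Finset.range (j + 1), X i

/-- What is recorded at the completion of an informative packet. The system is empty at this
epoch and a vacation begins. -/
structure Epoch where
  /-- the completion time of the informative packet -/
  time : ℝ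
  /-- the generation time of the informative packet -/
  gen : ℝ
  /-- the number of packets that have arrived so far, i.e. the index of the next arrival -/
  arrived : ℕ
  /-- the number of vacations taken so far, i.e. the index of the next vacation -/
  vacations : ℕ

/-- The end of the `(m+1)`-st consecutive vacation after the epoch `e`. -/
noncomputable def vacationEnd (V : ℕ → ℝ) (e : Epoch) (m : ℕ) : ℝ :=
  e.time + ∑ i ∈ Finset.range (m + 1), V (e.vacations + i)

/-- Multiple vacations: after the epoch `e` the server takes vacations until it first finds a
packet on return; this is the index `m` of that last vacation. -/
noncomputable def lastVacation (X V : ℕ → ℝ) (e : Epoch) : ℕ :=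
  sInf {m : ℕ | arrivalTime X e.arrived ≤ vacationEnd V e m}

/-- The time at which the server starts processing after the epoch `e`. -/
noncomputable def startTime (X V : ℕ → ℝ) (e : Epoch) : ℝ :=
  vacationEnd V e (lastVacation X V e)

/-- The packet in the buffer when processing starts: a new packet replaces the old one during
vacations, so this is the last packet to have arrived by then. -/
noncomputable def bufferedPacket (X V : ℕ → ℝ) (e : Epoch) : ℕ :=
  sInf {j : ℕ | e.arrived ≤ j ∧ startTime X V e < arrivalTime X (j + 1)}

/-- The time at which packet `k` enters service, if it is the buffered packet or preempts its
predecessor: the start of processing or its own arrival time, whichever is later. -/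
noncomputable def serviceStart (X V : ℕ → ℝ) (e : Epoch) (k : ℕ) : ℝ :=
  max (startTime X V e) (arrivalTime X k)

/-- The next informative packet: every arrival during processing preempts (and discards) the
packet in service, so it is the first packet, from the buffered one on, whose processing is
complete by the arrival of its successor. -/
noncomputable def informativePacket (X H V : ℕ → ℝ) (e : Epoch) : ℕ :=
  sInf {k : ℕ | bufferedPacket X V e ≤ k ∧
    serviceStart X V e k + H k ≤ arrivalTime X (k + 1)}

/-- The completion epoch of the next informative packet. -/
noncomputable def nextEpoch (X H V : ℕ → ℝ) (e : Epoch) : Epoch where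
  time := serviceStart X V e (informativePacket X H V e) + H (informativePacket X H V e)
  gen := arrivalTime X (informativePacket X H V e)
  arrived := informativePacket X H V e + 1
  vacations := e.vacations + (lastVacation X V e + 1)

/-- The completion epochs of the informative packets on a sample path with inter-arrival times
`X i`, processing time `H j` of packet `j` and length `V i` of the `i`-th vacation. At time `0` the
system is empty, a vacation begins, and the age is `a`: epoch `0` is the completion at time
`0` of a packet generated at time `-a`. -/
noncomputable def epoch (a : ℝ) (X H V : ℕ → ℝ) : ℕ → Epoch
  | 0 => ⟨0, -a, 0, 0⟩
  | l + 1 => nextEpoch X H V (epoch a X H V l)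

/-- The completion time `C_l` of the `l`-th informative packet. -/
noncomputable def completion (a : ℝ) (X H V : ℕ → ℝ) (l : ℕ) : ℝ := (epoch a X H V l).time

/-- The generation time `r_l` of the `l`-th informative packet. -/
noncomputable def generation (a : ℝ) (X H V : ℕ → ℝ) (l : ℕ) : ℝ := (epoch a X H V l).gen

/-- The age `Δ(t) = t - max {r_l : C_l ≤ t}`. -/
noncomputable def age (a : ℝ) (X H V : ℕ → ℝ) (t : ℝ) : ℝ :=
  t - sSup {r : ℝ | ∃ l : ℕ, completion a X H V l ≤ t ∧ generation a X H V l = r}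

/-- The `(l+1)`-st age peak `A_{l+1} = C_{l+1} - r_l`, `l = 0, 1, …`. -/
noncomputable def peak (a : ℝ) (X H V : ℕ → ℝ) (l : ℕ) : ℝ :=
  completion a X H V (l + 1) - generation a X H V l

/-- The closed form for the peak age of information. -/
noncomputable def paoiValue (lam : ℝ) (μH μV : Measure ℝ) : ℝ :=
  (1 - lst μH lam - lam * lstDeriv 1 μH lam + lst μH lam ^ 2) / (lam * lst μH lam)
    + (lst μH lam * lstDeriv 1 μV lam - lstDeriv 1 μV 0) / (1 - lst μV lam)

/-- The closed form for the age of information. -/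
noncomputable def aoiValue (lam : ℝ) (μH μV : Measure ℝ) : ℝ :=
  1 / (2 * (-(lstDeriv 1 μV 0 / (1 - lst μV lam))
      + (1 - lst μH lam) / (lam * lst μH lam)))
    * (lstDeriv 2 μV 0 / (1 - lst μV lam)
      + 2 * (lstDeriv 1 μV 0 * lstDeriv 1 μV lam / (1 - lst μV lam) ^ 2)
      - 2 * (lstDeriv 1 μV 0 / (1 - lst μV lam))
          * ((1 - lst μH lam) / (lam * lst μH lam))
      + 2 / (lam * lst μH lam ^ 2)
          * (1 / lam - lst μH lam / lam + lstDeriv 1 μH lam))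
    - lstDeriv 1 μH lam / lst μH lam
    + lst μH lam * (1 / lam + lstDeriv 1 μV lam / (1 - lst μV lam))

end CBSP

namespace CBSP

open scoped ENNReal

/-! ### The exponential distribution -/

/-! The completion epochs are regeneration epochs. When a packet completes, the system is empty, a
vacation begins, and the residual inter-arrival time is again exponential because the exponential
law is memoryless. The future, coded as a `Stream` of inter-arrival times, processing times and
vacations, is thus a fresh copy of the original stream, independent of the cycle just finished. With
Y_l the length of the l-th cycle and D_l the age of its informative packet at its end, the pairs
(Y_l, D_l) are i.i.d. (`indepFun_nextCycle`, `iIndepFun_cycles`), while D_l may depend on Y_l.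

Since 0 ≤ D_l ≤ Y_l, the age is a sawtooth: on cycle l it starts at D_{l-1} (at a for the first
cycle) and grows with slope one. The peak is Y_l + D_{l-1} and the area is D_{l-1} Y_l + Y_l²/2. As
D_{l-1} and Y_l belong to different cycles, the law of large numbers gives E[Y] + E[D] for the peaks
and (E[D] E[Y] + E[Y²]/2) / E[Y] for the age.

The moments come from one-step analysis (`lintegral_of_renewal_equation`). The vacation period
restarts after each vacation without arrivals, which has probability V*(λ); the busy period restarts
after each preemption, which has probability 1 - H*(λ). The age of the buffered packet is found from
Campbell's formula (`tsum_lintegral_arrivalTime`). It enters D only if there is no preemption, an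
event independent of it.

If E[Δ(t)] → d, then the averages of E[Δ] over [0, n] also tend to d. Fatou's lemma bounds d below
by the pathwise time average. For the upper bound, every cycle begun by time n is counted with its
full area; the event of having begun is independent of that cycle, and the expected number of such
cycles is controlled by truncating the cycle lengths (`RenewalCycles.tsum_renewed_mul_le`). No
regularity of the cycle law and no key renewal theorem is needed
(`RenewalCycles.eq_of_tsendsto_integral` is replaced here by
`RenewalCycles.eq_of_tendsto_integral`). -/

lemma lintegral_expMeasure (lam : ℝ) {f : ℝ → ℝ≥0∞} (hf : Measurable f) :
    ∫⁻ x, f x ∂(expMeasure lam) =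
      ∫⁻ x in Ioi 0, ENNReal.ofReal (lam * Real.exp (-(lam * x))) * f x := by
  have h0 : expMeasure lam = volume.withDensity (exponentialPDF lam) := rfl
  have hm : Measurable (exponentialPDF lam) :=
    (measurable_exponentialPDFReal lam).ennreal_ofReal
  rw [h0, lintegral_withDensity_eq_lintegral_mul _ hm hf, ← lintegral_indicator measurableSet_Ioi]
  refine lintegral_congr_ae ?_
  have : ∀ᵐ x : ℝ, x ≠ 0 := by simp [ae_iff]
  filter_upwards [this] with x hx
  rcases lt_or_gt_of_ne hx with h | h
  · simp [exponentialPDF_of_neg h, h.le]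
  · simp [exponentialPDF_of_nonneg h.le, h]

/-- The memoryless property. -/
lemma lintegral_expMeasure_sub (lam : ℝ) {f : ℝ → ℝ≥0∞} (hf : Measurable f)
    {u : ℝ} (hu : 0 ≤ u) :
    ∫⁻ x, (Ioi u).indicator (fun x => f (x - u)) x ∂(expMeasure lam) =
      ENNReal.ofReal (Real.exp (-(lam * u))) * ∫⁻ x, f x ∂(expMeasure lam) := by
  rw [lintegral_expMeasure lam hf, lintegral_expMeasure lam
    (by exact (hf.comp (measurable_id.sub_const u)).indicator measurableSet_Ioi),
    ← lintegral_const_mul _ (by fun_prop), ← lintegral_indicator measurableSet_Ioi,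
    ← lintegral_indicator measurableSet_Ioi, ← lintegral_add_right_eq_self _ u]
  refine lintegral_congr fun x => ?_
  by_cases hx : 0 < x
  · have h1 : 0 < x + u := by linarith
    simp only [indicator, mem_Ioi, hx, h1, if_true, lt_add_iff_pos_left, add_sub_cancel_right]
    rw [← mul_assoc, ← ENNReal.ofReal_mul (Real.exp_pos _).le]
    congr 2
    rw [mul_left_comm, ← Real.exp_add]
    ring_nf
  · by_cases h1 : 0 < x + u <;> simp [indicator, hx, h1]

lemma expMeasure_Ioi {lam : ℝ} (hlam : 0 < lam) {u : ℝ} (hu : 0 ≤ u) :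
    expMeasure lam (Ioi u) = ENNReal.ofReal (Real.exp (-(lam * u))) := by
  have := isProbabilityMeasure_expMeasure hlam
  have := lintegral_expMeasure_sub lam (f := fun _ => 1) measurable_const hu
  simpa [lintegral_indicator measurableSet_Ioi] using this

lemma expMeasure_memoryless (lam : ℝ) {t : Set ℝ} (ht : MeasurableSet t)
    {u : ℝ} (hu : 0 ≤ u) :
    expMeasure lam {x | u < x ∧ x - u ∈ t} =
      ENNReal.ofReal (Real.exp (-(lam * u))) * expMeasure lam t := by
  have h := lintegral_expMeasure_sub lam (f := t.indicator 1) (measurable_one.indicator ht) hu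
  rw [lintegral_indicator_one ht] at h
  rw [← h, ← lintegral_indicator_one]
  · refine lintegral_congr fun x => ?_
    by_cases h1 : u < x <;> by_cases h2 : x - u ∈ t <;> simp [indicator, h1, h2]
  · exact measurableSet_Ioi.inter ((measurable_id.sub_const u) ht)

instance nullSingletonClass_expMeasure (lam : ℝ) : NullSingletonClass (expMeasure lam) :=
  inferInstanceAs (NullSingletonClass (volume.withDensity (exponentialPDF lam)))

lemma ae_pos_expMeasure {lam : ℝ} (hlam : 0 < lam) : ∀ᵐ x ∂(expMeasure lam), 0 < x := by
  have := isProbabilityMeasure_expMeasure hlam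
  refine (prob_compl_eq_zero_iff measurableSet_Ioi).2 ?_
  rw [expMeasure_Ioi hlam le_rfl]
  simp

/-- The fundamental theorem of calculus for an antiderivative `F` of the weighted integrand.
Nonnegativity of `f` on the half-line is what lets the Lebesgue integral be read as a real one. -/
lemma lintegral_Iio_expMeasure {lam : ℝ} (hlam : 0 < lam) {h : ℝ} (hh : 0 ≤ h) {f F : ℝ → ℝ}
    (hf : Continuous f) (hf0 : ∀ x, 0 ≤ x → 0 ≤ f x)
    (hF : ∀ x, HasDerivAt F (lam * Real.exp (-(lam * x)) * f x) x) :
    ∫⁻ x, (Iio h).indicator (fun x => ENNReal.ofReal (f x)) x ∂(expMeasure lam) =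
      ENNReal.ofReal (F h - F 0) := by
  have hc : Continuous fun x => lam * Real.exp (-(lam * x)) * f x := by fun_prop
  have h1 : ∫ x in (0 : ℝ)..h, lam * Real.exp (-(lam * x)) * f x = F h - F 0 :=
    intervalIntegral.integral_eq_sub_of_hasDerivAt (fun x _ => hF x) (hc.intervalIntegrable _ _)
  rw [lintegral_expMeasure lam (by
    exact (hf.measurable.ennreal_ofReal).indicator measurableSet_Iio), ← h1,
    intervalIntegral.integral_of_le hh, ← integral_Ioc_eq_integral_Ioo.symm,
    ofReal_integral_eq_lintegral_ofReal]
  · rw [← lintegral_indicator measurableSet_Ioi, ← lintegral_indicator measurableSet_Ioo]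
    refine lintegral_congr fun x => ?_
    by_cases h1 : 0 < x <;> by_cases h2 : x < h <;> simp [indicator, h1, h2]
    rw [ENNReal.ofReal_mul (by positivity : 0 ≤ lam * Real.exp (-(lam * x))),
      ENNReal.ofReal_mul hlam.le]
  · exact (hc.integrableOn_Icc).mono_set Ioo_subset_Icc_self
  · filter_upwards [ae_restrict_mem measurableSet_Ioo] with x hx
    have := hf0 x hx.1.le
    positivity

/-- `∫₀ʰ x λ e^{-λx} dx`. -/
noncomputable def expMoment (lam h : ℝ) : ℝ :=
  (1 - Real.exp (-(lam * h))) / lam - h * Real.exp (-(lam * h))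

lemma lintegral_id_expMeasure {lam : ℝ} (hlam : 0 < lam) {h : ℝ} (hh : 0 ≤ h) :
    ∫⁻ x, (Iio h).indicator (fun x => ENNReal.ofReal x) x ∂(expMeasure lam) =
      ENNReal.ofReal (expMoment lam h) := by
  rw [lintegral_Iio_expMeasure hlam hh (f := fun x => x)
    (F := fun x => -(x + 1 / lam) * Real.exp (-(lam * x))) continuous_id (fun x hx => hx)]
  · congr 1
    simp only [expMoment]
    simp
    field_simp
    ring
  · intro x
    have h1 : HasDerivAt (fun x => Real.exp (-(lam * x))) (Real.exp (-(lam * x)) * -lam) x := by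
      simpa using (((hasDerivAt_id x).const_mul lam).neg).exp
    have h2 : HasDerivAt (fun x : ℝ => -(x + 1 / lam)) (-1) x :=
      ((hasDerivAt_id x).add_const _).neg
    convert! h2.mul h1 using 1
    field_simp
    ring

lemma lintegral_sq_expMeasure {lam : ℝ} (hlam : 0 < lam) {h : ℝ} (hh : 0 ≤ h) :
    ∫⁻ x, (Iio h).indicator (fun x => ENNReal.ofReal (x ^ 2)) x ∂(expMeasure lam) =
      ENNReal.ofReal (2 / lam * expMoment lam h - h ^ 2 * Real.exp (-(lam * h))) := by
  rw [lintegral_Iio_expMeasure hlam hh (f := fun x => x ^ 2)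
    (F := fun x => -(x ^ 2 + 2 / lam * x + 2 / lam ^ 2) * Real.exp (-(lam * x)))
    (by fun_prop) (fun x hx => by positivity)]
  · congr 1
    simp only [expMoment]
    simp
    field_simp
    ring
  · intro x
    have h1 : HasDerivAt (fun x => Real.exp (-(lam * x))) (Real.exp (-(lam * x)) * -lam) x := by
      simpa using (((hasDerivAt_id x).const_mul lam).neg).exp
    have h2 : HasDerivAt (fun x : ℝ => -(x ^ 2 + 2 / lam * x + 2 / lam ^ 2))
        (-(2 * x + 2 / lam)) x := by
      convert! (((hasDerivAt_pow 2 x).add ((hasDerivAt_id x).const_mul (2 / lam))).add_const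
        (2 / lam ^ 2)).neg using 1
      simp
    convert! h2.mul h1 using 1
    field_simp
    ring

/-- From 1 + x ≤ exp x. No sign condition on `h` is needed, so the bound can be integrated over any
law. -/
lemma expMoment_nonneg {lam : ℝ} (hlam : 0 < lam) (h : ℝ) : 0 ≤ expMoment lam h := by
  have h1 := Real.add_one_le_exp (lam * h)
  have h2 : expMoment lam h = (Real.exp (lam * h) - (lam * h + 1)) * Real.exp
      (-(lam * h)) / lam := by
    rw [sub_mul, ← Real.exp_add, expMoment]
    field_simp
    simp
    ring
  rw [h2]
  have : 0 ≤ Real.exp (lam * h) - (lam * h + 1) := by linarith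
  positivity

/-- Separates the part of the minimum below `h` from its atom at `h`, so that moments of min(x, h)
reduce to truncated moments and a tail probability. -/
lemma indicator_Iio_add {h : ℝ} (f : ℝ → ℝ≥0∞) (x : ℝ) :
    f (min x h) = (Iio h).indicator f x + (Ici h).indicator (fun _ => f h) x := by
  by_cases hx : x < h
  · simp [hx, hx.le]
  · simp [hx, not_lt.1 hx]

lemma expMeasure_Ici {lam : ℝ} (hlam : 0 < lam) {u : ℝ} (hu : 0 ≤ u) :
    expMeasure lam (Ici u) = ENNReal.ofReal (Real.exp (-(lam * u))) := by
  rw [← expMeasure_Ioi hlam hu, measure_congr Ioi_ae_eq_Ici]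

lemma lintegral_min_expMeasure {lam : ℝ} (hlam : 0 < lam) {h : ℝ} (hh : 0 ≤ h) :
    ∫⁻ x, ENNReal.ofReal (min x h) ∂(expMeasure lam) =
      ENNReal.ofReal ((1 - Real.exp (-(lam * h))) / lam) := by
  simp_rw [indicator_Iio_add (fun x => ENNReal.ofReal x)]
  rw [lintegral_add_left (by exact ENNReal.measurable_ofReal.indicator measurableSet_Iio),
    lintegral_id_expMeasure hlam hh, lintegral_indicator_const measurableSet_Ici,
    expMeasure_Ici hlam hh, ← ENNReal.ofReal_mul hh,
    ← ENNReal.ofReal_add (expMoment_nonneg hlam h) (by positivity)]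
  simp [expMoment]

lemma lintegral_min_sq_expMeasure {lam : ℝ} (hlam : 0 < lam) {h : ℝ} (hh : 0 ≤ h) :
    ∫⁻ x, ENNReal.ofReal (min x h ^ 2) ∂(expMeasure lam) =
      ENNReal.ofReal (2 / lam * expMoment lam h) := by
  simp_rw [indicator_Iio_add (fun x => ENNReal.ofReal (x ^ 2))]
  rw [lintegral_add_left (by exact Measurable.indicator (by fun_prop) measurableSet_Iio),
    lintegral_sq_expMeasure hlam hh, lintegral_indicator_const measurableSet_Ici,
    expMeasure_Ici hlam hh, ← ENNReal.ofReal_mul (by positivity),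
    ← ENNReal.ofReal_add _ (by positivity)]
  · simp
  · have h1 := Real.quadratic_le_exp_of_nonneg (mul_nonneg hlam.le hh)
    have h2 : 2 / lam * expMoment lam h - h ^ 2 * Real.exp (-(lam * h)) =
        2 / lam ^ 2 * (Real.exp (lam * h) - (1 + lam * h + (lam * h) ^ 2 / 2)) *
          Real.exp (-(lam * h)) := by
      rw [mul_assoc, sub_mul, ← Real.exp_add, expMoment]
      field_simp
      simp
      ring
    rw [h2]
    have : 0 ≤ Real.exp (lam * h) - (1 + lam * h + (lam * h) ^ 2 / 2) := by linarith
    positivity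

/-! ### Laplace–Stieltjes transforms and their derivatives -/

/-- The mean value bound on [c, ∞). It yields the integrable majorant for the difference quotients
of the transform. -/
lemma abs_exp_neg_sub_exp_neg_le {a b c : ℝ} (hca : c ≤ a) (hcb : c ≤ b) :
    |Real.exp (-a) - Real.exp (-b)| ≤ |a - b| * Real.exp (-c) := by
  wlog hab : a ≤ b generalizing a b
  · rw [abs_sub_comm, abs_sub_comm a b]
    exact this hcb hca (le_of_not_ge hab)
  rw [abs_of_nonneg (sub_nonneg.2 (Real.exp_le_exp.2 (by linarith))), abs_of_nonpos (by linarith)]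
  have h1 := Real.add_one_le_exp (-(b - a))
  have h2 : Real.exp (-b) = Real.exp (-a) * Real.exp (-(b - a)) := by
    rw [← Real.exp_add]; ring_nf
  have h3 : Real.exp (-a) ≤ Real.exp (-c) := Real.exp_le_exp.2 (by linarith)
  rw [h2]
  nlinarith [Real.exp_pos (-a)]

/-- Dominated convergence for the difference quotients, done within `Ici 0` so that the right
derivative at 0 is covered. The lower bound `c` sets the majorant: half the point when the point is
positive, where no moment is required, and 0 when the next moment is finite. -/
lemma hasDerivWithinAt_lst_aux (μ : Measure ℝ) (hμ : ∀ᵐ x ∂μ, 0 ≤ x) (k : ℕ) {s₀ c : ℝ}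
    (hs₀ : 0 ≤ s₀) (hc : ∀ᶠ s in 𝓝[Ici 0] s₀, c ≤ s)
    (hint : ∀ s, 0 ≤ s → Integrable (fun x => x ^ k * Real.exp (-(s * x))) μ)
    (hb : Integrable (fun x => x ^ (k + 1) * Real.exp (-(c * x))) μ) :
    HasDerivWithinAt (fun s => ∫ x, x ^ k * Real.exp (-(s * x)) ∂μ)
      (-∫ x, x ^ (k + 1) * Real.exp (-(s₀ * x)) ∂μ) (Ici 0) s₀ := by
  rw [hasDerivWithinAt_iff_tendsto_slope, ← integral_neg]
  have hle : 𝓝[Ici 0 \ {s₀}] s₀ ≤ 𝓝[Ici 0] s₀ := nhdsWithin_mono _ sdiff_subset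
  have hcs₀ : c ≤ s₀ := hc.self_of_nhdsWithin hs₀
  have hev : ∀ᶠ s in 𝓝[Ici 0 \ {s₀}] s₀, 0 ≤ s ∧ s ≠ s₀ := by
    filter_upwards [self_mem_nhdsWithin] with s hs using hs
  refine Tendsto.congr' (f₁ := fun s => ∫ x,
    slope (fun s => x ^ k * Real.exp (-(s * x))) s₀ s ∂μ) ?_ ?_
  · filter_upwards [hev] with s hs
    simp only [slope_def_field]
    rw [integral_div, integral_sub (hint s hs.1) (hint s₀ hs₀)]
  · refine tendsto_integral_filter_of_dominated_convergence
      (fun x => x ^ (k + 1) * Real.exp (-(c * x))) ?_ ?_ hb ?_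
    · refine Eventually.of_forall fun s => ?_
      simp only [slope_def_field]
      exact (by fun_prop : Continuous fun x : ℝ =>
        (x ^ k * Real.exp (-(s * x)) - x ^ k * Real.exp (-(s₀ * x))) /
            (s - s₀)).aestronglyMeasurable
    · filter_upwards [hev, hle hc] with s hs hcs
      filter_upwards [hμ] with x hx
      have hne : 0 < |s - s₀| := abs_pos.2 (sub_ne_zero.2 hs.2)
      rw [slope_def_field, Real.norm_eq_abs, abs_div, div_le_iff₀ hne, ← mul_sub, abs_mul,
        abs_of_nonneg (pow_nonneg hx k)]
      have := abs_exp_neg_sub_exp_neg_le (mul_le_mul_of_nonneg_right hcs hx)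
        (mul_le_mul_of_nonneg_right hcs₀ hx)
      rw [← sub_mul, abs_mul, abs_of_nonneg hx] at this
      calc x ^ k * _ ≤ x ^ k * (|s - s₀| * x * Real.exp (-(c * x))) :=
            mul_le_mul_of_nonneg_left this (pow_nonneg hx k)
        _ = _ := by ring
    · refine Eventually.of_forall fun x => ?_
      have h1 : HasDerivAt (fun s => x ^ k * Real.exp (-(s * x)))
          (-(x ^ (k + 1) * Real.exp (-(s₀ * x)))) s₀ := by
        convert! ((((hasDerivAt_id s₀).mul_const x).neg).exp).const_mul (x ^ k) using 1
        simp
        ring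
      exact (hasDerivWithinAt_iff_tendsto_slope.1 (h1.hasDerivWithinAt (s := Ici 0)))

variable (μ : Measure ℝ)

lemma integrable_exp_neg [IsFiniteMeasure μ] (hμ : ∀ᵐ x ∂μ, 0 ≤ x) {s : ℝ} (hs : 0 ≤ s) :
    Integrable (fun x => Real.exp (-(s * x))) μ := by
  refine Integrable.mono' (integrable_const 1)
    (by fun_prop : Continuous fun x : ℝ => Real.exp (-(s * x))).aestronglyMeasurable ?_
  filter_upwards [hμ] with x hx
  simp [abs_of_pos (Real.exp_pos _)]
  positivity

lemma integrable_mul_exp_neg (hμ : ∀ᵐ x ∂μ, 0 ≤ x) {f : ℝ → ℝ} (hf : Integrable f μ)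
    {s : ℝ} (hs : 0 ≤ s) : Integrable (fun x => f x * Real.exp (-(s * x))) μ := by
  refine Integrable.mono hf (hf.aestronglyMeasurable.mul
    (by fun_prop : Continuous fun x : ℝ => Real.exp (-(s * x))).aestronglyMeasurable) ?_
  filter_upwards [hμ] with x hx
  rw [norm_mul]
  refine mul_le_of_le_one_right (norm_nonneg _) ?_
  simp [abs_of_pos (Real.exp_pos _)]
  positivity

/-- Since x exp(-s x) ≤ 1/s, the first derivative at λ > 0 exists without any moment of the
processing time. -/
lemma integrable_id_mul_exp_neg [IsFiniteMeasure μ] (hμ : ∀ᵐ x ∂μ, 0 ≤ x) {s : ℝ} (hs : 0 < s) :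
    Integrable (fun x => x * Real.exp (-(s * x))) μ := by
  refine Integrable.mono' (integrable_const (1 / s))
    (by fun_prop : Continuous fun x : ℝ => x * Real.exp (-(s * x))).aestronglyMeasurable ?_
  filter_upwards [hμ] with x hx
  rw [Real.norm_eq_abs, abs_of_nonneg (by positivity), Real.exp_neg, ← div_eq_mul_inv,
    div_le_div_iff₀ (Real.exp_pos _) hs]
  linarith [Real.add_one_le_exp (s * x)]

lemma lstDeriv_one_of_pos [IsFiniteMeasure μ] (hμ : ∀ᵐ x ∂μ, 0 ≤ x) {s : ℝ} (hs : 0 < s) :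
    lstDeriv 1 μ s = -∫ x, x * Real.exp (-(s * x)) ∂μ := by
  have h := hasDerivWithinAt_lst_aux μ hμ 0 (s₀ := s) (c := s / 2) hs.le
    (by filter_upwards [mem_nhdsWithin_of_mem_nhds (lt_mem_nhds
        (by linarith : s / 2 < s))] with x hx
        using le_of_lt hx)
    (fun s hs => by simpa using integrable_exp_neg μ hμ hs)
    (by simpa using integrable_id_mul_exp_neg μ hμ (half_pos hs))
  simp only [pow_zero, one_mul, zero_add, pow_one] at h
  rw [lstDeriv, iteratedDerivWithin_one]
  exact h.derivWithin (uniqueDiffOn_Ici 0 s hs.le)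

lemma lstDeriv_one_of_integrable [IsFiniteMeasure μ] (hμ : ∀ᵐ x ∂μ, 0 ≤ x)
    (h1 : Integrable (fun x => x) μ) {s : ℝ} (hs : 0 ≤ s) :
    lstDeriv 1 μ s = -∫ x, x * Real.exp (-(s * x)) ∂μ := by
  have h := hasDerivWithinAt_lst_aux μ hμ 0 (s₀ := s) (c := 0) hs self_mem_nhdsWithin
    (fun s hs => by simpa using integrable_exp_neg μ hμ hs) (by simpa using h1)
  simp only [pow_zero, one_mul, zero_add, pow_one] at h
  rw [lstDeriv, iteratedDerivWithin_one]
  exact h.derivWithin (uniqueDiffOn_Ici 0 s hs)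

lemma lstDeriv_two_zero [IsFiniteMeasure μ] (hμ : ∀ᵐ x ∂μ, 0 ≤ x)
    (h1 : Integrable (fun x => x) μ) (h2 : Integrable (fun x => x ^ 2) μ) :
    lstDeriv 2 μ 0 = ∫ x, x ^ 2 ∂μ := by
  have h := hasDerivWithinAt_lst_aux μ hμ 1 (s₀ := 0) (c := 0) le_rfl self_mem_nhdsWithin
    (fun s hs => by simpa using integrable_mul_exp_neg μ hμ h1 hs) (by simpa using h2)
  simp only [pow_one, zero_mul, neg_zero, Real.exp_zero, mul_one, one_add_one_eq_two] at h
  rw [lstDeriv, iteratedDerivWithin_succ]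
  have he : ∀ s ∈ Ici (0 : ℝ), iteratedDerivWithin 1 (lst μ) (Ici 0) s =
      -∫ x, x * Real.exp (-(s * x)) ∂μ := fun s hs => lstDeriv_one_of_integrable μ hμ h1 hs
  rw [derivWithin_congr he (he 0 (by simp)), h.fun_neg.derivWithin (uniqueDiffOn_Ici 0 0 (by simp)),
    neg_neg]

lemma lst_pos [IsProbabilityMeasure μ] (hμ : ∀ᵐ x ∂μ, 0 ≤ x) {s : ℝ} (hs : 0 ≤ s) :
    0 < lst μ s :=
  integral_exp_pos (integrable_exp_neg μ hμ hs)

lemma ofReal_lst [IsFiniteMeasure μ] (hμ : ∀ᵐ x ∂μ, 0 ≤ x) {s : ℝ} (hs : 0 ≤ s) :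
    ENNReal.ofReal (lst μ s) = ∫⁻ x, ENNReal.ofReal (Real.exp (-(s * x))) ∂μ :=
  ofReal_integral_eq_lintegral_ofReal (integrable_exp_neg μ hμ hs)
    (Eventually.of_forall fun _ => (Real.exp_pos _).le)

lemma lst_le_one [IsProbabilityMeasure μ] (hμ : ∀ᵐ x ∂μ, 0 ≤ x) {s : ℝ} (hs : 0 ≤ s) :
    lst μ s ≤ 1 := by
  have := integral_mono_ae (integrable_exp_neg μ hμ hs) (integrable_const 1) (by
    filter_upwards [hμ] with x hx
    simp
    positivity)
  simpa [lst] using this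

lemma lst_lt_one [IsProbabilityMeasure μ] (hμ : ∀ᵐ x ∂μ, 0 ≤ x) (hpos : 0 < μ (Ioi 0)) {s : ℝ}
    (hs : 0 < s) : lst μ s < 1 := by
  have h0 : 0 < ∫ x, (1 - Real.exp (-(s * x))) ∂μ := by
    rw [integral_pos_iff_support_of_nonneg_ae]
    · refine hpos.trans_le (measure_mono fun x hx => ?_)
      have : 0 < s * x := mul_pos hs hx
      simp only [Function.mem_support, ne_eq, sub_eq_zero]
      intro h
      rw [eq_comm, Real.exp_eq_one_iff] at h
      linarith
    · filter_upwards [hμ] with x hx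
      simp
      positivity
    · exact (integrable_const 1).sub (integrable_exp_neg μ hμ hs.le)
  rw [integral_sub (integrable_const 1) (integrable_exp_neg μ hμ hs.le)] at h0
  simp only [integral_const, probReal_univ, smul_eq_mul, mul_one] at h0
  exact sub_pos.1 h0

lemma integral_id_pos (hμ : ∀ᵐ x ∂μ, 0 ≤ x) (hpos : 0 < μ (Ioi 0))
    (hint : Integrable (fun x => x) μ) : 0 < ∫ x, x ∂μ := by
  rw [integral_pos_iff_support_of_nonneg_ae hμ hint]
  exact hpos.trans_le (measure_mono fun x (hx : 0 < x) => hx.ne')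

/-! ### Tools: independence and a renewal equation for expectations -/

lemma lintegral_prodMk_of_indepFun {Ω α β : Type*} [MeasurableSpace Ω] [MeasurableSpace α]
    [MeasurableSpace β] {P : Measure Ω} [IsProbabilityMeasure P] {f : Ω → α} {g : Ω → β}
    (hfg : IndepFun f g P) (hf : Measurable f) (hg : Measurable g) {F : α → β → ℝ≥0∞}
    (hF : Measurable (Function.uncurry F)) :
    ∫⁻ ω, F (f ω) (g ω) ∂P = ∫⁻ ω, ∫⁻ b, F (f ω) b ∂(P.map g) ∂P := by
  have := Measure.isProbabilityMeasure_map (μ := P) hg.aemeasurable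
  have := Measure.isProbabilityMeasure_map (μ := P) hf.aemeasurable
  have h := (indepFun_iff_map_prod_eq_prod_map_map hf.aemeasurable hg.aemeasurable).1 hfg
  calc ∫⁻ ω, F (f ω) (g ω) ∂P
      = ∫⁻ z, Function.uncurry F z ∂(P.map fun ω => (f ω, g ω)) := by
        rw [lintegral_map hF (hf.prodMk hg)]; rfl
    _ = ∫⁻ a, ∫⁻ b, F a b ∂(P.map g) ∂(P.map f) := by
        rw [h, lintegral_prod _ hF.aemeasurable]; rfl
    _ = _ := by
        rw [lintegral_map _ hf]
        exact hF.lintegral_prod_right'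

/-- If `F = ξ + 1_c · F ∘ τ`, where on `c` the map `τ` reproduces the law up to the factor
`p < 1`, then `E[F] = E[ξ] / (1 - p)`. -/
lemma lintegral_of_renewal_equation {E : Type*} [MeasurableSpace E] {ν : Measure E}
    [IsProbabilityMeasure ν] {F ξ : E → ℝ≥0∞} {c : Set E} {τ : E → E} {p A : ℝ}
    (hF : Measurable F) (hξ : Measurable ξ)
    (hp0 : 0 ≤ p) (hp1 : p < 1) (hA : 0 ≤ A)
    (hτ : ∀ f : E → ℝ≥0∞, Measurable f →
      ∫⁻ ω, c.indicator (fun ω => f (τ ω)) ω ∂ν = ENNReal.ofReal p * ∫⁻ ω, f ω ∂ν)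
    (hrec : ∀ᵐ ω ∂ν, F ω = ξ ω + c.indicator (fun ω => F (τ ω)) ω)
    (hA' : ∫⁻ ω, ξ ω ∂ν = ENNReal.ofReal A) :
    ∫⁻ ω, F ω ∂ν = ENNReal.ofReal (A / (1 - p)) := by
  have h1p : 0 < 1 - p := by linarith
  -- E[F] is not known to be finite, so it cannot be cancelled directly. Truncation at `N` makes it
  -- finite, and min(x + y, N) ≤ x + min(y, N) keeps the recursion as an inequality.
  have key : ∀ N : ℕ, ∫⁻ ω, min (F ω) N ∂ν ≤ ENNReal.ofReal (A / (1 - p)) := by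
    intro N
    have hm : Measurable fun ω => min (F ω) (N : ℝ≥0∞) := hF.min measurable_const
    have hfin : ∫⁻ ω, min (F ω) (N : ℝ≥0∞) ∂ν ≠ ∞ := by
      refine ne_top_of_le_ne_top (b := (N : ℝ≥0∞)) (by simp) ?_
      calc _ ≤ ∫⁻ _, (N : ℝ≥0∞) ∂ν := lintegral_mono fun ω => min_le_right _ _
        _ = N := by simp
    have hle : ∫⁻ ω, min (F ω) (N : ℝ≥0∞) ∂ν ≤
        ENNReal.ofReal A + ENNReal.ofReal p * ∫⁻ ω, min (F ω) (N : ℝ≥0∞) ∂ν := by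
      rw [← hA', ← hτ _ hm, ← lintegral_add_left hξ]
      refine lintegral_mono_ae ?_
      filter_upwards [hrec] with ω hω
      rw [hω]
      by_cases h : ω ∈ c
      · simp only [indicator_of_mem h]
        rcases le_total (F (τ ω)) (N : ℝ≥0∞) with h' | h'
        · rw [min_eq_left h']; exact min_le_left _ _
        · rw [min_eq_right h']; exact (min_le_right _ _).trans le_add_self
      · simp [indicator_of_notMem h]
    lift ∫⁻ ω, min (F ω) (N : ℝ≥0∞) ∂ν to NNReal using hfin with m hm
    rw [← ENNReal.ofReal_coe_nnreal, ← ENNReal.ofReal_mul hp0, ← ENNReal.ofReal_add hA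
      (by positivity), ENNReal.ofReal_le_ofReal_iff (by positivity)] at hle
    rw [← ENNReal.ofReal_coe_nnreal]
    refine ENNReal.ofReal_le_ofReal ?_
    rw [le_div_iff₀ h1p]
    linarith
  have hle : ∫⁻ ω, F ω ∂ν ≤ ENNReal.ofReal (A / (1 - p)) := by
    have h1 : ∀ ω, F ω = ⨆ N : ℕ, min (F ω) (N : ℝ≥0∞) := by
      intro ω
      rw [← inf_iSup_eq, ENNReal.iSup_natCast]
      simp
    rw [lintegral_congr h1, lintegral_iSup (fun N => hF.min measurable_const)]
    · exact iSup_le key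
    · intro i j hij ω
      exact min_le_min_left _ (by exact_mod_cast hij)
  have heq : ∫⁻ ω, F ω ∂ν = ENNReal.ofReal A + ENNReal.ofReal p * ∫⁻ ω, F ω ∂ν := by
    conv_lhs => rw [lintegral_congr_ae hrec, lintegral_add_left hξ, hA', hτ F hF]
  have hfin : ∫⁻ ω, F ω ∂ν ≠ ∞ := ne_top_of_le_ne_top ENNReal.ofReal_ne_top hle
  lift ∫⁻ ω, F ω ∂ν to NNReal using hfin with m hm
  rw [← ENNReal.ofReal_coe_nnreal, ← ENNReal.ofReal_mul hp0, ← ENNReal.ofReal_add hA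
      (by positivity), ENNReal.ofReal_eq_ofReal_iff (by positivity) (by positivity)] at heq
  rw [← ENNReal.ofReal_coe_nnreal]
  congr 1
  rw [eq_div_iff h1p.ne']
  linarith

/-- The variables may have infinite mean; the strong law is applied to min(Z, 1), whose mean is
finite and positive. -/
lemma tendsto_sum_atTop_of_iid {Ω : Type*} [MeasurableSpace Ω] {P : Measure Ω}
    [IsProbabilityMeasure P] {Z : ℕ → Ω → ℝ}
    (hindep : Pairwise fun i j => IndepFun (Z i) (Z j) P)
    (hident : ∀ i, IdentDistrib (Z i) (Z 0) P P) (hnn : ∀ i, ∀ᵐ ω ∂P, 0 ≤ Z i ω)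
    (hpos : 0 < P {ω | 0 < Z 0 ω}) :
    ∀ᵐ ω ∂P, Tendsto (fun n => ∑ i ∈ Finset.range n, Z i ω) atTop atTop := by
  have hm : Measurable fun x : ℝ => min x 1 := by fun_prop
  have hint : Integrable (fun ω => min (Z 0 ω) 1) P := by
    refine Integrable.mono' (integrable_const 1)
      (hm.comp_aemeasurable (hident 0).aemeasurable_fst).aestronglyMeasurable ?_
    filter_upwards [hnn 0] with ω hω
    rw [Real.norm_eq_abs, abs_of_nonneg (le_min hω zero_le_one)]
    exact min_le_right _ _
  have hmean : 0 < ∫ ω, min (Z 0 ω) 1 ∂P := by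
    rw [integral_pos_iff_support_of_nonneg_ae _ hint]
    · refine hpos.trans_le (measure_mono fun ω (hω : 0 < Z 0 ω) => ?_)
      exact (lt_min hω one_pos).ne'
    · filter_upwards [hnn 0] with ω hω using le_min hω zero_le_one
  have h := strong_law_ae_real (fun i ω => min (Z i ω) 1) hint
    (fun i j hij => (hindep hij).comp hm hm) (fun i => (hident i).comp hm)
  filter_upwards [h] with ω hω
  have h1 := hω.pos_mul_atTop hmean (tendsto_natCast_atTop_atTop (R := ℝ))
  refine tendsto_atTop_mono' _ ?_ h1
  filter_upwards [eventually_gt_atTop 0] with n hn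
  have hn' : (n : ℝ) ≠ 0 := by positivity
  rw [div_mul_cancel₀ _ hn']
  exact Finset.sum_le_sum fun i _ => min_le_left _ _

/-! ### The stream of primitive random variables -/

/-- A stream of inter-arrival times, processing times and vacation lengths. -/
abbrev Stream : Type := ℕ ⊕ ℕ ⊕ ℕ → ℝ

/-- the inter-arrival times -/
def xs (ω : Stream) (i : ℕ) : ℝ := ω (Sum.inl i)
/-- the processing times -/
def hs (ω : Stream) (i : ℕ) : ℝ := ω (Sum.inr (Sum.inl i))
/-- the vacation lengths -/
def vs (ω : Stream) (i : ℕ) : ℝ := ω (Sum.inr (Sum.inr i))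

@[fun_prop] lemma measurable_xs (i : ℕ) : Measurable fun ω : Stream => xs ω i :=
  measurable_pi_apply _
@[fun_prop] lemma measurable_hs (i : ℕ) : Measurable fun ω : Stream => hs ω i :=
  measurable_pi_apply _
@[fun_prop] lemma measurable_vs (i : ℕ) : Measurable fun ω : Stream => vs ω i :=
  measurable_pi_apply _

/-- Drop the first `p` inter-arrival times, `q` processing times and `r` vacations. -/
def shift (p q r : ℕ) (ω : Stream) : Stream :=
  fun i => ω (Sum.map (p + ·) (Sum.map (q + ·) (r + ·)) i)

/-- Keep the first `p` inter-arrival times, `q` processing times and `r` vacations. -/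
def past (p q r : ℕ) (ω : Stream) : Stream
  | Sum.inl i => if i < p then ω (Sum.inl i) else 0
  | Sum.inr (Sum.inl i) => if i < q then ω (Sum.inr (Sum.inl i)) else 0
  | Sum.inr (Sum.inr i) => if i < r then ω (Sum.inr (Sum.inr i)) else 0

/-- Shorten the first inter-arrival time by `u`. -/
def delay (u : ℝ) (ω : Stream) : Stream := fun i => if i = Sum.inl 0 then ω i - u else ω i

@[simp] lemma xs_shift (p q r : ℕ) (ω : Stream) (i : ℕ) : xs (shift p q r ω) i = xs ω (p + i) := rfl
@[simp] lemma hs_shift (p q r : ℕ) (ω : Stream) (i : ℕ) : hs (shift p q r ω) i = hs ω (q + i) := rfl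
@[simp] lemma vs_shift (p q r : ℕ) (ω : Stream) (i : ℕ) : vs (shift p q r ω) i = vs ω (r + i) := rfl
lemma xs_past (p q r : ℕ) (ω : Stream) (i : ℕ) :
    xs (past p q r ω) i = if i < p then xs ω i else 0 := rfl
lemma hs_past (p q r : ℕ) (ω : Stream) (i : ℕ) :
    hs (past p q r ω) i = if i < q then hs ω i else 0 := rfl
lemma vs_past (p q r : ℕ) (ω : Stream) (i : ℕ) :
    vs (past p q r ω) i = if i < r then vs ω i else 0 := rfl
@[simp] lemma xs_delay_zero (u : ℝ) (ω : Stream) : xs (delay u ω) 0 = xs ω 0 - u := rfl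
@[simp] lemma xs_delay_succ (u : ℝ) (ω : Stream) (i : ℕ) :
    xs (delay u ω) (i + 1) = xs ω (i + 1) := by simp [xs, delay]
@[simp] lemma hs_delay (u : ℝ) (ω : Stream) (i : ℕ) : hs (delay u ω) i = hs ω i := by
  simp [hs, delay]
@[simp] lemma vs_delay (u : ℝ) (ω : Stream) (i : ℕ) : vs (delay u ω) i = vs ω i := by
  simp [vs, delay]

lemma stream_ext {ω ω' : Stream} (hx : ∀ i, xs ω i = xs ω' i) (hh : ∀ i, hs ω i = hs ω' i)
    (hv : ∀ i, vs ω i = vs ω' i) : ω = ω' := by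
  funext i
  rcases i with i | i | i
  exacts [hx i, hh i, hv i]

lemma measurable_shift (p q r : ℕ) : Measurable (shift p q r) :=
  measurable_pi_lambda _ fun _ => measurable_pi_apply _

lemma measurable_past (p q r : ℕ) : Measurable (past p q r) := by
  refine measurable_pi_lambda _ fun i => ?_
  rcases i with i | i | i <;> simp only [past] <;> split_ifs <;> fun_prop

lemma measurable_delay : Measurable fun z : ℝ × Stream => delay z.1 z.2 := by
  refine measurable_pi_lambda _ fun i => ?_
  simp only [delay]
  split_ifs <;> fun_prop

/-- The laws of the coordinates of the stream. -/
noncomputable def coordLaw (lam : ℝ) (μH μV : Measure ℝ) : ℕ ⊕ ℕ ⊕ ℕ → Measure ℝ :=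
  Sum.elim (fun _ => expMeasure lam) (Sum.elim (fun _ => μH) (fun _ => μV))

/-- The law of the stream. -/
noncomputable def streamLaw (lam : ℝ) (μH μV : Measure ℝ) : Measure Stream :=
  Measure.infinitePi (coordLaw lam μH μV)

variable {lam : ℝ} {μH μV : Measure ℝ} [hlam : Fact (0 < lam)] [IsProbabilityMeasure μH]
  [IsProbabilityMeasure μV]

instance isProbabilityMeasure_coordLaw (i : ℕ ⊕ ℕ ⊕ ℕ) :
    IsProbabilityMeasure (coordLaw lam μH μV i) := by
  rcases i with i | i | i
  · exact isProbabilityMeasure_expMeasure hlam.out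
  · assumption
  · assumption

instance isProbabilityMeasure_streamLaw : IsProbabilityMeasure (streamLaw lam μH μV) := by
  unfold streamLaw; infer_instance

lemma iIndepFun_stream : iIndepFun (fun i (ω : Stream) => ω i) (streamLaw lam μH μV) :=
  iIndepFun_infinitePi (P := coordLaw lam μH μV) (X := fun _ x => x) fun _ => measurable_id

lemma map_xs (i : ℕ) : (streamLaw lam μH μV).map (fun ω => xs ω i) = expMeasure lam :=
  Measure.infinitePi_map_eval (coordLaw lam μH μV) (Sum.inl i)
lemma map_hs (i : ℕ) : (streamLaw lam μH μV).map (fun ω => hs ω i) = μH :=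
  Measure.infinitePi_map_eval (coordLaw lam μH μV) (Sum.inr (Sum.inl i))
lemma map_vs (i : ℕ) : (streamLaw lam μH μV).map (fun ω => vs ω i) = μV :=
  Measure.infinitePi_map_eval (coordLaw lam μH μV) (Sum.inr (Sum.inr i))

lemma map_shift (p q r : ℕ) :
    (streamLaw lam μH μV).map (shift p q r) = streamLaw lam μH μV := by
  refine Measure.eq_infinitePi _ fun s t ht => ?_
  have hinj : Function.Injective (Sum.map (p + ·) (Sum.map (q + ·) (r + ·)) :
      ℕ ⊕ ℕ ⊕ ℕ → ℕ ⊕ ℕ ⊕ ℕ) :=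
    (add_right_injective p).sumMap ((add_right_injective q).sumMap (add_right_injective r))
  have hpre := (iIndepFun_stream (lam := lam) (μH := μH) (μV := μV)).precomp hinj
  rw [Measure.map_apply (measurable_shift p q r) (.pi s.countable_toSet fun i _ => ht i)]
  have h := hpre.measure_inter_preimage_eq_mul s (sets := t) fun i _ => ht i
  have he : shift p q r ⁻¹' Set.pi s t = ⋂ i ∈ s, (fun ω : Stream =>
      ω (Sum.map (p + ·) (Sum.map (q + ·) (r + ·)) i)) ⁻¹' t i := by
    ext ω; simp [shift, Set.mem_pi]
  rw [he, h]
  refine Finset.prod_congr rfl fun i _ => ?_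
  rw [← Measure.map_apply (f := fun ω : Stream =>
    ω (Sum.map (p + ·) (Sum.map (q + ·) (r + ·)) i)) (measurable_pi_apply _) (ht i)]
  rcases i with i | i | i
  · exact DFunLike.congr_fun (map_xs (lam := lam) (μH := μH) (μV := μV) (p + i)) _
  · exact DFunLike.congr_fun (map_hs (lam := lam) (μH := μH) (μV := μV) (q + i)) _
  · exact DFunLike.congr_fun (map_vs (lam := lam) (μH := μH) (μV := μV) (r + i)) _

/-- `shift` reads the coordinates in the range of `φ` and `past` only the others; disjoint families
of independent coordinates are independent. -/
lemma indepFun_past_shift (p q r : ℕ) :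
    IndepFun (past p q r) (shift p q r) (streamLaw lam μH μV) := by
  set φ : ℕ ⊕ ℕ ⊕ ℕ → ℕ ⊕ ℕ ⊕ ℕ := Sum.map (p + ·) (Sum.map (q + ·) (r + ·)) with hφ
  have h := indep_iSup_of_disjoint
    (m := fun i : ℕ ⊕ ℕ ⊕ ℕ => MeasurableSpace.comap (fun ω : Stream => ω i) inferInstance)
    (fun i => (measurable_pi_apply i).comap_le)
    (iIndepFun_stream (lam := lam) (μH := μH) (μV := μV)) (disjoint_compl_left (a := range φ))
  have hle : ∀ (S : Set (ℕ ⊕ ℕ ⊕ ℕ)), ∀ i ∈ S, Measurable[⨆ i ∈ S,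
      MeasurableSpace.comap (fun ω : Stream => ω i) inferInstance] fun ω : Stream => ω i :=
    fun S i hi => Measurable.mono (comap_measurable _) (le_iSup₂_of_le i hi le_rfl) le_rfl
  refine indep_of_indep_of_le_left (indep_of_indep_of_le_right h ?_) ?_
  · refine Measurable.comap_le ?_
    exact @measurable_pi_lambda _ _ _ (_) _ _ fun i => hle _ (φ i) (mem_range_self i)
  · refine Measurable.comap_le ?_
    refine @measurable_pi_lambda _ _ _ (_) _ _ fun i => ?_
    rcases i with i | i | i <;> simp only [past] <;> split_ifs with hi
    · refine hle _ _ ?_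
      rintro ⟨j | j | j, hj⟩ <;> simp [hφ] at hj; omega
    · exact measurable_const
    · refine hle _ _ ?_
      rintro ⟨j | j | j, hj⟩ <;> simp [hφ] at hj; omega
    · exact measurable_const
    · refine hle _ _ ?_
      rintro ⟨j | j | j, hj⟩ <;> simp [hφ] at hj; omega
    · exact measurable_const

/-- The stream property is preserved when the first inter-arrival time is conditioned to be larger
than `u`, and shortened by `u`. -/
lemma lintegral_delay {u : ℝ} (hu : 0 ≤ u) {f : Stream → ℝ≥0∞} (hf : Measurable f) :
    ∫⁻ ω, {ω | u < xs ω 0}.indicator (fun ω => f (delay u ω)) ω ∂(streamLaw lam μH μV) =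
      ENNReal.ofReal (Real.exp (-(lam * u))) * ∫⁻ ω, f ω ∂(streamLaw lam μH μV) := by
  set ν := streamLaw lam μH μV
  have hm : Measurable (delay u) := measurable_delay.comp (measurable_const.prodMk measurable_id)
  have hs : MeasurableSet {ω : Stream | u < xs ω 0} :=
    measurableSet_lt measurable_const (by fun_prop)
  set e := ENNReal.ofReal (Real.exp (-(lam * u))) with he
  have he0 : e ≠ 0 := by simp [he, Real.exp_pos]
  have het : e ≠ ∞ := ENNReal.ofReal_ne_top
  -- The law conditioned on x₀ > u and pushed through `delay` is compared with the product measure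
  -- on boxes. Only the coordinate `Sum.inl 0` is affected, and there memorylessness applies.
  have key : e⁻¹ • (ν.restrict {ω | u < xs ω 0}).map (delay u) = ν := by
    refine Measure.eq_infinitePi _ fun s t ht => ?_
    rw [Measure.smul_apply, Measure.map_apply hm (.pi s.countable_toSet fun i _ => ht i),
      Measure.restrict_apply (hm (.pi s.countable_toSet fun i _ => ht i))]
    classical
    -- The sides of the box pulled back by `delay`, together with the conditioning x₀ > u. That
    -- condition is present even if the box leaves the coordinate `Sum.inl 0` free, hence the
    -- implication.
    set t' : ℕ ⊕ ℕ ⊕ ℕ → Set ℝ := fun i =>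
      if i = Sum.inl 0 then {x | u < x ∧ (Sum.inl 0 ∈ s → x - u ∈ t (Sum.inl 0))} else t i with ht'
    have h1 : delay u ⁻¹' Set.pi s t ∩ {ω | u < xs ω 0} =
        Set.pi (insert (Sum.inl 0) s : Finset (ℕ ⊕ ℕ ⊕ ℕ)) t' := by
      ext ω
      simp only [mem_inter_iff, mem_preimage, Set.mem_pi, Finset.mem_coe, mem_ofPred_eq,
        Finset.mem_insert, forall_eq_or_imp, ht', if_true, delay, xs]
      constructor
      · rintro ⟨h, h'⟩
        refine ⟨⟨h', fun h0 => by simpa using h _ h0⟩, fun i hi => ?_⟩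
        split_ifs with h0
        · subst h0; exact ⟨h', fun _ => by simpa using h _ hi⟩
        · simpa [h0] using h i hi
      · rintro ⟨⟨h', h0⟩, h⟩
        refine ⟨fun i hi => ?_, h'⟩
        split_ifs with hi0
        · subst hi0; exact h0 hi
        · simpa [hi0] using h i hi
    have hmt' : ∀ i ∈ insert (Sum.inl 0) s, MeasurableSet (t' i) := by
      intro i _
      simp only [ht']
      split_ifs
      · by_cases h0 : Sum.inl 0 ∈ s
        · simp only [h0, true_imp_iff]
          exact measurableSet_Ioi.inter ((measurable_id.sub_const u) (ht _))
        · simp only [h0, false_imp_iff, and_true]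
          exact measurableSet_Ioi
      · exact ht i
    have hrest : ∏ i ∈ s.erase (Sum.inl 0), coordLaw lam μH μV i (t' i) =
        ∏ i ∈ s.erase (Sum.inl 0), coordLaw lam μH μV i (t i) := by
      refine Finset.prod_congr rfl fun i hi => ?_
      rw [Finset.mem_erase] at hi
      simp [ht', hi.1]
    rw [h1]
    change e⁻¹ • Measure.infinitePi (coordLaw lam μH μV) _ = _
    rw [Measure.infinitePi_pi _ hmt', smul_eq_mul]
    by_cases h0 : Sum.inl 0 ∈ s
    · rw [Finset.insert_eq_of_mem h0, ← Finset.mul_prod_erase _ _ h0, hrest,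
        ← Finset.mul_prod_erase _ _ h0, ← mul_assoc]
      congr 1
      have := expMeasure_memoryless lam (ht (Sum.inl 0)) hu
      simp only [ht', if_true, h0, true_imp_iff]
      change e⁻¹ * expMeasure lam _ = expMeasure lam _
      rw [this, ← mul_assoc, ENNReal.inv_mul_cancel he0 het, one_mul]
    · rw [Finset.prod_insert h0, ← mul_assoc]
      rw [Finset.erase_eq_of_notMem h0] at hrest
      rw [hrest]
      have : e⁻¹ * coordLaw lam μH μV (Sum.inl 0) (t' (Sum.inl 0)) = 1 := by
        simp only [ht', if_true, h0, false_imp_iff, and_true]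
        change e⁻¹ * expMeasure lam (Ioi u) = 1
        rw [expMeasure_Ioi hlam.out hu, ENNReal.inv_mul_cancel he0 het]
      rw [this, one_mul]
  rw [lintegral_indicator hs, ← lintegral_map hf hm]
  conv_rhs => rw [← key, lintegral_smul_measure, smul_eq_mul, ← mul_assoc,
    ENNReal.mul_inv_cancel he0 het, one_mul]

/-- Regeneration: the stream seen from the time at which all of `past p q r` and the part `U` of
the inter-arrival time `p` has been used. -/
lemma lintegral_mul_delay_shift (p q r : ℕ) {g : Stream → ℝ≥0∞} {U : Stream → ℝ}
    {f : Stream → ℝ≥0∞} (hg : Measurable g) (hU : Measurable U) (hf : Measurable f)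
    (hgp : ∀ ω, g (past p q r ω) = g ω) (hUp : ∀ ω, U (past p q r ω) = U ω)
    (hU0 : ∀ᵐ ω ∂(streamLaw lam μH μV), g ω ≠ 0 → 0 ≤ U ω) :
    ∫⁻ ω, g ω * {ω | U ω < xs ω p}.indicator (fun ω => f (delay (U ω) (shift p q r ω))) ω
        ∂(streamLaw lam μH μV) =
      (∫⁻ ω, g ω * ENNReal.ofReal (Real.exp (-(lam * U ω))) ∂(streamLaw lam μH μV)) *
        ∫⁻ ω, f ω ∂(streamLaw lam μH μV) := by
  set ν := streamLaw lam μH μV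
  have hfd : Measurable fun z : Stream × Stream => f (delay (U z.1) z.2) :=
    hf.comp (measurable_delay.comp ((hU.comp measurable_fst).prodMk measurable_snd))
  have hF : Measurable (Function.uncurry fun ω σ : Stream =>
      g ω * {σ | U ω < xs σ 0}.indicator (fun σ => f (delay (U ω) σ)) σ) := by
    have : MeasurableSet {z : Stream × Stream | U z.1 < xs z.2 0} :=
      measurableSet_lt (hU.comp measurable_fst) ((measurable_xs 0).comp measurable_snd)
    exact (hg.comp measurable_fst).mul (hfd.indicator this)
  have h := lintegral_prodMk_of_indepFun (indepFun_past_shift (lam := lam) (μH := μH) (μV := μV)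
    p q r) (measurable_past p q r) (measurable_shift p q r) hF
  simp only [hgp, hUp, map_shift] at h
  refine Eq.trans ?_ (h.trans ?_)
  · refine lintegral_congr fun ω => ?_
    simp [indicator]
  · rw [← lintegral_mul_const _ (by fun_prop)]
    refine lintegral_congr_ae ?_
    filter_upwards [hU0] with ω hω
    by_cases h0 : g ω = 0
    · simp [h0]
    · have hm : Measurable ({σ : Stream | U ω < xs σ 0}.indicator fun σ => f (delay (U ω) σ)) :=
        (hfd.comp (measurable_const.prodMk measurable_id)).indicator
          (measurableSet_lt measurable_const (by fun_prop))
      rw [lintegral_const_mul _ hm, lintegral_delay (hω h0) hf, mul_assoc]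

lemma lintegral_mul_shift (p q r : ℕ) {g : Stream → ℝ≥0∞}
    {f : Stream → ℝ≥0∞} (hg : Measurable g) (hf : Measurable f)
    (hgp : ∀ ω, g (past p q r ω) = g ω) :
    ∫⁻ ω, g ω * f (shift p q r ω) ∂(streamLaw lam μH μV) =
      (∫⁻ ω, g ω ∂(streamLaw lam μH μV)) * ∫⁻ ω, f ω ∂(streamLaw lam μH μV) := by
  have hF : Measurable (Function.uncurry fun ω σ : Stream => g ω * f σ) :=
    (hg.comp measurable_fst).mul (hf.comp measurable_snd)
  have h := lintegral_prodMk_of_indepFun (indepFun_past_shift (lam := lam) (μH := μH) (μV := μV)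
    p q r) (measurable_past p q r) (measurable_shift p q r) hF
  simp only [hgp, map_shift] at h
  rw [h, ← lintegral_mul_const _ hg]
  exact lintegral_congr fun ω => lintegral_const_mul _ hf

/-! ### Independence of past and future at a random regeneration time -/

section Regeneration

variable {lam : ℝ} {μH μV : Measure ℝ} [hlam : Fact (0 < lam)] [IsProbabilityMeasure μH]
  [IsProbabilityMeasure μV]

/-- If on each of countably many pieces, determined by the past up to the requirement `U < x_p`,
`out` is a function of the past and `θ` is the future stream, then `θ ω` is a new stream
independent of `out ω`. -/
lemma indepFun_of_pieces {ι β : Type*} [Countable ι] [MeasurableSpace β] (p q r : ι → ℕ)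
    (A : ι → Set Stream) (U : ι → Stream → ℝ) (o : ι → Stream → β) (N : Stream → ι)
    {out : Stream → β} {θ : Stream → Stream} (hout : Measurable out) (hθ : Measurable θ)
    (hA : ∀ i, MeasurableSet (A i)) (hU : ∀ i, Measurable (U i)) (ho : ∀ i, Measurable (o i))
    (hAp : ∀ i ω, past (p i) (q i) (r i) ω ∈ A i ↔ ω ∈ A i)
    (hUp : ∀ i ω, U i (past (p i) (q i) (r i) ω) = U i ω)
    (hop : ∀ i ω, o i (past (p i) (q i) (r i) ω) = o i ω)
    (hU0 : ∀ i, ∀ᵐ ω ∂(streamLaw lam μH μV), ω ∈ A i → 0 ≤ U i ω)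
    (hN : ∀ᵐ ω ∂(streamLaw lam μH μV), ∀ i, N ω = i ↔ ω ∈ A i ∧ U i ω < xs ω (p i))
    (hout' : ∀ ω, out ω = o (N ω) ω)
    (hθ' : ∀ ω, θ ω = delay (U (N ω) ω) (shift (p (N ω)) (q (N ω)) (r (N ω)) ω)) :
    IndepFun out θ (streamLaw lam μH μV) ∧
      (streamLaw lam μH μV).map θ = streamLaw lam μH μV := by
  set ν := streamLaw lam μH μV with hν
  have hB : ∀ i, ∀ O : Set β, MeasurableSet O → MeasurableSet (A i ∩ o i ⁻¹' O) :=
    fun i O hO => (hA i).inter (ho i hO)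
  -- For fixed `O`, the joint probability is a constant times ν(C). Taking O = univ shows that θ
  -- preserves the law; taking C = univ identifies the constant as the probability of `out ∈ O`.
  have key : ∀ O : Set β, MeasurableSet O → ∃ κ : ℝ≥0∞, ∀ C : Set Stream, MeasurableSet C →
      ν (out ⁻¹' O ∩ θ ⁻¹' C) = κ * ν C := by
    intro O hO
    refine ⟨∑' i, ∫⁻ ω, (A i ∩ o i ⁻¹' O).indicator 1 ω *
      ENNReal.ofReal (Real.exp (-(lam * U i ω))) ∂ν, fun C hC => ?_⟩
    have hmeas : ∀ i, Measurable fun ω => (A i ∩ o i ⁻¹' O).indicator (1 : Stream → ℝ≥0∞) ω *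
        {ω | U i ω < xs ω (p i)}.indicator
          (fun ω => C.indicator (1 : Stream → ℝ≥0∞) (delay (U i ω) (shift (p i) (q i)
              (r i) ω))) ω := by
      intro i
      refine (measurable_one.indicator (hB i O hO)).mul (Measurable.indicator ?_ ?_)
      · exact (measurable_one.indicator hC).comp
          (measurable_delay.comp ((hU i).prodMk (measurable_shift _ _ _)))
      · exact measurableSet_lt (hU i) (by fun_prop)
    rw [← ENNReal.tsum_mul_right, ← lintegral_indicator_one ((hout hO).inter (hθ hC))]
    have : ∀ i, (∫⁻ ω, (A i ∩ o i ⁻¹' O).indicator 1 ω *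
        ENNReal.ofReal (Real.exp (-(lam * U i ω))) ∂ν) * ν C =
        ∫⁻ ω, (A i ∩ o i ⁻¹' O).indicator (1 : Stream → ℝ≥0∞) ω *
          {ω | U i ω < xs ω (p i)}.indicator
          (fun ω => C.indicator (1 : Stream → ℝ≥0∞)
            (delay (U i ω) (shift (p i) (q i) (r i) ω))) ω ∂ν := by
      intro i
      rw [lintegral_mul_delay_shift (p i) (q i) (r i) (measurable_one.indicator (hB i O hO)) (hU i)
        (measurable_one.indicator hC) _ (hUp i), lintegral_indicator_one hC]
      · filter_upwards [hU0 i] with ω hω h0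
        exact hω (mem_of_indicator_ne_zero h0).1
      · intro ω
        have h1 : past (p i) (q i) (r i) ω ∈ A i ∩ o i ⁻¹' O ↔ ω ∈ A i ∩ o i ⁻¹' O := by
          rw [mem_inter_iff, mem_inter_iff, hAp, mem_preimage, mem_preimage, hop]
        by_cases h2 : ω ∈ A i ∩ o i ⁻¹' O
        · rw [indicator_of_mem h2, indicator_of_mem (h1.2 h2)]; rfl
        · rw [indicator_of_notMem h2, indicator_of_notMem (mt h1.1 h2)]
    simp_rw [this]
    rw [← lintegral_tsum fun i => (hmeas i).aemeasurable]
    refine lintegral_congr_ae ?_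
    filter_upwards [hN] with ω hω
    have h1 := (hω (N ω)).1 rfl
    -- The pieces partition the space up to a null set, so only the piece with index `N ω`
    -- contributes.
    rw [tsum_eq_single (N ω)]
    · have h3 : ω ∈ {ω' | U (N ω) ω' < xs ω' (p (N ω))} := h1.2
      rw [indicator_of_mem h3, ← hθ']
      have h2 : out ω ∈ O ↔ o (N ω) ω ∈ O := by rw [hout']
      by_cases h4 : o (N ω) ω ∈ O <;> by_cases h5 : θ ω ∈ C
      · rw [indicator_of_mem (show ω ∈ out ⁻¹' O ∩ θ ⁻¹' C from ⟨h2.2 h4, h5⟩),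
          indicator_of_mem (show ω ∈ A (N ω) ∩ o (N ω) ⁻¹' O from ⟨h1.1, h4⟩), indicator_of_mem h5]
        simp
      · rw [indicator_of_notMem (fun h => h5 h.2), indicator_of_notMem h5, mul_zero]
      all_goals rw [indicator_of_notMem (fun h => h4 (h2.1 h.1)),
        indicator_of_notMem (fun h => h4 h.2), zero_mul]
    · intro i hi
      have h2 : ¬ (ω ∈ A i ∧ U i ω < xs ω (p i)) := fun h => hi ((hω i).2 h).symm
      by_cases h3 : ω ∈ A i
      · have h4 : ω ∉ {ω | U i ω < xs ω (p i)} := fun h => h2 ⟨h3, h⟩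
        rw [indicator_of_notMem h4, mul_zero]
      · rw [indicator_of_notMem (fun h => h3 h.1), zero_mul]
  have hmap : ν.map θ = ν := by
    obtain ⟨κ, hκ⟩ := key univ .univ
    have h1 : κ = 1 := by simpa using (hκ univ .univ).symm
    ext C hC
    rw [Measure.map_apply hθ hC]
    simpa [h1] using hκ C hC
  refine ⟨?_, hmap⟩
  rw [indepFun_iff_measure_inter_preimage_eq_mul]
  intro O C hO hC
  obtain ⟨κ, hκ⟩ := key O hO
  have h1 : ν (out ⁻¹' O) = κ := by simpa using hκ univ .univ
  rw [hκ C hC, h1, ← Measure.map_apply hθ hC, hmap]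

end Regeneration

/-! ### First indices: characterization and measurability -/

lemma sInf_setOf_eq_iff {p : ℕ → Prop} (hp : ∃ n, p n) (n : ℕ) :
    sInf {m | p m} = n ↔ p n ∧ ∀ m < n, ¬ p m := by
  constructor
  · rintro rfl
    exact ⟨Nat.sInf_mem hp, fun m hm => Nat.notMem_of_lt_sInf hm⟩
  · rintro ⟨h1, h2⟩
    exact le_antisymm (Nat.sInf_le h1) (not_lt.1 fun h => h2 _ h (Nat.sInf_mem hp))

lemma measurable_sInf_nat {α : Type*} [MeasurableSpace α] {p : ℕ → α → Prop}
    (hp : ∀ n, MeasurableSet {a | p n a}) : Measurable fun a => sInf {n | p n a} := by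
  refine measurable_to_countable' fun n => ?_
  -- Since `sInf ∅ = 0`, the preimage of 0 also contains the points at which no index qualifies;
  -- this is the second part of the union.
  have : (fun a => sInf {n | p n a}) ⁻¹' {n} =
      ({a | p n a} ∩ ⋂ m ∈ Iio n, {a | p m a}ᶜ) ∪ ({a | n = 0} ∩ ⋂ m, {a | p m a}ᶜ) := by
    ext a
    by_cases h : ∃ m, p m a
    · have h' : ¬ ∀ m, ¬ p m a := by push Not; exact h
      simp [sInf_setOf_eq_iff h, h']
    · push Not at h
      simp [h, eq_comm]
  rw [this]
  refine ((hp n).inter (.biInter (to_countable _) fun m _ => (hp m).compl)).union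
    (.inter (.const _) (.iInter fun m => (hp m).compl))

lemma measurable_comp_nat {α β : Type*} [MeasurableSpace α] [MeasurableSpace β] {N : α → ℕ}
    {f : ℕ → α → β} (hN : Measurable N) (hf : ∀ n, Measurable (f n)) :
    Measurable fun a => f (N a) a :=
  (measurable_from_prod_countable_left (f := fun z : α × ℕ => f z.2 z.1) hf).comp
    (measurable_id.prodMk hN)

/-! ### One cycle of the server, as a function of the stream -/

/-- total length of the first `m` vacations -/
noncomputable def vacSum (ω : Stream) (m : ℕ) : ℝ := ∑ i ∈ Finset.range m, vs ω i

/-- the index of the vacation during which the first packet arrives -/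
noncomputable def numVac (ω : Stream) : ℕ := sInf {m | xs ω 0 ≤ vacSum ω (m + 1)}

/-- the total length of the vacations of a cycle -/
noncomputable def vacTime (ω : Stream) : ℝ := vacSum ω (numVac ω + 1)

/-- the last packet that arrives during the vacations -/
noncomputable def lastArr (ω : Stream) : ℕ := sInf {j | vacTime ω < arrivalTime (xs ω) (j + 1)}

/-- the age of the buffered packet at the end of the vacations -/
noncomputable def bufAge (ω : Stream) : ℝ := vacTime ω - arrivalTime (xs ω) (lastArr ω)

/-- the stream seen from the end of the vacations; its first processing time is the one of the
packet in the buffer -/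
noncomputable def afterVac (ω : Stream) : Stream :=
  delay (bufAge ω) (shift (lastArr ω + 1) (lastArr ω) (numVac ω + 1) ω)

lemma xs_afterVac_succ (ω : Stream) (i : ℕ) :
    xs (afterVac ω) (i + 1) = xs ω (lastArr ω + 1 + (i + 1)) := by
  rw [afterVac, xs_delay_succ, xs_shift]

lemma hs_afterVac (ω : Stream) (i : ℕ) : hs (afterVac ω) i = hs ω (lastArr ω + i) := by
  rw [afterVac, hs_delay, hs_shift]

lemma vs_afterVac (ω : Stream) (i : ℕ) : vs (afterVac ω) i = vs ω (numVac ω + 1 + i) := by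
  rw [afterVac, vs_delay, vs_shift]

/-- the number of preemptions -/
noncomputable def numPre (ω : Stream) : ℕ := sInf {k | hs ω k ≤ xs ω k}

/-- the processing time of the packet that completes -/
noncomputable def lastSvc (ω : Stream) : ℝ := hs ω (numPre ω)

/-- the length of the busy period -/
noncomputable def svcTime (ω : Stream) : ℝ := ∑ i ∈ Finset.range (numPre ω), xs ω i + lastSvc ω

/-- the stream seen from the end of the busy period -/
noncomputable def afterSvc (ω : Stream) : Stream :=
  delay (lastSvc ω) (shift (numPre ω) (numPre ω + 1) 0 ω)

/-- the length of a cycle -/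
noncomputable def cycleTime (ω : Stream) : ℝ := vacTime ω + svcTime (afterVac ω)

/-- the age, at the end of the cycle, of the packet that completes -/
noncomputable def sysTime (ω : Stream) : ℝ :=
  (if numPre (afterVac ω) = 0 then bufAge ω else 0) + lastSvc (afterVac ω)

/-- the stream seen from the end of the cycle -/
noncomputable def nextCycle (ω : Stream) : Stream := afterSvc (afterVac ω)

/-- The properties that hold for almost every stream. -/
structure Good (ω : Stream) : Prop where
  xs_pos : ∀ i, 0 < xs ω i
  hs_nonneg : ∀ i, 0 ≤ hs ω i
  vs_nonneg : ∀ i, 0 ≤ vs ω i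
  vac : Tendsto (vacSum ω) atTop atTop
  arr : Tendsto (arrivalTime (xs ω)) atTop atTop
  svc : ∃ k, hs ω k ≤ xs ω k
  ne : ∀ k, hs ω k ≠ xs ω k

lemma arrivalTime_succ (X : ℕ → ℝ) (j : ℕ) :
    arrivalTime X (j + 1) = arrivalTime X j + X (j + 1) := by
  rw [arrivalTime, Finset.sum_range_succ, arrivalTime]

lemma arrivalTime_zero (X : ℕ → ℝ) : arrivalTime X 0 = X 0 := by simp [arrivalTime]

namespace Good

variable {ω : Stream} (hω : Good ω)
include hω

lemma monotone_vacSum : Monotone (vacSum ω) :=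
  monotone_nat_of_le_succ fun n => by
    rw [vacSum, vacSum, Finset.sum_range_succ]
    linarith [hω.vs_nonneg n]

lemma strictMono_arrivalTime : StrictMono (arrivalTime (xs ω)) :=
  strictMono_nat_of_lt_succ fun n => by
    rw [arrivalTime_succ]
    linarith [hω.xs_pos (n + 1)]

lemma exists_vac : ∃ m, xs ω 0 ≤ vacSum ω (m + 1) :=
  ((hω.vac.comp (tendsto_add_atTop_nat 1)).eventually_ge_atTop (xs ω 0)).exists

lemma exists_arr (t : ℝ) : ∃ j, t < arrivalTime (xs ω) (j + 1) :=
  ((hω.arr.comp (tendsto_add_atTop_nat 1)).eventually_gt_atTop t).exists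

/-- The partial sums increase, so minimality only needs testing at the preceding index; for m = 0
the left inequality is the positivity of the first inter-arrival time. The result involves only that
time and the first m + 1 vacations. -/
lemma numVac_eq_iff (m : ℕ) :
    numVac ω = m ↔ vacSum ω m < xs ω 0 ∧ xs ω 0 ≤ vacSum ω (m + 1) := by
  rw [numVac, sInf_setOf_eq_iff hω.exists_vac]
  constructor
  · rintro ⟨h1, h2⟩
    refine ⟨?_, h1⟩
    rcases m with _ | m
    · simpa [vacSum] using hω.xs_pos 0
    · exact not_le.1 (h2 m (Nat.lt_succ_self m))
  · rintro ⟨h1, h2⟩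
    exact ⟨h2, fun k hk => not_le.2 ((hω.monotone_vacSum hk).trans_lt h1)⟩

lemma xs_le_vacTime : xs ω 0 ≤ vacTime ω := ((hω.numVac_eq_iff _).1 rfl).2

lemma lastArr_eq_iff (j : ℕ) : lastArr ω = j ↔
    arrivalTime (xs ω) j ≤ vacTime ω ∧ vacTime ω < arrivalTime (xs ω) (j + 1) := by
  rw [lastArr, sInf_setOf_eq_iff (hω.exists_arr _)]
  constructor
  · rintro ⟨h1, h2⟩
    refine ⟨?_, h1⟩
    rcases j with _ | j
    · simpa [arrivalTime_zero] using hω.xs_le_vacTime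
    · exact not_lt.1 (h2 j (Nat.lt_succ_self j))
  · rintro ⟨h1, h2⟩
    exact ⟨h2, fun k hk => not_lt.2 ((hω.strictMono_arrivalTime.monotone hk).trans h1)⟩

/-- Ties are excluded by `Good.ne`, and the strict inequality at `k` has the form U < x_p required
by `indepFun_of_pieces`. -/
lemma numPre_eq_iff (k : ℕ) :
    numPre ω = k ↔ (∀ i < k, xs ω i < hs ω i) ∧ hs ω k < xs ω k := by
  rw [numPre, sInf_setOf_eq_iff hω.svc, and_comm]
  simp only [not_le, lt_iff_le_and_ne, hω.ne k, ne_eq, not_false_iff, and_true]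

lemma bufAge_nonneg : 0 ≤ bufAge ω := sub_nonneg.2 ((hω.lastArr_eq_iff _).1 rfl).1

lemma arrivalTime_pos (j : ℕ) : 0 < arrivalTime (xs ω) j :=
  Finset.sum_pos (fun i _ => hω.xs_pos i) (by simp)

lemma bufAge_le : bufAge ω ≤ vacTime ω := by
  have := hω.arrivalTime_pos (lastArr ω)
  rw [bufAge]
  linarith

lemma vacTime_pos : 0 < vacTime ω := (hω.xs_pos 0).trans_le hω.xs_le_vacTime

lemma lastSvc_nonneg : 0 ≤ lastSvc ω := hω.hs_nonneg _

lemma lastSvc_le : lastSvc ω ≤ svcTime ω := by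
  have : 0 ≤ ∑ i ∈ Finset.range (numPre ω), xs ω i := Finset.sum_nonneg fun i _ => (hω.xs_pos i).le
  rw [svcTime]
  linarith

lemma cycleTime_pos (hω' : Good (afterVac ω)) : 0 < cycleTime ω := by
  have := hω.vacTime_pos
  have := hω'.lastSvc_le
  have := hω'.lastSvc_nonneg
  rw [cycleTime]
  linarith

lemma sysTime_nonneg (hω' : Good (afterVac ω)) : 0 ≤ sysTime ω := by
  have := hω.bufAge_nonneg
  have := hω'.lastSvc_nonneg
  rw [sysTime]
  split_ifs <;> linarith

lemma sysTime_le (hω' : Good (afterVac ω)) : sysTime ω ≤ cycleTime ω := by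
  have := hω.bufAge_le
  have := hω.vacTime_pos
  have := hω'.lastSvc_le
  rw [sysTime, cycleTime]
  split_ifs <;> linarith

end Good

/-! ### Epochs as iterated cycles -/

/-- The stream seen from the epoch `e`. -/
noncomputable def streamAt (e : Epoch) (ω : Stream) : Stream
  | Sum.inl i => if i = 0 then arrivalTime (xs ω) e.arrived - e.time else xs ω (e.arrived + i)
  | Sum.inr (Sum.inl i) => hs ω (e.arrived + i)
  | Sum.inr (Sum.inr i) => vs ω (e.vacations + i)

lemma xs_streamAt_zero (e : Epoch) (ω : Stream) :
    xs (streamAt e ω) 0 = arrivalTime (xs ω) e.arrived - e.time := rfl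
lemma xs_streamAt_succ (e : Epoch) (ω : Stream) (i : ℕ) :
    xs (streamAt e ω) (i + 1) = xs ω (e.arrived + (i + 1)) := rfl
lemma hs_streamAt (e : Epoch) (ω : Stream) (i : ℕ) :
    hs (streamAt e ω) i = hs ω (e.arrived + i) := rfl
lemma vs_streamAt (e : Epoch) (ω : Stream) (i : ℕ) :
    vs (streamAt e ω) i = vs ω (e.vacations + i) := rfl

/-- Turns packet indices counted from time 0 into indices counted from an epoch. Existence matters:
for empty sets the two sides would be 0 and n. -/
lemma sInf_setOf_add {p : ℕ → Prop} {n : ℕ} (h : ∃ k, p (n + k)) :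
    sInf {j | n ≤ j ∧ p j} = n + sInf {k | p (n + k)} := by
  obtain ⟨k, hk⟩ := h
  rw [sInf_setOf_eq_iff ⟨n + k, by simp, hk⟩]
  refine ⟨⟨by simp, Nat.sInf_mem (s := {k | p (n + k)}) ⟨k, hk⟩⟩, ?_⟩
  rintro m hm ⟨h1, h2⟩
  obtain ⟨i, rfl⟩ := Nat.exists_eq_add_of_le h1
  exact Nat.notMem_of_lt_sInf (s := {k | p (n + k)}) (by omega : i < _) h2

section Link

variable (e : Epoch) (ω : Stream)

/-- The first inter-arrival time of `streamAt` is the residual one, which absorbs `e.time`; the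
later ones are unchanged. All absolute times in the model are translated through this identity. -/
lemma arrivalTime_streamAt (j : ℕ) :
    arrivalTime (xs ω) (e.arrived + j) = e.time + arrivalTime (xs (streamAt e ω)) j := by
  induction j with
  | zero => rw [arrivalTime_zero, xs_streamAt_zero]; simp
  | succ j ih =>
    rw [← add_assoc, arrivalTime_succ, ih, arrivalTime_succ, xs_streamAt_succ]
    ring_nf

lemma vacationEnd_streamAt (m : ℕ) :
    vacationEnd (vs ω) e m = e.time + vacSum (streamAt e ω) (m + 1) := rfl

lemma lastVacation_streamAt : lastVacation (xs ω) (vs ω) e = numVac (streamAt e ω) := by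
  have := arrivalTime_streamAt e ω 0
  rw [add_zero, arrivalTime_zero] at this
  simp only [lastVacation, numVac, vacationEnd_streamAt, this, add_le_add_iff_left]

lemma startTime_streamAt :
    startTime (xs ω) (vs ω) e = e.time + vacTime (streamAt e ω) := by
  rw [startTime, lastVacation_streamAt, vacationEnd_streamAt, vacTime]

/-- The first inter-arrival time after the vacations was shortened by `bufAge`, which is exactly the
time from the buffered arrival to the end of the vacations. -/
lemma xs_afterVac_sum (ω : Stream) (k : ℕ) :
    arrivalTime (xs ω) (lastArr ω + k + 1) =
      vacTime ω + ∑ i ∈ Finset.range (k + 1), xs (afterVac ω) i := by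
  induction k with
  | zero =>
    simp only [add_zero, zero_add, Finset.sum_range_one, afterVac, xs_delay_zero, xs_shift,
      arrivalTime_succ, bufAge]
    ring
  | succ k ih =>
    rw [Finset.sum_range_succ, ← add_assoc (vacTime ω), ← ih, ← add_assoc (lastArr ω),
      arrivalTime_succ, xs_afterVac_succ]
    ring_nf

variable {e ω}

lemma bufferedPacket_streamAt (hω : Good (streamAt e ω)) :
    bufferedPacket (xs ω) (vs ω) e = e.arrived + lastArr (streamAt e ω) := by
  simp only [bufferedPacket, startTime_streamAt]
  rw [sInf_setOf_add]
  · simp only [add_assoc, arrivalTime_streamAt, add_lt_add_iff_left]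
    rfl
  · simp only [add_assoc, arrivalTime_streamAt, add_lt_add_iff_left]
    exact hω.exists_arr _

lemma serviceStart_streamAt (hω : Good (streamAt e ω)) (hω' : Good (afterVac (streamAt e ω)))
    (k : ℕ) :
    serviceStart (xs ω) (vs ω) e (e.arrived + lastArr (streamAt e ω) + k) =
      e.time + vacTime (streamAt e ω) +
        ∑ i ∈ Finset.range k, xs (afterVac (streamAt e ω)) i := by
  rw [serviceStart, startTime_streamAt, add_assoc e.arrived, arrivalTime_streamAt]
  -- The buffered packet arrived before processing started, so the maximum is the start time; each
  -- later packet arrives after it, so the maximum is its arrival time.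
  rcases k with _ | k
  · have := ((hω.lastArr_eq_iff _).1 rfl).1
    simpa using this
  · rw [← add_assoc, xs_afterVac_sum, ← add_assoc, max_eq_right]
    exact le_add_of_nonneg_right (Finset.sum_nonneg fun i _ => (hω'.xs_pos i).le)

lemma informativePacket_streamAt (hω : Good (streamAt e ω))
    (hω' : Good (afterVac (streamAt e ω))) :
    informativePacket (xs ω) (hs ω) (vs ω) e =
      e.arrived + lastArr (streamAt e ω) + numPre (afterVac (streamAt e ω)) := by
  -- Completion before the successor arrives becomes, after cancelling the common starting time, a
  -- comparison of the `k`-th processing and inter-arrival times of the stream after the vacations.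
  have key : ∀ k, serviceStart (xs ω) (vs ω) e (e.arrived + lastArr (streamAt e ω) + k) +
      hs ω (e.arrived + lastArr (streamAt e ω) + k) ≤
        arrivalTime (xs ω) (e.arrived + lastArr (streamAt e ω) + k + 1) ↔
      hs (afterVac (streamAt e ω)) k ≤ xs (afterVac (streamAt e ω)) k := by
    intro k
    rw [serviceStart_streamAt hω hω', add_assoc e.arrived, add_assoc e.arrived,
      arrivalTime_streamAt, xs_afterVac_sum, Finset.sum_range_succ, ← hs_streamAt]
    rw [hs_afterVac]
    constructor <;> intro h <;> linarith
  rw [informativePacket, bufferedPacket_streamAt hω, sInf_setOf_add]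
  · simp only [key]; rfl
  · simp only [key]; exact hω'.svc

lemma nextEpoch_time (hω : Good (streamAt e ω)) (hω' : Good (afterVac (streamAt e ω))) :
    (nextEpoch (xs ω) (hs ω) (vs ω) e).time = e.time + cycleTime (streamAt e ω) := by
  simp only [nextEpoch, informativePacket_streamAt hω hω', serviceStart_streamAt hω hω', cycleTime,
    svcTime, lastSvc]
  simp only [afterVac, hs_delay, hs_shift, hs_streamAt]
  ring_nf

lemma nextEpoch_gen (hω : Good (streamAt e ω)) (hω' : Good (afterVac (streamAt e ω))) :
    (nextEpoch (xs ω) (hs ω) (vs ω) e).gen =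
      e.time + cycleTime (streamAt e ω) - sysTime (streamAt e ω) := by
  simp only [nextEpoch, informativePacket_streamAt hω hω', cycleTime, sysTime, svcTime]
  rw [add_assoc e.arrived, arrivalTime_streamAt]
  -- Without preemption the completing packet is the buffered one, already of age `bufAge` when
  -- processing starts. Otherwise it arrived during processing and entered service at once.
  rcases h : numPre (afterVac (streamAt e ω)) with _ | k
  · simp [bufAge]
    ring
  · rw [← add_assoc, xs_afterVac_sum]
    simp
    ring

/-- The link between the operational definition and the iteration of `nextCycle`: the indices
consumed by the two phases add up to the counters of the epoch, and the two shortenings give the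
residual inter-arrival time. Hence the `l`-th epoch sees the `l`-th iterate. -/
lemma streamAt_nextEpoch (hω : Good (streamAt e ω)) (hω' : Good (afterVac (streamAt e ω))) :
    streamAt (nextEpoch (xs ω) (hs ω) (vs ω) e) ω = nextCycle (streamAt e ω) := by
  have harr : (nextEpoch (xs ω) (hs ω) (vs ω) e).arrived =
      e.arrived + lastArr (streamAt e ω) + numPre (afterVac (streamAt e ω)) + 1 := by
    simp only [nextEpoch, informativePacket_streamAt hω hω']
  have hvac : (nextEpoch (xs ω) (hs ω) (vs ω) e).vacations =
      e.vacations + (numVac (streamAt e ω) + 1) := by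
    simp only [nextEpoch, lastVacation_streamAt]
  refine stream_ext (fun i => ?_) (fun i => ?_) (fun i => ?_)
  · rcases i with _ | i
    · rw [xs_streamAt_zero, nextEpoch_time hω hω', harr, add_assoc e.arrived, add_assoc e.arrived,
        arrivalTime_streamAt, xs_afterVac_sum, Finset.sum_range_succ, cycleTime, svcTime, nextCycle,
        afterSvc, xs_delay_zero, xs_shift, add_zero]
      ring
    · rw [xs_streamAt_succ, harr, nextCycle, afterSvc, xs_delay_succ, xs_shift,
        ← add_assoc _ i 1, ← add_assoc _ i 1,
        xs_afterVac_succ]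
      have : lastArr (streamAt e ω) + 1 + (numPre (afterVac (streamAt e ω)) + i + 1) =
        (lastArr (streamAt e ω) + 1 + numPre (afterVac (streamAt e ω)) + i) + 1 := by ring
      rw [this, xs_streamAt_succ]
      congr 1
      ring
  · rw [hs_streamAt, harr, nextCycle, afterSvc, hs_delay, hs_shift, hs_afterVac, hs_streamAt]
    congr 1
    ring
  · rw [vs_streamAt, hvac, nextCycle, afterSvc, vs_delay, vs_shift, vs_afterVac, vs_streamAt]
    congr 1
    ring

end Link

section Iterate

variable {a : ℝ} {ω : Stream}

lemma streamAt_epoch (hω : ∀ l, Good (nextCycle^[l] ω)) (hω' : ∀ l, Good (afterVac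
    (nextCycle^[l] ω)))
    (l : ℕ) : streamAt (epoch a (xs ω) (hs ω) (vs ω) l) ω = nextCycle^[l] ω := by
  induction l with
  | zero =>
    refine stream_ext (fun i => ?_) (fun i => ?_) (fun i => ?_)
    · rcases i with _ | i
      · simp [xs_streamAt_zero, epoch, arrivalTime_zero]
      · simp [xs_streamAt_succ, epoch]
    · simp [hs_streamAt, epoch]
    · simp [vs_streamAt, epoch]
  | succ l ih =>
    have h1 := hω l
    have h2 := hω' l
    rw [← ih] at h1 h2
    rw [epoch, streamAt_nextEpoch h1 h2, ih, Function.iterate_succ_apply']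

lemma completion_eq (hω : ∀ l, Good (nextCycle^[l] ω))
    (hω' : ∀ l, Good (afterVac (nextCycle^[l] ω))) (l : ℕ) :
    completion a (xs ω) (hs ω) (vs ω) l =
      ∑ i ∈ Finset.range l, cycleTime (nextCycle^[i] ω) := by
  induction l with
  | zero => simp [completion, epoch]
  | succ l ih =>
    have h0 := streamAt_epoch (a := a) hω hω' l
    have h1 := hω l
    have h2 := hω' l
    rw [← h0] at h1 h2
    rw [Finset.sum_range_succ, ← ih, completion, epoch, nextEpoch_time h1 h2, h0, completion]

lemma generation_succ (hω : ∀ l, Good (nextCycle^[l] ω))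
    (hω' : ∀ l, Good (afterVac (nextCycle^[l] ω))) (l : ℕ) :
    generation a (xs ω) (hs ω) (vs ω) (l + 1) =
      completion a (xs ω) (hs ω) (vs ω) (l + 1) - sysTime (nextCycle^[l] ω) := by
  have h0 := streamAt_epoch (a := a) hω hω' l
  have h1 := hω l
  have h2 := hω' l
  rw [← h0] at h1 h2
  rw [generation, completion, epoch, nextEpoch_gen h1 h2, nextEpoch_time h1 h2, h0]

end Iterate

/-! ### Measurability of the cycle functionals -/

@[fun_prop] lemma measurable_vacSum (m : ℕ) : Measurable fun ω => vacSum ω m := by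
  unfold vacSum; fun_prop

@[fun_prop] lemma measurable_arrivalTime (j : ℕ) :
    Measurable fun ω : Stream => arrivalTime (xs ω) j := by
  unfold arrivalTime; fun_prop

@[fun_prop] lemma measurable_numVac : Measurable numVac :=
  measurable_sInf_nat fun _ => measurableSet_le (by fun_prop) (by fun_prop)

@[fun_prop] lemma measurable_vacTime : Measurable vacTime :=
  measurable_comp_nat (f := fun m ω => vacSum ω (m + 1)) measurable_numVac fun _ => by fun_prop

@[fun_prop] lemma measurable_lastArr : Measurable lastArr :=
  measurable_sInf_nat fun _ => measurableSet_lt (by fun_prop) (by fun_prop)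

@[fun_prop] lemma measurable_bufAge : Measurable bufAge :=
  measurable_vacTime.sub (measurable_comp_nat (f := fun j ω => arrivalTime (xs ω) j)
    measurable_lastArr fun _ => by fun_prop)

@[fun_prop] lemma measurable_afterVac : Measurable afterVac :=
  measurable_delay.comp (measurable_bufAge.prodMk
    (measurable_comp_nat (f := fun j ω => shift (j + 1) j (numVac ω + 1) ω) measurable_lastArr
      fun j => measurable_comp_nat (f := fun m ω => shift (j + 1) j (m + 1) ω) measurable_numVac
        fun _ => measurable_shift _ _ _))

@[fun_prop] lemma measurable_numPre : Measurable numPre :=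
  measurable_sInf_nat fun _ => measurableSet_le (by fun_prop) (by fun_prop)

@[fun_prop] lemma measurable_lastSvc : Measurable lastSvc :=
  measurable_comp_nat (f := fun k ω => hs ω k) measurable_numPre fun _ => by fun_prop

@[fun_prop] lemma measurable_svcTime : Measurable svcTime :=
  (measurable_comp_nat (f := fun k ω => ∑ i ∈ Finset.range k, xs ω i) measurable_numPre
    fun _ => by fun_prop).add measurable_lastSvc

@[fun_prop] lemma measurable_afterSvc : Measurable afterSvc :=
  measurable_delay.comp (measurable_lastSvc.prodMk
    (measurable_comp_nat (f := fun k ω => shift k (k + 1) 0 ω) measurable_numPre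
      fun _ => measurable_shift _ _ _))

@[fun_prop] lemma measurable_cycleTime : Measurable cycleTime := by
  unfold cycleTime; fun_prop

@[fun_prop] lemma measurable_nextCycle : Measurable nextCycle := by
  unfold nextCycle; fun_prop

@[fun_prop] lemma measurable_sysTime : Measurable sysTime := by
  unfold sysTime
  refine Measurable.add (Measurable.ite ?_ (by fun_prop) (by fun_prop)) (by fun_prop)
  exact (measurable_numPre.comp measurable_afterVac) (measurableSet_singleton 0)

/-! ### Almost every stream is good -/

section Law

variable {lam : ℝ} {μH μV : Measure ℝ} [hlam : Fact (0 < lam)] [IsProbabilityMeasure μH]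
  [IsProbabilityMeasure μV]

local notation "𝓛" => streamLaw lam μH μV

lemma indepFun_coord {i j : ℕ ⊕ ℕ ⊕ ℕ} (hij : i ≠ j) :
    IndepFun (fun ω : Stream => ω i) (fun ω : Stream => ω j) 𝓛 :=
  iIndepFun_stream.indepFun hij

lemma lintegral_hs_xs {F : ℝ → ℝ → ℝ≥0∞} (hF : Measurable (Function.uncurry F)) (k : ℕ) :
    ∫⁻ ω, F (hs ω k) (xs ω k) ∂𝓛 = ∫⁻ h, ∫⁻ x, F h x ∂(expMeasure lam) ∂μH := by
  have := isProbabilityMeasure_expMeasure hlam.out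
  have h := lintegral_prodMk_of_indepFun (f := fun ω => hs ω k) (g := fun ω => xs ω k)
    (indepFun_coord (lam := lam) (μH := μH) (μV := μV)
      (by simp : (Sum.inr (Sum.inl k) : ℕ ⊕ ℕ ⊕ ℕ) ≠ Sum.inl k))
    (by fun_prop) (by fun_prop) hF
  have hF' : Measurable fun h => ∫⁻ x, F h x ∂(expMeasure lam) := hF.lintegral_prod_right'
  rw [h, map_xs, ← lintegral_map hF' (by fun_prop), map_hs]

lemma lintegral_vs {f : ℝ → ℝ≥0∞} (hf : Measurable f) (k : ℕ) :
    ∫⁻ ω, f (vs ω k) ∂𝓛 = ∫⁻ v, f v ∂μV := by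
  rw [← lintegral_map hf (measurable_vs k), map_vs]

lemma ae_xs_pos : ∀ᵐ ω ∂𝓛, ∀ i, 0 < xs ω i :=
  ae_all_iff.2 fun i => ae_of_ae_map (f := fun ω => xs ω i) (by fun_prop)
    (by rw [map_xs]; exact ae_pos_expMeasure hlam.out)

lemma ae_hs_nonneg (hH : ∀ᵐ x ∂μH, 0 ≤ x) : ∀ᵐ ω ∂𝓛, ∀ i, 0 ≤ hs ω i :=
  ae_all_iff.2 fun i => ae_of_ae_map (f := fun ω => hs ω i) (by fun_prop) (by rw [map_hs]; exact hH)

lemma ae_vs_nonneg (hV : ∀ᵐ x ∂μV, 0 ≤ x) : ∀ᵐ ω ∂𝓛, ∀ i, 0 ≤ vs ω i :=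
  ae_all_iff.2 fun i => ae_of_ae_map (f := fun ω => vs ω i) (by fun_prop) (by rw [map_vs]; exact hV)

lemma ae_hs_ne_xs : ∀ᵐ ω ∂𝓛, ∀ k, hs ω k ≠ xs ω k := by
  refine ae_all_iff.2 fun k => ?_
  have hm : MeasurableSet {z : ℝ × ℝ | z.1 = z.2} := measurableSet_eq_fun measurable_fst measurable_snd
  have h := lintegral_hs_xs (lam := lam) (μH := μH) (μV := μV)
    (F := fun h x => {z : ℝ × ℝ | z.1 = z.2}.indicator 1 (h, x)) (measurable_one.indicator hm) k
  have h0 : ∀ h : ℝ, ∫⁻ x, {z : ℝ × ℝ | z.1 = z.2}.indicator (1 : ℝ × ℝ → ℝ≥0∞) (h, x)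
      ∂(expMeasure lam) = 0 := by
    intro h
    rw [lintegral_eq_zero_iff (by
      exact (measurable_one.indicator hm).comp (measurable_const.prodMk measurable_id))]
    have : ∀ᵐ x ∂(expMeasure lam), x ≠ h := by simp [ae_iff]
    filter_upwards [this] with x hx
    simp [hx.symm]
  simp only [h0, lintegral_zero] at h
  have hm2 : Measurable fun ω : Stream =>
      {z : ℝ × ℝ | z.1 = z.2}.indicator (1 : ℝ × ℝ → ℝ≥0∞) (hs ω k, xs ω k) :=
    (measurable_one.indicator hm).comp ((measurable_hs k).prodMk (measurable_xs k))
  rw [lintegral_eq_zero_iff hm2] at h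
  filter_upwards [h] with ω hω heq
  simp [heq] at hω

/-- The probability of a preemption. -/
lemma measure_xs_lt_hs (hH : ∀ᵐ x ∂μH, 0 ≤ x) :
    𝓛 {ω | xs ω 0 < hs ω 0} = ENNReal.ofReal (1 - lst μH lam) := by
  have hle := lst_le_one μH hH hlam.out.le
  have hm : MeasurableSet {ω : Stream | hs ω 0 < xs ω 0} := measurableSet_lt (by fun_prop)
      (by fun_prop)
  have hm' : MeasurableSet {z : ℝ × ℝ | z.1 < z.2} := measurableSet_lt measurable_fst measurable_snd
  have h1 : 𝓛 {ω | hs ω 0 < xs ω 0} = ENNReal.ofReal (lst μH lam) := by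
    rw [← lintegral_indicator_one hm]
    refine (lintegral_hs_xs (F := fun h x => {z : ℝ × ℝ | z.1 < z.2}.indicator 1 (h, x))
      (measurable_one.indicator hm') 0).trans ?_
    rw [ofReal_lst μH hH hlam.out.le]
    refine lintegral_congr_ae ?_
    filter_upwards [hH] with h hh
    rw [← expMeasure_Ioi hlam.out hh, ← lintegral_indicator_one measurableSet_Ioi]
    rfl
  have h2 : 𝓛 {ω : Stream | xs ω 0 < hs ω 0} = 𝓛 {ω : Stream | hs ω 0 < xs ω 0}ᶜ := by
    refine measure_congr (Filter.eventuallyEq_set.2 ?_)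
    filter_upwards [ae_hs_ne_xs (lam := lam) (μH := μH) (μV := μV)] with ω hω
    change xs ω 0 < hs ω 0 ↔ ¬ (hs ω 0 < xs ω 0)
    rw [not_lt]
    exact ⟨le_of_lt, fun h => lt_of_le_of_ne h (hω 0).symm⟩
  rw [h2, prob_compl_eq_one_sub hm, h1, ENNReal.ofReal_sub _
    (lst_pos μH hH hlam.out.le).le, ENNReal.ofReal_one]

/-- A preemption at the first packet reads only the first inter-arrival and processing times, so the
remaining stream is fresh. This supplies the hypothesis `hτ` of `lintegral_of_renewal_equation` for
the busy period. -/
lemma lintegral_preempt (hH : ∀ᵐ x ∂μH, 0 ≤ x) {f : Stream → ℝ≥0∞} (hf : Measurable f) :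
    ∫⁻ ω, {ω | xs ω 0 < hs ω 0}.indicator (fun ω => f (shift 1 1 0 ω)) ω ∂𝓛 =
      ENNReal.ofReal (1 - lst μH lam) * ∫⁻ ω, f ω ∂𝓛 := by
  have hm : MeasurableSet {ω : Stream | xs ω 0 < hs ω 0} := measurableSet_lt (by fun_prop)
      (by fun_prop)
  rw [← measure_xs_lt_hs (lam := lam) (μV := μV) hH, ← lintegral_indicator_one hm,
    ← lintegral_mul_shift 1 1 0 (measurable_one.indicator hm) hf]
  · refine lintegral_congr fun ω => ?_
    by_cases h : ω ∈ {ω : Stream | xs ω 0 < hs ω 0} <;> simp only [indicator_of_mem,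
      indicator_of_notMem, h, not_false_eq_true, zero_mul, Pi.one_apply, one_mul]
  · intro ω
    rfl

/-- The probability q that every packet is preempted satisfies q = (1 - H*(λ)) q, the renewal
equation with ξ = 0, and H*(λ) > 0. -/
lemma ae_svc (hH : ∀ᵐ x ∂μH, 0 ≤ x) : ∀ᵐ ω ∂𝓛, ∃ k, hs ω k ≤ xs ω k := by
  have hm : MeasurableSet {ω : Stream | ∀ k, xs ω k < hs ω k} := by
    simp only [ofPred_forall]
    exact .iInter fun k => measurableSet_lt (by fun_prop) (by fun_prop)
  have h := lintegral_of_renewal_equation (ν := 𝓛) (F := {ω | ∀ k, xs ω k < hs ω k}.indicator 1)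
    (ξ := 0) (c := {ω | xs ω 0 < hs ω 0}) (τ := shift 1 1 0) (p := 1 - lst μH lam) (A := 0)
    (measurable_one.indicator hm) measurable_zero
    (by linarith [lst_le_one μH hH hlam.out.le]) (by linarith [lst_pos μH hH hlam.out.le]) le_rfl
    (fun f hf => lintegral_preempt hH hf) ?_ (by simp)
  · rw [lintegral_indicator_one hm, zero_div, ENNReal.ofReal_zero] at h
    filter_upwards [measure_eq_zero_iff_ae_notMem.1 h] with ω hω
    simpa using hω
  · refine Eventually.of_forall fun ω => ?_
    have : (∀ k, xs ω k < hs ω k) ↔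
        xs ω 0 < hs ω 0 ∧ ∀ k, xs (shift 1 1 0 ω) k < hs (shift 1 1 0 ω) k := by
      simp only [xs_shift, hs_shift, add_comm 1]
      exact ⟨fun h => ⟨h 0, fun k => h (k + 1)⟩, fun h k => Nat.casesOn k h.1 h.2⟩
    have hmem : ω ∈ {ω | ∀ k, xs ω k < hs ω k} ↔
        ω ∈ {ω | xs ω 0 < hs ω 0} ∧ shift 1 1 0 ω ∈ {ω | ∀ k, xs ω k < hs ω k} := this
    rw [Pi.zero_apply, zero_add]
    by_cases h1 : ω ∈ {ω | xs ω 0 < hs ω 0}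
    · rw [indicator_of_mem h1]
      by_cases h2 : shift 1 1 0 ω ∈ {ω | ∀ k, xs ω k < hs ω k}
      · rw [indicator_of_mem h2, indicator_of_mem (hmem.2 ⟨h1, h2⟩)]
        rfl
      · rw [indicator_of_notMem h2, indicator_of_notMem fun h => h2 (hmem.1 h).2]
    · rw [indicator_of_notMem h1, indicator_of_notMem fun h => h1 (hmem.1 h).1]

lemma ae_tendsto_sum {μ : Measure ℝ} (κ : ℕ → ℕ ⊕ ℕ ⊕ ℕ) (hκ : Function.Injective κ)
    (hlaw : ∀ i, (𝓛).map (fun ω : Stream => ω (κ i)) = μ) (hμ : ∀ᵐ x ∂μ, 0 ≤ x)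
    (hpos : 0 < μ (Ioi 0)) :
    ∀ᵐ ω ∂𝓛, Tendsto (fun n => ∑ i ∈ Finset.range n, ω (κ i)) atTop atTop := by
  refine tendsto_sum_atTop_of_iid (fun i j hij => indepFun_coord (hκ.ne hij)) (fun i => ?_)
    (fun i => ae_of_ae_map (f := fun ω : Stream => ω (κ i)) (measurable_pi_apply _).aemeasurable
      (by rw [hlaw]; exact hμ)) ?_
  · exact ⟨(measurable_pi_apply _).aemeasurable, (measurable_pi_apply _).aemeasurable,
      by rw [hlaw, hlaw]⟩
  · rwa [← hlaw 0, Measure.map_apply (measurable_pi_apply _) measurableSet_Ioi] at hpos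

lemma ae_good (hH : ∀ᵐ x ∂μH, 0 ≤ x) (hV : ∀ᵐ x ∂μV, 0 ≤ x) (hVpos : 0 < μV (Ioi 0)) :
    ∀ᵐ ω ∂𝓛, Good ω := by
  have hx := ae_tendsto_sum (lam := lam) (μH := μH) (μV := μV) Sum.inl Sum.inl_injective map_xs
    ((ae_pos_expMeasure hlam.out).mono fun _ h => h.le)
    (by rw [expMeasure_Ioi hlam.out le_rfl]; simp)
  have hv := ae_tendsto_sum (lam := lam) (μH := μH) (μV := μV) (fun i => Sum.inr (Sum.inr i))
    (Sum.inr_injective.comp Sum.inr_injective) map_vs hV hVpos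
  filter_upwards [hx, hv, ae_xs_pos (lam := lam) (μH := μH) (μV := μV), ae_hs_nonneg hH,
    ae_vs_nonneg hV, ae_svc hH, ae_hs_ne_xs (lam := lam) (μH := μH) (μV := μV)]
    with ω h1 h2 h3 h4 h5 h6 h7
  exact ⟨h3, h4, h5, h2, h1.comp (tendsto_add_atTop_nat 1), h6, h7⟩

end Law

/-! ### Regeneration at the ends of the two phases of a cycle -/

lemma vacSum_past {p q r m : ℕ} (h : m ≤ r) (ω : Stream) :
    vacSum (past p q r ω) m = vacSum ω m := by
  refine Finset.sum_congr rfl fun i hi => ?_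
  rw [vs_past, if_pos ((Finset.mem_range.1 hi).trans_le h)]

lemma arrivalTime_past {p q r j : ℕ} (h : j < p) (ω : Stream) :
    arrivalTime (xs (past p q r ω)) j = arrivalTime (xs ω) j := by
  refine Finset.sum_congr rfl fun i hi => ?_
  rw [xs_past, if_pos ((Finset.mem_range.1 hi).trans_le h)]

/-! ### Composition and iteration of law-preserving regenerations -/

section

variable {E α β : Type*} [MeasurableSpace E] [MeasurableSpace α] [MeasurableSpace β]
  {μ : Measure E} [IsProbabilityMeasure μ]

/-- With `G` frozen, the second independence is applied to the fresh stream produced by `θ₁`. The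
joint probability is then a multiple of μ(C), and C = univ gives the factor. -/
lemma indepFun_trans {G : E → α} {θ₁ : E → E} {G' : E → β} {θ₂ : E → E}
    (hG : Measurable G) (hθ₁ : Measurable θ₁) (hG' : Measurable G') (hθ₂ : Measurable θ₂)
    (h1 : IndepFun G θ₁ μ) (hm1 : μ.map θ₁ = μ) (h2 : IndepFun G' θ₂ μ) (hm2 : μ.map θ₂ = μ) :
    IndepFun (fun ω => (G ω, G' (θ₁ ω))) (fun ω => θ₂ (θ₁ ω)) μ ∧
      μ.map (fun ω => θ₂ (θ₁ ω)) = μ := by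
  have hm : μ.map (fun ω => θ₂ (θ₁ ω)) = μ := by
    rw [← Function.comp_def, ← Measure.map_map hθ₂ hθ₁, hm1, hm2]
  refine ⟨?_, hm⟩
  rw [indepFun_iff_measure_inter_preimage_eq_mul]
  intro O C hO hC
  have key : ∀ C : Set E, MeasurableSet C →
      μ ((fun ω => (G ω, G' (θ₁ ω))) ⁻¹' O ∩ (fun ω => θ₂ (θ₁ ω)) ⁻¹' C) =
        (∫⁻ ω, μ (G' ⁻¹' {b | (G ω, b) ∈ O}) ∂μ) * μ C := by
    intro C hC
    have hS : MeasurableSet {z : α × E | (z.1, G' z.2) ∈ O ∧ θ₂ z.2 ∈ C} :=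
      ((measurable_fst.prodMk (hG'.comp measurable_snd)) hO).inter ((hθ₂.comp measurable_snd) hC)
    have hO' : ∀ a, MeasurableSet {b | (a, b) ∈ O} := fun a => measurable_prodMk_left hO
    have h := lintegral_prodMk_of_indepFun h1 hG hθ₁ (F := fun a e =>
      {z : α × E | (z.1, G' z.2) ∈ O ∧ θ₂ z.2 ∈ C}.indicator (1 : α × E → ℝ≥0∞) (a, e))
      (measurable_one.indicator hS)
    have hme : Measurable fun ω => μ (G' ⁻¹' {b | (G ω, b) ∈ O}) := by
      have hT : MeasurableSet {z : E × E | (G z.1, G' z.2) ∈ O} :=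
        ((hG.comp measurable_fst).prodMk (hG'.comp measurable_snd)) hO
      exact measurable_measure_prodMk_left hT
    rw [← lintegral_mul_const _ hme]
    rw [hm1] at h
    refine Eq.trans ?_ (h.trans (lintegral_congr fun ω => ?_))
    · have hT : MeasurableSet {ω : E | (G ω, G' (θ₁ ω)) ∈ O ∧ θ₂ (θ₁ ω) ∈ C} :=
        ((hG.prodMk (hG'.comp hθ₁)) hO).inter ((hθ₂.comp hθ₁) hC)
      exact (lintegral_indicator_one hT).symm
    · have hT : MeasurableSet {e : E | (G ω, G' e) ∈ O ∧ θ₂ e ∈ C} :=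
        ((measurable_const.prodMk hG') hO).inter (hθ₂ hC)
      refine (lintegral_indicator_one hT).trans ?_
      have := h2.measure_inter_preimage_eq_mul _ _ (hO' (G ω)) hC
      rw [← Measure.map_apply hθ₂ hC, hm2] at this
      exact this
  have h3 := key univ .univ
  rw [preimage_univ, inter_univ, measure_univ, mul_one] at h3
  rw [key C hC, h3, ← Measure.map_apply (f := fun ω => θ₂ (θ₁ ω)) (hθ₂.comp hθ₁) hC, hm]

omit [IsProbabilityMeasure μ] in
lemma map_iterate {θ : E → E} (hθ : Measurable θ) (hm : μ.map θ = μ) (n : ℕ) :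
    μ.map (θ^[n]) = μ :=
  ((MeasurePreserving.mk hθ hm).iterate n).map_eq

/-- If `G` is independent of `θ` and `θ` preserves the law, then `G, G ∘ θ, G ∘ θ ∘ θ, …` are
independent. -/
lemma iIndepFun_iterate {G : E → α} {θ : E → E} (hG : Measurable G) (hθ : Measurable θ)
    (h : IndepFun G θ μ) (hm : μ.map θ = μ) : iIndepFun (fun n ω => G (θ^[n] ω)) μ := by
  -- Induction on initial segments: the first factor is split off by independence, and the others
  -- are the same event for n - 1 factors seen through `θ`, which preserves the law.
  have key : ∀ (n : ℕ) (t : ℕ → Set α), (∀ i, MeasurableSet (t i)) →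
      μ (⋂ i ∈ Finset.range n, (fun ω => G (θ^[i] ω)) ⁻¹' t i) =
        ∏ i ∈ Finset.range n, μ (G ⁻¹' t i) := by
    intro n
    induction n with
    | zero => intro t _; simp
    | succ n ih =>
      intro t ht
      have hs : MeasurableSet (⋂ i ∈ Finset.range n, (fun ω => G (θ^[i] ω)) ⁻¹' t (i + 1)) :=
        Finset.measurableSet_biInter _ fun i _ => (hG.comp (hθ.iterate i)) (ht _)
      have he : (⋂ i ∈ Finset.range (n + 1), (fun ω => G (θ^[i] ω)) ⁻¹' t i) =
          G ⁻¹' t 0 ∩ θ ⁻¹' (⋂ i ∈ Finset.range n, (fun ω => G (θ^[i] ω)) ⁻¹' t (i + 1)) := by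
        ext ω
        simp only [mem_iInter, Finset.mem_range, mem_preimage, mem_inter_iff]
        constructor
        · exact fun h => ⟨h 0 (by omega), fun i hi => by
            simpa only [Function.iterate_succ_apply] using h (i + 1) (by omega)⟩
        · rintro ⟨h0, h1⟩ i hi
          rcases i with _ | i
          · exact h0
          · simpa only [Function.iterate_succ_apply] using h1 i (by omega)
      rw [he, h.measure_inter_preimage_eq_mul _ _ (ht 0) hs, ← Measure.map_apply hθ hs, hm,
        ih _ fun i => ht _, Finset.prod_range_succ', mul_comm]
  rw [iIndepFun_iff_measure_inter_preimage_eq_mul]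
  intro S t ht
  classical
  obtain ⟨n, hn⟩ : ∃ n, S ⊆ Finset.range n := ⟨S.sup id + 1, fun i hi =>
    Finset.mem_range.2 (Nat.lt_succ_of_le (Finset.le_sup (f := id) hi))⟩
  have hlaw : ∀ i, MeasurableSet (t i) → μ ((fun ω => G (θ^[i] ω)) ⁻¹' t i) = μ (G ⁻¹' t i) := by
    intro i hi
    change μ (θ^[i] ⁻¹' (G ⁻¹' t i)) = _
    rw [← Measure.map_apply (hθ.iterate i) (hG hi), map_iterate hθ hm]
  -- A general finite index set is filled up to an initial segment with `univ`.
  have h1 := key n (fun i => if i ∈ S then t i else univ) fun i => by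
    split_ifs with hi
    exacts [ht i hi, .univ]
  have h2 : (⋂ i ∈ Finset.range n, (fun ω => G (θ^[i] ω)) ⁻¹' (if i ∈ S then t i else univ)) =
      ⋂ i ∈ S, (fun ω => G (θ^[i] ω)) ⁻¹' t i := by
    ext ω
    simp only [mem_iInter, mem_preimage]
    constructor
    · intro h i hi
      simpa [hi] using h i (hn hi)
    · intro h i _
      split_ifs with hi
      exacts [h i hi, mem_univ _]
  rw [← h2, h1, Finset.prod_congr rfl fun i hi => hlaw i (ht i hi), ← Finset.prod_subset hn]
  · exact Finset.prod_congr rfl fun i hi => by rw [if_pos hi]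
  · intro i _ hi
    simp [hi]

end

section Law

variable {lam : ℝ} {μH μV : Measure ℝ} [hlam : Fact (0 < lam)] [IsProbabilityMeasure μH]
  [IsProbabilityMeasure μV]

local notation "𝓛" => streamLaw lam μH μV

/-- The pieces are indexed by the last vacation m and the last arrival j during the vacations. Given
the past, it only remains that arrival j + 1 comes after the end of the vacations, so the used part
of that inter-arrival time is the age of the buffered packet. -/
lemma indepFun_afterVac (hgood : ∀ᵐ ω ∂𝓛, Good ω) :
    IndepFun (fun ω => (vacTime ω, bufAge ω)) afterVac 𝓛 ∧ (𝓛).map afterVac = 𝓛 := by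
  refine indepFun_of_pieces (ι := ℕ × ℕ) (fun i => i.2 + 1) (fun i => i.2) (fun i => i.1 + 1)
    (fun i => {ω | vacSum ω i.1 < xs ω 0 ∧ xs ω 0 ≤ vacSum ω (i.1 + 1) ∧
      arrivalTime (xs ω) i.2 ≤ vacSum ω (i.1 + 1)})
    (fun i ω => vacSum ω (i.1 + 1) - arrivalTime (xs ω) i.2)
    (fun i ω => (vacSum ω (i.1 + 1), vacSum ω (i.1 + 1) - arrivalTime (xs ω) i.2))
    (fun ω => (numVac ω, lastArr ω)) (by fun_prop) (by fun_prop) (fun i => ?_)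
    (fun i => by fun_prop) (fun i => by fun_prop) (fun i ω => ?_) (fun i ω => ?_) (fun i ω => ?_)
    (fun i => ?_) ?_ (fun ω => rfl) (fun ω => rfl)
  · exact (measurableSet_lt (measurable_vacSum _) (measurable_xs _)).inter
      ((measurableSet_le (measurable_xs _) (measurable_vacSum _)).inter
        (measurableSet_le (measurable_arrivalTime _) (measurable_vacSum _)))
  · simp only [mem_ofPred_eq, vacSum_past (Nat.le_succ i.1), vacSum_past le_rfl,
      arrivalTime_past (Nat.lt_succ_self i.2), xs_past, Nat.succ_pos, if_true]
  · simp only [vacSum_past le_rfl, arrivalTime_past (Nat.lt_succ_self i.2)]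
  · simp only [vacSum_past le_rfl, arrivalTime_past (Nat.lt_succ_self i.2)]
  · exact Eventually.of_forall fun ω hω => sub_nonneg.2 hω.2.2
  · filter_upwards [hgood] with ω hω
    rintro ⟨m, j⟩
    simp only [Prod.mk.injEq, hω.lastArr_eq_iff, vacTime]
    have harr := arrivalTime_succ (xs ω) j
    constructor
    · rintro ⟨rfl, h2, h3⟩
      have h4 := (hω.numVac_eq_iff _).1 rfl
      exact ⟨⟨h4.1, h4.2, h2⟩, by linarith⟩
    · rintro ⟨⟨h1, h2, h3⟩, h4⟩
      have h5 := (hω.numVac_eq_iff m).2 ⟨h1, h2⟩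
      rw [h5]
      exact ⟨rfl, h3, by linarith⟩

/-- The pieces are indexed by the number k of preemptions; the used part of inter-arrival time k is
the processing time of packet k. `numPre` is among the outputs because it decides whether `bufAge`
counts in `sysTime`. -/
lemma indepFun_afterSvc (hgood : ∀ᵐ ω ∂𝓛, Good ω) :
    IndepFun (fun ω => (svcTime ω, lastSvc ω, numPre ω)) afterSvc 𝓛 ∧ (𝓛).map afterSvc = 𝓛 := by
  refine indepFun_of_pieces (ι := ℕ) (fun k => k) (fun k => k + 1) (fun _ => 0)
    (fun k => {ω | ∀ i ∈ Finset.range k, xs ω i < hs ω i}) (fun k ω => hs ω k)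
    (fun k ω => (∑ i ∈ Finset.range k, xs ω i + hs ω k, hs ω k, k))
    numPre (by fun_prop) (by fun_prop) (fun k => ?_)
    (fun k => by fun_prop) (fun k => by fun_prop) (fun k ω => ?_) (fun k ω => ?_) (fun k ω => ?_)
    (fun k => ?_) ?_ (fun ω => rfl) (fun ω => rfl)
  · simp only [ofPred_forall]
    exact .iInter fun i => .iInter fun _ => measurableSet_lt (by fun_prop) (by fun_prop)
  · simp only [mem_ofPred_eq]
    refine forall₂_congr fun i hi => ?_
    have := Finset.mem_range.1 hi
    rw [xs_past, hs_past, if_pos this, if_pos (by omega)]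
  · simp [hs_past]
  · simp only [hs_past, Nat.lt_succ_self, if_true]
    rw [Finset.sum_congr rfl fun i hi => by rw [xs_past, if_pos (Finset.mem_range.1 hi)]]
  · filter_upwards [hgood] with ω hω _ using hω.hs_nonneg k
  · filter_upwards [hgood] with ω hω k
    simp only [hω.numPre_eq_iff, Finset.mem_range]

lemma indepFun_nextCycle (hgood : ∀ᵐ ω ∂𝓛, Good ω) :
    IndepFun (fun ω => (cycleTime ω, sysTime ω)) nextCycle 𝓛 ∧ (𝓛).map nextCycle = 𝓛 := by
  obtain ⟨h1, hm1⟩ := indepFun_afterVac hgood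
  obtain ⟨h2, hm2⟩ := indepFun_afterSvc hgood
  obtain ⟨h3, hm3⟩ := indepFun_trans (by fun_prop) (by fun_prop) (by fun_prop) (by fun_prop)
    h1 hm1 h2 hm2
  refine ⟨?_, hm3⟩
  -- Cycle length and system time are a measurable function of the outputs of the two phases.
  have hφ : Measurable fun z : (ℝ × ℝ) × (ℝ × ℝ × ℕ) =>
      (z.1.1 + z.2.1, (if z.2.2.2 = 0 then z.1.2 else 0) + z.2.2.1) := by
    refine Measurable.prodMk (by fun_prop) (Measurable.add (Measurable.ite ?_ ?_ ?_) (by fun_prop))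
    · exact (measurable_snd.comp (measurable_snd.comp measurable_snd)) (measurableSet_singleton 0)
    · fun_prop
    · fun_prop
  exact h3.comp hφ measurable_id

lemma iIndepFun_cycles (hgood : ∀ᵐ ω ∂𝓛, Good ω) :
    iIndepFun (fun l ω => (cycleTime (nextCycle^[l] ω), sysTime (nextCycle^[l] ω))) 𝓛 :=
  iIndepFun_iterate (by fun_prop : Measurable fun ω => (cycleTime ω, sysTime ω)) (by fun_prop)
    (indepFun_nextCycle hgood).1 (indepFun_nextCycle hgood).2

lemma ae_good_iterate (hgood : ∀ᵐ ω ∂𝓛, Good ω) :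
    ∀ᵐ ω ∂𝓛, ∀ l, Good (nextCycle^[l] ω) ∧ Good (afterVac (nextCycle^[l] ω)) := by
  have h1 : ∀ᵐ ω ∂𝓛, Good ω ∧ Good (afterVac ω) :=
    hgood.and (ae_of_ae_map (by fun_prop) (by rw [(indepFun_afterVac hgood).2]; exact hgood))
  exact ae_all_iff.2 fun l => ae_of_ae_map (measurable_nextCycle.iterate l).aemeasurable
    (by rw [map_iterate measurable_nextCycle (indepFun_nextCycle hgood).2]; exact h1)

end Law

/-! ### Recursions for the functionals of a cycle -/

section Recursion

lemma numPre_of_le {ω : Stream} (h : hs ω 0 ≤ xs ω 0) : numPre ω = 0 :=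
  Nat.sInf_eq_zero.2 (Or.inl h)

variable {ω : Stream} (hω : Good ω)
include hω

lemma numPre_of_lt (h : xs ω 0 < hs ω 0) : numPre ω = numPre (shift 1 1 0 ω) + 1 := by
  have hex : ∃ k, hs (shift 1 1 0 ω) k ≤ xs (shift 1 1 0 ω) k := by
    obtain ⟨k, hk⟩ := hω.svc
    rcases k with _ | k
    · exact absurd h (not_lt.2 hk)
    · exact ⟨k, by simpa [add_comm 1] using hk⟩
  obtain ⟨h1, h2⟩ := (sInf_setOf_eq_iff hex (numPre (shift 1 1 0 ω))).1 rfl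
  refine (sInf_setOf_eq_iff hω.svc _).2 ⟨by simpa [add_comm 1] using h1, fun m hm => ?_⟩
  rcases m with _ | m
  · exact not_le.2 h
  · simpa [add_comm 1] using h2 m (by omega)

lemma numPre_eq_zero_iff : numPre ω = 0 ↔ hs ω 0 ≤ xs ω 0 := by
  refine ⟨fun h => ?_, numPre_of_le⟩
  by_contra h'
  rw [numPre_of_lt hω (not_le.1 h')] at h
  omega

lemma lastSvc_of_lt (h : xs ω 0 < hs ω 0) : lastSvc ω = lastSvc (shift 1 1 0 ω) := by
  rw [lastSvc, numPre_of_lt hω h, lastSvc, hs_shift, add_comm]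

lemma svcTime_of_lt (h : xs ω 0 < hs ω 0) : svcTime ω = xs ω 0 + svcTime (shift 1 1 0 ω) := by
  rw [svcTime, lastSvc_of_lt hω h, numPre_of_lt hω h, Finset.sum_range_succ', svcTime]
  simp only [xs_shift, add_comm 1]
  ring

omit hω in
lemma svcTime_of_le (h : hs ω 0 ≤ xs ω 0) : svcTime ω = hs ω 0 := by
  simp [svcTime, lastSvc, numPre_of_le h]

omit hω in
lemma lastSvc_of_le (h : hs ω 0 ≤ xs ω 0) : lastSvc ω = hs ω 0 := by
  simp [lastSvc, numPre_of_le h]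

/-- The stream seen from the end of the first vacation, if no packet has arrived. -/
noncomputable def afterOneVac (ω : Stream) : Stream := delay (vs ω 0) (shift 0 0 1 ω)

omit hω in
lemma vacSum_afterOneVac (ω : Stream) (m : ℕ) :
    vacSum (afterOneVac ω) m = vacSum ω (m + 1) - vs ω 0 := by
  simp [vacSum, Finset.sum_range_succ', afterOneVac, add_comm 1]

omit hω in
lemma arrivalTime_afterOneVac (ω : Stream) (j : ℕ) :
    arrivalTime (xs (afterOneVac ω)) j = arrivalTime (xs ω) j - vs ω 0 := by
  simp only [arrivalTime, Finset.sum_range_succ', afterOneVac, xs_delay_succ, xs_shift, zero_add,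
    xs_delay_zero]
  ring

lemma numVac_of_lt (h : vs ω 0 < xs ω 0) : numVac ω = numVac (afterOneVac ω) + 1 := by
  have hx : ∀ m, xs (afterOneVac ω) 0 ≤ vacSum (afterOneVac ω) (m + 1) ↔
      xs ω 0 ≤ vacSum ω (m + 1 + 1) := by
    intro m
    rw [vacSum_afterOneVac]
    simp [afterOneVac]
  have hex : ∃ m, xs (afterOneVac ω) 0 ≤ vacSum (afterOneVac ω) (m + 1) := by
    obtain ⟨m, hm⟩ := hω.exists_vac
    exact ⟨m, (hx m).2 (hm.trans (hω.monotone_vacSum (Nat.le_succ _)))⟩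
  obtain ⟨h1, h2⟩ := (sInf_setOf_eq_iff hex (numVac (afterOneVac ω))).1 rfl
  refine (sInf_setOf_eq_iff hω.exists_vac _).2 ⟨(hx _).1 h1, fun m hm => ?_⟩
  rcases m with _ | m
  · simpa [vacSum] using h
  · rw [← hx]; exact h2 m (by omega)

lemma vacTime_of_lt (h : vs ω 0 < xs ω 0) : vacTime ω = vs ω 0 + vacTime (afterOneVac ω) := by
  rw [vacTime, numVac_of_lt hω h, vacTime, vacSum_afterOneVac]
  ring

lemma bufAge_of_lt (h : vs ω 0 < xs ω 0) : bufAge ω = bufAge (afterOneVac ω) := by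
  have hv : vacTime (afterOneVac ω) = vacTime ω - vs ω 0 := by rw [vacTime_of_lt hω h]; ring
  have hl : lastArr ω = lastArr (afterOneVac ω) := by
    simp only [lastArr, hv, arrivalTime_afterOneVac, sub_lt_sub_iff_right]
  rw [bufAge, hl, bufAge, hv, arrivalTime_afterOneVac]
  ring

omit hω in
lemma numVac_of_le (h : xs ω 0 ≤ vs ω 0) : numVac ω = 0 :=
  Nat.sInf_eq_zero.2 (Or.inl (by simpa [vacSum] using h))

omit hω in
lemma vacTime_of_le (h : xs ω 0 ≤ vs ω 0) : vacTime ω = vs ω 0 := by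
  simp [vacTime, numVac_of_le h, vacSum]

end Recursion

lemma measurable_afterOneVac : Measurable afterOneVac :=
  measurable_delay.comp ((measurable_vs 0).prodMk (measurable_shift _ _ _))

lemma eq_add_indicator {Ω : Type*} {A b : ℝ≥0∞} {g : Ω → ℝ≥0∞} {c : Set Ω} {ω : Ω}
    (h1 : ω ∈ c → A = b + g ω) (h2 : ω ∉ c → A = b) : A = b + c.indicator g ω := by
  by_cases h : ω ∈ c
  · rw [indicator_of_mem h, h1 h]
  · rw [indicator_of_notMem h, add_zero, h2 h]

section Moments

variable {lam : ℝ} {μH μV : Measure ℝ} [hlam : Fact (0 < lam)] [IsProbabilityMeasure μH]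
  [IsProbabilityMeasure μV]

local notation "𝓛" => streamLaw lam μH μV

/-! ### Moments of the busy period -/

lemma integral_expMoment (μ : Measure ℝ) [IsProbabilityMeasure μ] (hμ : ∀ᵐ x ∂μ, 0 ≤ x) :
    Integrable (expMoment lam) μ ∧ ∫ x, expMoment lam x ∂μ =
      (1 - lst μ lam) / lam - ∫ x, x * Real.exp (-(lam * x)) ∂μ := by
  have h1 : Integrable (fun x => (1 - Real.exp (-(lam * x))) / lam) μ :=
    ((integrable_const 1).sub (integrable_exp_neg μ hμ hlam.out.le)).div_const _
  have h2 := integrable_id_mul_exp_neg μ hμ hlam.out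
  refine ⟨h1.sub h2, ?_⟩
  simp only [expMoment]
  rw [integral_sub h1 h2, integral_div,
    integral_sub (integrable_const 1) (integrable_exp_neg μ hμ hlam.out.le)]
  simp [lst]

/-- One-step analysis: the busy period lasts min(X, H) and, on preemption, continues with a fresh
busy period. Here E[min(X, H)] = (1 - H*(λ))/λ. -/
lemma lintegral_svcTime (hgood : ∀ᵐ ω ∂𝓛, Good ω) (hH : ∀ᵐ x ∂μH, 0 ≤ x) :
    ∫⁻ ω, ENNReal.ofReal (svcTime ω) ∂𝓛 =
      ENNReal.ofReal ((1 - lst μH lam) / lam / lst μH lam) := by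
  have hη := lst_pos μH hH hlam.out.le
  have hη1 := lst_le_one μH hH hlam.out.le
  have h := lintegral_of_renewal_equation (ν := 𝓛) (F := fun ω => ENNReal.ofReal (svcTime ω))
    (ξ := fun ω => ENNReal.ofReal (min (xs ω 0) (hs ω 0))) (c := {ω | xs ω 0 < hs ω 0})
    (τ := shift 1 1 0) (p := 1 - lst μH lam) (A := (1 - lst μH lam) / lam) (by fun_prop)
    (by fun_prop) (by linarith) (by linarith)
    (div_nonneg (by linarith) hlam.out.le)
    (fun f hf => lintegral_preempt hH hf) ?_ ?_
  · simpa using h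
  · filter_upwards [hgood] with ω hω
    refine eq_add_indicator (fun (h : xs ω 0 < hs ω 0) => ?_)
      (fun (h : ¬ (xs ω 0 < hs ω 0)) => ?_)
    · have hs0 : 0 ≤ svcTime (shift 1 1 0 ω) := by
        refine add_nonneg (Finset.sum_nonneg fun i _ => (hω.xs_pos _).le) (hω.hs_nonneg _)
      rw [svcTime_of_lt hω h, min_eq_left h.le, ENNReal.ofReal_add (hω.xs_pos 0).le hs0]
    · rw [svcTime_of_le (not_lt.1 h), min_eq_right (not_lt.1 h)]
  · refine (lintegral_hs_xs (F := fun h x => ENNReal.ofReal (min x h)) (by fun_prop) 0).trans ?_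
    have hint : Integrable (fun x => (1 - Real.exp (-(lam * x))) / lam) μH :=
      ((integrable_const 1).sub (integrable_exp_neg μH hH hlam.out.le)).div_const _
    have hi : ∫ x, (1 - Real.exp (-(lam * x))) / lam ∂μH = (1 - lst μH lam) / lam := by
      rw [integral_div, integral_sub (integrable_const 1) (integrable_exp_neg μH hH hlam.out.le)]
      simp [lst]
    rw [← hi, ofReal_integral_eq_lintegral_ofReal hint]
    · refine lintegral_congr_ae ?_
      filter_upwards [hH] with h hh using lintegral_min_expMeasure hlam.out hh
    · filter_upwards [hH] with h hh
      have h0 := hlam.out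
      have : Real.exp (-(lam * h)) ≤ 1 := Real.exp_le_one_iff.2 (by
        have := mul_nonneg h0.le hh; linarith)
      exact div_nonneg (by linarith) h0.le

/-- One-step analysis: a preempted packet contributes nothing, and a completing one contributes H on
the event H ≤ X, whose conditional probability given H is exp(-λH). -/
lemma lintegral_lastSvc (hgood : ∀ᵐ ω ∂𝓛, Good ω) (hH : ∀ᵐ x ∂μH, 0 ≤ x) :
    ∫⁻ ω, ENNReal.ofReal (lastSvc ω) ∂𝓛 =
      ENNReal.ofReal ((∫ x, x * Real.exp (-(lam * x)) ∂μH) / lst μH lam) := by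
  have hη := lst_pos μH hH hlam.out.le
  have hη1 := lst_le_one μH hH hlam.out.le
  have hnn : 0 ≤ᵐ[μH] fun x => x * Real.exp (-(lam * x)) := by
    filter_upwards [hH] with x hx
    have := Real.exp_pos (-(lam * x))
    exact mul_nonneg hx this.le
  have hm : MeasurableSet {ω : Stream | hs ω 0 ≤ xs ω 0} :=
    measurableSet_le (by fun_prop) (by fun_prop)
  have h := lintegral_of_renewal_equation (ν := 𝓛) (F := fun ω => ENNReal.ofReal (lastSvc ω))
    (ξ := {ω | hs ω 0 ≤ xs ω 0}.indicator fun ω => ENNReal.ofReal (hs ω 0))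
    (c := {ω | xs ω 0 < hs ω 0})
    (τ := shift 1 1 0) (p := 1 - lst μH lam) (A := ∫ x, x * Real.exp (-(lam * x)) ∂μH) (by fun_prop)
    (Measurable.indicator (by fun_prop) hm) (by linarith) (by linarith)
    (integral_nonneg_of_ae hnn)
    (fun f hf => lintegral_preempt hH hf) ?_ ?_
  · simpa using h
  · filter_upwards [hgood] with ω hω
    refine eq_add_indicator (fun (h : xs ω 0 < hs ω 0) => ?_)
      (fun (h : ¬ (xs ω 0 < hs ω 0)) => ?_)
    · have h' : ω ∉ {ω : Stream | hs ω 0 ≤ xs ω 0} := not_le.2 h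
      rw [lastSvc_of_lt hω h, indicator_of_notMem h', zero_add]
    · have h' : ω ∈ {ω : Stream | hs ω 0 ≤ xs ω 0} := not_lt.1 h
      rw [lastSvc_of_le (not_lt.1 h), indicator_of_mem h']
  · have hm2 : MeasurableSet {z : ℝ × ℝ | z.1 ≤ z.2} := measurableSet_le measurable_fst measurable_snd
    refine (lintegral_hs_xs (F := fun h x => {z : ℝ × ℝ | z.1 ≤ z.2}.indicator
      (fun z => ENNReal.ofReal z.1) (h, x)) (Measurable.indicator (by fun_prop) hm2) 0).trans ?_
    rw [ofReal_integral_eq_lintegral_ofReal (integrable_id_mul_exp_neg μH hH hlam.out) hnn]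
    refine lintegral_congr_ae ?_
    filter_upwards [hH] with h hh
    rw [ENNReal.ofReal_mul hh, ← expMeasure_Ici hlam.out hh,
      ← lintegral_indicator_const measurableSet_Ici]
    rfl

/-- Squaring the one-step recursion gives a cross term 2 X B' on the event of preemption, with B'
the fresh busy period independent of X and H. The constant `c₁` is E[X; X < H]. -/
lemma lintegral_svcTime_sq (hgood : ∀ᵐ ω ∂𝓛, Good ω) (hH : ∀ᵐ x ∂μH, 0 ≤ x) {c₁ : ℝ}
    (hc₁ : c₁ = (1 - lst μH lam) / lam - ∫ x, x * Real.exp (-(lam * x)) ∂μH) :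
    0 ≤ c₁ ∧ ∫⁻ ω, ENNReal.ofReal (svcTime ω ^ 2) ∂𝓛 =
      ENNReal.ofReal ((2 / lam * c₁ + 2 * c₁ * ((1 - lst μH lam) / lam / lst μH lam)) /
        lst μH lam) := by
  have hη := lst_pos μH hH hlam.out.le
  have hη1 := lst_le_one μH hH hlam.out.le
  have hl := hlam.out
  obtain ⟨hint, hval⟩ := integral_expMoment (lam := lam) μH hH
  rw [← hval] at hc₁
  have hnn : 0 ≤ᵐ[μH] expMoment lam := Eventually.of_forall (expMoment_nonneg hl)
  have hc0 : 0 ≤ c₁ := hc₁ ▸ integral_nonneg_of_ae hnn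
  have hEB : 0 ≤ (1 - lst μH lam) / lam / lst μH lam :=
    div_nonneg (div_nonneg (by linarith) hl.le) hη.le
  have hmc : MeasurableSet {ω : Stream | xs ω 0 < hs ω 0} :=
    measurableSet_lt (by fun_prop) (by fun_prop)
  refine ⟨hc0, ?_⟩
  have hg : Measurable ({ω : Stream | xs ω 0 < hs ω 0}.indicator
      fun ω => ENNReal.ofReal (2 * xs ω 0)) := Measurable.indicator (by fun_prop) hmc
  have hf : Measurable fun ω => ENNReal.ofReal (svcTime ω) := by fun_prop
  have hms := measurable_shift 1 1 0
  have h := lintegral_of_renewal_equation (ν := 𝓛) (F := fun ω => ENNReal.ofReal (svcTime ω ^ 2))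
    (ξ := fun ω => ENNReal.ofReal (min (xs ω 0) (hs ω 0) ^ 2) +
      {ω | xs ω 0 < hs ω 0}.indicator (fun ω => ENNReal.ofReal (2 * xs ω 0)) ω *
        ENNReal.ofReal (svcTime (shift 1 1 0 ω))) (c := {ω | xs ω 0 < hs ω 0})
    (τ := shift 1 1 0) (p := 1 - lst μH lam)
    (A := 2 / lam * c₁ + 2 * c₁ * ((1 - lst μH lam) / lam / lst μH lam)) (by fun_prop)
    ((by fun_prop : Measurable fun ω => ENNReal.ofReal (min (xs ω 0) (hs ω 0) ^ 2)).add
      (hg.mul (hf.comp hms))) (by linarith) (by linarith)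
    (by positivity)
    (fun f hf => lintegral_preempt hH hf) ?_ ?_
  · simpa using h
  · filter_upwards [hgood] with ω hω
    refine eq_add_indicator (fun (h : xs ω 0 < hs ω 0) => ?_)
      (fun (h : ¬ (xs ω 0 < hs ω 0)) => ?_)
    · have hs0 : 0 ≤ svcTime (shift 1 1 0 ω) := by
        refine add_nonneg (Finset.sum_nonneg fun i _ => (hω.xs_pos _).le) (hω.hs_nonneg _)
      have h' : ω ∈ {ω : Stream | xs ω 0 < hs ω 0} := h
      have hx := (hω.xs_pos 0).le
      rw [svcTime_of_lt hω h, min_eq_left h.le, indicator_of_mem h',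
        ← ENNReal.ofReal_mul (by positivity), ← ENNReal.ofReal_add (by positivity) (by positivity),
        ← ENNReal.ofReal_add (by positivity) (by positivity)]
      congr 1
      ring
    · have h' : ω ∉ {ω : Stream | xs ω 0 < hs ω 0} := h
      rw [svcTime_of_le (not_lt.1 h), min_eq_right (not_lt.1 h), indicator_of_notMem h', zero_mul,
        add_zero]
  · rw [lintegral_add_left (by fun_prop), lintegral_mul_shift 1 1 0 hg hf (fun ω => rfl),
      lintegral_svcTime hgood hH, ENNReal.ofReal_add (by positivity) (by positivity),
      ENNReal.ofReal_mul (by positivity : 0 ≤ 2 * c₁)]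
    have hm2 : MeasurableSet {z : ℝ × ℝ | z.2 < z.1} := measurableSet_lt measurable_snd measurable_fst
    congr 1
    · refine (lintegral_hs_xs (F := fun h x => ENNReal.ofReal (min x h ^ 2))
        (by fun_prop) 0).trans ?_
      rw [hc₁, ← integral_const_mul, ofReal_integral_eq_lintegral_ofReal (hint.const_mul _)]
      · refine lintegral_congr_ae ?_
        filter_upwards [hH] with h hh using lintegral_min_sq_expMeasure hlam.out hh
      · filter_upwards [hnn] with h hh using mul_nonneg (by positivity) hh
    · congr 1
      refine (lintegral_hs_xs (F := fun h x => {z : ℝ × ℝ | z.2 < z.1}.indicator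
        (fun z => ENNReal.ofReal (2 * z.2)) (h, x)) (Measurable.indicator
            (by fun_prop) hm2) 0).trans ?_
      rw [hc₁, ← integral_const_mul, ofReal_integral_eq_lintegral_ofReal (hint.const_mul _)]
      · refine lintegral_congr_ae ?_
        filter_upwards [hH] with h hh
        rw [ENNReal.ofReal_mul zero_le_two, ← lintegral_id_expMeasure hl hh,
          ← lintegral_const_mul _ (by
            exact Measurable.indicator ENNReal.measurable_ofReal measurableSet_Iio)]
        refine lintegral_congr fun x => ?_
        by_cases hx : x < h
        · have h1 : (h, x) ∈ {z : ℝ × ℝ | z.2 < z.1} := hx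
          have h2 : x ∈ Iio h := hx
          rw [indicator_of_mem h1, indicator_of_mem h2, ENNReal.ofReal_mul zero_le_two]
        · have h1 : (h, x) ∉ {z : ℝ × ℝ | z.2 < z.1} := hx
          have h2 : x ∉ Iio h := hx
          rw [indicator_of_notMem h1, indicator_of_notMem h2, mul_zero]
      · filter_upwards [hnn] with h hh using mul_nonneg zero_le_two hh

lemma measure_numPre_eq_zero (hgood : ∀ᵐ ω ∂𝓛, Good ω) (hH : ∀ᵐ x ∂μH, 0 ≤ x) :
    𝓛 {ω | numPre ω = 0} = ENNReal.ofReal (lst μH lam) := by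
  have hη1 := lst_le_one μH hH hlam.out.le
  have hmc : MeasurableSet {ω : Stream | xs ω 0 < hs ω 0} :=
    measurableSet_lt (by fun_prop) (by fun_prop)
  have h1 : 𝓛 {ω | numPre ω = 0} = 𝓛 {ω : Stream | xs ω 0 < hs ω 0}ᶜ := by
    refine measure_congr (Filter.eventuallyEq_set.2 ?_)
    filter_upwards [hgood] with ω hω
    exact (numPre_eq_zero_iff hω).trans not_lt.symm
  rw [h1, prob_compl_eq_one_sub hmc, measure_xs_lt_hs hH, ← ENNReal.ofReal_one,
    ← ENNReal.ofReal_sub _ (by linarith), sub_sub_cancel]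

end Moments

section VacationMoments

variable {lam : ℝ} {μH μV : Measure ℝ} [hlam : Fact (0 < lam)] [IsProbabilityMeasure μH]
  [IsProbabilityMeasure μV]

local notation "𝓛" => streamLaw lam μH μV

/-! ### Moments of the vacation period -/

/-- Regeneration after the first vacation when nothing arrived in it: the elapsed part of the
inter-arrival time is the vacation itself. The weight `g` serves the cross term of the second
moment. -/
lemma lintegral_mul_afterOneVac (hV : ∀ᵐ x ∂μV, 0 ≤ x) {g : ℝ → ℝ≥0∞} (hg : Measurable g)
    {f : Stream → ℝ≥0∞} (hf : Measurable f) :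
    ∫⁻ ω, g (vs ω 0) * {ω | vs ω 0 < xs ω 0}.indicator (fun ω => f (afterOneVac ω)) ω ∂𝓛 =
      (∫⁻ v, g v * ENNReal.ofReal (Real.exp (-(lam * v))) ∂μV) * ∫⁻ ω, f ω ∂𝓛 := by
  have h := lintegral_mul_delay_shift (lam := lam) (μH := μH) (μV := μV) 0 0 1
    (g := fun ω => g (vs ω 0)) (U := fun ω => vs ω 0) (f := f) (by fun_prop) (by fun_prop) hf
    (fun ω => rfl) (fun ω => rfl) ((ae_vs_nonneg hV).mono fun ω h _ => h 0)
  refine h.trans ?_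
  congr 1
  exact lintegral_vs (f := fun v => g v * ENNReal.ofReal (Real.exp (-(lam * v)))) (by fun_prop) 0

lemma lintegral_afterOneVac (hV : ∀ᵐ x ∂μV, 0 ≤ x) {f : Stream → ℝ≥0∞} (hf : Measurable f) :
    ∫⁻ ω, {ω | vs ω 0 < xs ω 0}.indicator (fun ω => f (afterOneVac ω)) ω ∂𝓛 =
      ENNReal.ofReal (lst μV lam) * ∫⁻ ω, f ω ∂𝓛 := by
  have h := lintegral_mul_afterOneVac (lam := lam) (μH := μH) hV (g := fun _ => 1)
    measurable_const hf
  simp only [one_mul] at h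
  rw [h, ofReal_lst μV hV hlam.out.le]

lemma vacTime_afterOneVac_nonneg {ω : Stream} (hω : Good ω) (h : vs ω 0 < xs ω 0) :
    0 ≤ vacTime (afterOneVac ω) := by
  have h1 := vacTime_of_lt hω h
  have h2 := hω.xs_le_vacTime
  linarith

/-- One-step analysis: the first vacation, followed by a fresh vacation period if it ended with an
empty buffer. -/
lemma lintegral_vacTime (hgood : ∀ᵐ ω ∂𝓛, Good ω) (hV : ∀ᵐ x ∂μV, 0 ≤ x)
    (hVpos : 0 < μV (Ioi 0)) (hV1 : Integrable (fun x => x) μV) :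
    ∫⁻ ω, ENNReal.ofReal (vacTime ω) ∂𝓛 = ENNReal.ofReal ((∫ x, x ∂μV) / (1 - lst μV lam)) := by
  refine lintegral_of_renewal_equation (ξ := fun ω => ENNReal.ofReal (vs ω 0))
    (c := {ω | vs ω 0 < xs ω 0}) (τ := afterOneVac) (by fun_prop) (by fun_prop)
    (lst_pos μV hV hlam.out.le).le (lst_lt_one μV hV hVpos hlam.out) (integral_nonneg_of_ae hV)
    (fun f hf => lintegral_afterOneVac hV hf) ?_ ?_
  · filter_upwards [hgood] with ω hω
    refine eq_add_indicator (fun (h : vs ω 0 < xs ω 0) => ?_) (fun (h : ¬ (vs ω 0 < xs ω 0)) => ?_)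
    · rw [vacTime_of_lt hω h,
        ENNReal.ofReal_add (hω.vs_nonneg 0) (vacTime_afterOneVac_nonneg hω h)]
    · rw [vacTime_of_le (not_lt.1 h)]
  · rw [lintegral_vs ENNReal.measurable_ofReal, ofReal_integral_eq_lintegral_ofReal hV1 hV]

/-- The square of the one-step recursion. The cross term factors because the fresh vacation period
is independent of the first vacation, which leaves E[V exp(-λV)]. -/
lemma lintegral_vacTime_sq (hgood : ∀ᵐ ω ∂𝓛, Good ω) (hV : ∀ᵐ x ∂μV, 0 ≤ x)
    (hVpos : 0 < μV (Ioi 0)) (hV1 : Integrable (fun x => x) μV)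
    (hV2 : Integrable (fun x => x ^ 2) μV) :
    ∫⁻ ω, ENNReal.ofReal (vacTime ω ^ 2) ∂𝓛 = ENNReal.ofReal ((∫ x, x ^ 2 ∂μV +
      2 * (∫ x, x * Real.exp (-(lam * x)) ∂μV) * ((∫ x, x ∂μV) / (1 - lst μV lam))) /
        (1 - lst μV lam)) := by
  have hq := lst_lt_one μV hV hVpos hlam.out
  have hnn : 0 ≤ᵐ[μV] fun x => x * Real.exp (-(lam * x)) := by
    filter_upwards [hV] with x hx
    exact mul_nonneg hx (Real.exp_pos _).le
  have hE1 : 0 ≤ ∫ x, x ∂μV := integral_nonneg_of_ae hV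
  have hE2 : 0 ≤ ∫ x, x ^ 2 ∂μV := integral_nonneg fun x => sq_nonneg x
  have hm1 : 0 ≤ ∫ x, x * Real.exp (-(lam * x)) ∂μV := integral_nonneg_of_ae hnn
  have hES : 0 ≤ (∫ x, x ∂μV) / (1 - lst μV lam) := div_nonneg hE1 (by linarith)
  have hmc : MeasurableSet {ω : Stream | vs ω 0 < xs ω 0} :=
    measurableSet_lt (by fun_prop) (by fun_prop)
  have hf : Measurable fun ω => ENNReal.ofReal (vacTime ω) := by fun_prop
  have hmi : Measurable ({ω : Stream | vs ω 0 < xs ω 0}.indicator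
      fun ω => ENNReal.ofReal (vacTime (afterOneVac ω))) :=
    (hf.comp measurable_afterOneVac).indicator hmc
  refine lintegral_of_renewal_equation (ξ := fun ω => ENNReal.ofReal (vs ω 0 ^ 2) +
      ENNReal.ofReal (2 * vs ω 0) * {ω : Stream | vs ω 0 < xs ω 0}.indicator
        (fun ω => ENNReal.ofReal (vacTime (afterOneVac ω))) ω)
    (c := {ω | vs ω 0 < xs ω 0}) (τ := afterOneVac) (by fun_prop) (by fun_prop)
    (lst_pos μV hV hlam.out.le).le hq (by positivity)
    (fun f hf => lintegral_afterOneVac hV hf) ?_ ?_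
  · filter_upwards [hgood] with ω hω
    refine eq_add_indicator (fun (h : vs ω 0 < xs ω 0) => ?_) (fun (h : ¬ (vs ω 0 < xs ω 0)) => ?_)
    · have h' : ω ∈ {ω : Stream | vs ω 0 < xs ω 0} := h
      have hv := hω.vs_nonneg 0
      have hvt := vacTime_afterOneVac_nonneg hω h
      rw [vacTime_of_lt hω h, indicator_of_mem h', ← ENNReal.ofReal_mul (by positivity),
        ← ENNReal.ofReal_add (by positivity) (by positivity),
        ← ENNReal.ofReal_add (by positivity) (by positivity)]
      congr 1
      ring
    · have h' : ω ∉ {ω : Stream | vs ω 0 < xs ω 0} := h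
      rw [vacTime_of_le (not_lt.1 h), indicator_of_notMem h', mul_zero, add_zero]
  · rw [lintegral_add_left (by fun_prop), lintegral_vs (f := fun x => ENNReal.ofReal (x ^ 2))
      (by fun_prop), lintegral_mul_afterOneVac hV (g := fun v => ENNReal.ofReal (2 * v))
      (by fun_prop) hf, lintegral_vacTime hgood hV hVpos hV1,
      ENNReal.ofReal_add hE2 (by positivity), ENNReal.ofReal_mul (by positivity),
      ofReal_integral_eq_lintegral_ofReal hV2 (Eventually.of_forall fun x => sq_nonneg x),
      ← integral_const_mul, ofReal_integral_eq_lintegral_ofReal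
        ((integrable_id_mul_exp_neg μV hV hlam.out).const_mul 2)]
    · congr 2
      refine lintegral_congr_ae ?_
      filter_upwards [hV] with x hx
      rw [← ENNReal.ofReal_mul (by positivity)]
      congr 1
      ring
    · filter_upwards [hnn] with x hx using mul_nonneg zero_le_two hx

/-! ### Campbell's formula and the age of the buffered packet -/

/-- Tonelli: a point s at distance r beyond b is covered with probability P(x ≥ r) = exp(-λr), and λ
times this is the density at r. An arrival is thus traded for Lebesgue measure on the gap before it,
one summand of Campbell's formula. -/
lemma lintegral_expMeasure_add {b : ℝ} {F : ℝ → ℝ≥0∞} (hF : Measurable F) :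
    ∫⁻ x, F (b + x) ∂(expMeasure lam) =
      ENNReal.ofReal lam * ∫⁻ x, (∫⁻ s in Ioc b (b + x), F s) ∂(expMeasure lam) := by
  have := isProbabilityMeasure_expMeasure hlam.out
  have h1 : ∀ x : ℝ, ∫⁻ s in Ioc b (b + x), F s =
      ∫⁻ s in Ioi 0, {z : ℝ × ℝ | z.1 ≤ z.2}.indicator (fun z => F (b + z.1)) (s, x) := by
    intro x
    rw [← lintegral_indicator measurableSet_Ioc, ← lintegral_indicator measurableSet_Ioi,
      ← lintegral_add_left_eq_self _ b]
    refine lintegral_congr fun s => ?_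
    by_cases h1 : 0 < s <;> by_cases h2 : s ≤ x <;> simp [indicator, h1, h2]
  have hm : MeasurableSet {z : ℝ × ℝ | z.1 ≤ z.2} := measurableSet_le measurable_fst measurable_snd
  have hmi : Measurable ({z : ℝ × ℝ | z.1 ≤ z.2}.indicator fun z => F (b + z.1)) :=
    Measurable.indicator (by fun_prop) hm
  simp_rw [h1]
  rw [lintegral_lintegral_swap (by
      exact (hmi.comp measurable_swap).aemeasurable), lintegral_expMeasure lam (by fun_prop),
    ← lintegral_const_mul _ (by
      have : Measurable fun z : ℝ × ℝ => {z : ℝ × ℝ | z.1 ≤ z.2}.indicator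
        (fun z => F (b + z.1)) (z.1, z.2) := hmi
      exact this.lintegral_prod_right')]
  refine setLIntegral_congr_fun measurableSet_Ioi fun s (hs : 0 < s) => ?_
  have h2 : ∀ x : ℝ, {z : ℝ × ℝ | z.1 ≤ z.2}.indicator (fun z => F (b + z.1)) (s, x) =
      (Ici s).indicator (fun _ => F (b + s)) x := fun x => rfl
  simp_rw [h2]
  rw [lintegral_indicator_const measurableSet_Ici, expMeasure_Ici hlam.out hs.le,
    ENNReal.ofReal_mul hlam.out.le]
  ring

lemma arrivalTime_eq_sum (ω : Stream) (j : ℕ) :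
    arrivalTime (xs ω) j = ∑ i ∈ Finset.range j, xs ω i + xs ω j := by
  rw [arrivalTime, Finset.sum_range_succ]

/-- Campbell's formula for the arrivals. -/
lemma tsum_lintegral_arrivalTime (hgood : ∀ᵐ ω ∂𝓛, Good ω) {F : ℝ → ℝ → ℝ≥0∞}
    (hF : Measurable (Function.uncurry F)) :
    ∑' j, ∫⁻ ω, F (vs ω 0) (arrivalTime (xs ω) j) ∂𝓛 =
      ENNReal.ofReal lam * ∫⁻ v, (∫⁻ s in Ioi 0, F v s) ∂μV := by
  have := isProbabilityMeasure_expMeasure hlam.out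
  have hFv : ∀ v, Measurable (F v) := fun v => hF.comp (measurable_const.prodMk measurable_id)
  have hset : MeasurableSet {z : (ℝ × ℝ × ℝ) × ℝ | z.1.2.1 < z.2 ∧ z.2 ≤ z.1.2.1 + z.1.2.2} := by
    have h1 : MeasurableSet {z : (ℝ × ℝ × ℝ) × ℝ | z.1.2.1 < z.2} :=
      measurableSet_lt (by fun_prop) (by fun_prop)
    have h2 : MeasurableSet {z : (ℝ × ℝ × ℝ) × ℝ | z.2 ≤ z.1.2.1 + z.1.2.2} :=
      measurableSet_le (by fun_prop) (by fun_prop)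
    exact h1.inter h2
  have hmI : Measurable fun z : ℝ × ℝ × ℝ => ∫⁻ s in Ioc z.2.1 (z.2.1 + z.2.2), F z.1 s := by
    have h : Measurable ({z : (ℝ × ℝ × ℝ) × ℝ | z.1.2.1 < z.2 ∧ z.2 ≤ z.1.2.1 + z.1.2.2}.indicator
        fun z => F z.1.1 z.2) :=
      Measurable.indicator (hF.comp (by fun_prop :
        Measurable fun z : (ℝ × ℝ × ℝ) × ℝ => (z.1.1, z.2))) hset
    convert h.lintegral_prod_right' (ν := volume) using 2 with z
    rw [← lintegral_indicator measurableSet_Ioc]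
    rfl
  -- The `j`-th arrival is replaced by λ times the integral over the gap ending at it; its last
  -- inter-arrival time is independent of the vacation and of the earlier arrivals. The gaps tile
  -- (0, ∞).
  have hj : ∀ j, ∫⁻ ω, F (vs ω 0) (arrivalTime (xs ω) j) ∂𝓛 =
      ENNReal.ofReal lam * ∫⁻ ω, (∫⁻ s in Ioc (∑ i ∈ Finset.range j, xs ω i)
        (∑ i ∈ Finset.range (j + 1), xs ω i), F (vs ω 0) s) ∂𝓛 := by
    intro j
    have hind : IndepFun (fun ω => (vs ω 0, ∑ i ∈ Finset.range j, xs ω i)) (fun ω => xs ω j) 𝓛 := by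
      have h := (indepFun_past_shift (lam := lam) (μH := μH) (μV := μV) j 0 1).comp
        (φ := fun ω => (vs ω 0, ∑ i ∈ Finset.range j, xs ω i)) (ψ := fun ω => xs ω 0)
        (by fun_prop) (by fun_prop)
      have h2 : ((fun ω => (vs ω 0, ∑ i ∈ Finset.range j, xs ω i)) ∘ past j 0 1) =
          fun ω => (vs ω 0, ∑ i ∈ Finset.range j, xs ω i) := by
        funext ω
        simp only [Function.comp, Prod.mk.injEq]
        exact ⟨rfl, Finset.sum_congr rfl fun i hi => by
          rw [xs_past, if_pos (Finset.mem_range.1 hi)]⟩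
      rwa [h2] at h
    have e1 := lintegral_prodMk_of_indepFun hind (by fun_prop) (by fun_prop)
      (F := fun z x => F z.1 (z.2 + x))
      (hF.comp (by fun_prop : Measurable fun z : (ℝ × ℝ) × ℝ => (z.1.1, z.1.2 + z.2)))
    have e2 := lintegral_prodMk_of_indepFun hind (by fun_prop) (by fun_prop)
      (F := fun z x => ∫⁻ s in Ioc z.2 (z.2 + x), F z.1 s)
      (hmI.comp (by fun_prop : Measurable fun z : (ℝ × ℝ) × ℝ => (z.1.1, z.1.2, z.2)))
    simp only [map_xs] at e1 e2
    simp only [arrivalTime_eq_sum, Finset.sum_range_succ]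
    rw [e1, e2, ← lintegral_const_mul]
    · exact lintegral_congr fun ω => lintegral_expMeasure_add (hFv _)
    · have h3 := (hmI.comp (by fun_prop : Measurable fun z : Stream × ℝ =>
        (vs z.1 0, ∑ i ∈ Finset.range j, xs z.1 i, z.2))).lintegral_prod_right'
        (ν := expMeasure lam)
      exact h3
  have hmj : ∀ j, Measurable fun ω : Stream => ∫⁻ s in Ioc (∑ i ∈ Finset.range j, xs ω i)
        (∑ i ∈ Finset.range (j + 1), xs ω i), F (vs ω 0) s := by
    intro j
    have := hmI.comp (by fun_prop : Measurable fun ω : Stream =>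
        (vs ω 0, ∑ i ∈ Finset.range j, xs ω i, xs ω j))
    simpa only [Finset.sum_range_succ, Function.comp_def] using this
  simp_rw [hj]
  rw [ENNReal.tsum_mul_left, ← lintegral_tsum fun j => (hmj j).aemeasurable]
  congr 1
  have hm : Measurable fun v => ∫⁻ s in Ioi 0, F v s :=
    Measurable.lintegral_prod_right' (ν := volume.restrict (Ioi 0)) hF
  rw [← lintegral_vs (lam := lam) (μH := μH) hm 0]
  refine lintegral_congr_ae ?_
  filter_upwards [hgood] with ω hω
  have hmono : Monotone fun j => ∑ i ∈ Finset.range j, xs ω i :=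
    monotone_nat_of_le_succ fun n => by
      rw [Finset.sum_range_succ]; linarith [hω.xs_pos n]
  have hU : ⋃ j, Ioc (∑ i ∈ Finset.range j, xs ω i) (∑ i ∈ Finset.range (j + 1), xs ω i) =
      Ioi 0 := by
    have h := iUnion_Ioc_map_succ_eq_Ioi (f := fun j => ∑ i ∈ Finset.range j, xs ω i)
      (fun n => hmono bot_le) (not_bddAbove_of_tendsto_atTop (l := atTop) ?_)
    · simpa using h
    · rw [← tendsto_add_atTop_iff_nat 1]
      exact hω.arr
  have hdis := hmono.pairwise_disjoint_on_Ioc_succ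
  simp only [Order.succ_eq_add_one] at hdis
  rw [← hU, lintegral_iUnion (fun _ => measurableSet_Ioc) hdis]

omit [IsProbabilityMeasure μH] [IsProbabilityMeasure μV] in
-- The reflection s ↦ v - s. The integrand is an arrival at s, weighted by its age at v and by the
-- probability of no arrival in between.
lemma lintegral_Ioi_expMoment {v : ℝ} (hv : 0 ≤ v) :
    ENNReal.ofReal lam * ∫⁻ s in Ioi 0, (Iic v).indicator (fun s => ENNReal.ofReal (v - s) *
      ENNReal.ofReal (Real.exp (-(lam * (v - s))))) s = ENNReal.ofReal (expMoment lam v) := by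
  rw [← lintegral_id_expMeasure hlam.out hv,
    lintegral_expMeasure lam (ENNReal.measurable_ofReal.indicator measurableSet_Iio),
    ← lintegral_indicator measurableSet_Ioi, ← lintegral_indicator measurableSet_Ioi,
    ← lintegral_const_mul _ (Measurable.indicator (Measurable.indicator (by fun_prop)
      measurableSet_Iic) measurableSet_Ioi), ← lintegral_sub_left_eq_self (μ := volume) _ v]
  refine lintegral_congr fun s => ?_
  have hl := hlam.out
  rcases lt_trichotomy s 0 with hs | hs | hs
  · simp [indicator, hs.not_gt, hs.le]
  · simp [indicator, hs]
  · rcases lt_or_ge s v with hsv | hsv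
    · simp only [indicator, mem_Ioi, hs, if_true, mem_Iic, sub_pos, hsv, mem_Iio, sub_le_self_iff,
        hs.le, sub_sub_cancel]
      rw [ENNReal.ofReal_mul hl.le]
      ring
    · simp [indicator, hsv.not_gt]

/-- If nothing arrives in the first vacation, the age is that of the fresh stream. Otherwise the
vacation period is that first vacation, and summing over which arrival is the last one in it leads
to Campbell's formula. -/
lemma lintegral_bufAge (hgood : ∀ᵐ ω ∂𝓛, Good ω) (hV : ∀ᵐ x ∂μV, 0 ≤ x)
    (hVpos : 0 < μV (Ioi 0)) :
    ∫⁻ ω, ENNReal.ofReal (bufAge ω) ∂𝓛 =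
      ENNReal.ofReal (((1 - lst μV lam) / lam - ∫ x, x * Real.exp (-(lam * x)) ∂μV) /
        (1 - lst μV lam)) := by
  obtain ⟨hint, hval⟩ := integral_expMoment (lam := lam) μV hV
  have hnn : 0 ≤ᵐ[μV] expMoment lam := Eventually.of_forall (expMoment_nonneg hlam.out)
  rw [← hval]
  have hm : MeasurableSet {ω : Stream | xs ω 0 ≤ vs ω 0} :=
    measurableSet_le (by fun_prop) (by fun_prop)
  refine lintegral_of_renewal_equation
    (ξ := {ω | xs ω 0 ≤ vs ω 0}.indicator fun ω => ENNReal.ofReal (bufAge ω))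
    (c := {ω | vs ω 0 < xs ω 0}) (τ := afterOneVac) (by fun_prop)
    (Measurable.indicator (by fun_prop) hm)
    (lst_pos μV hV hlam.out.le).le (lst_lt_one μV hV hVpos hlam.out) (integral_nonneg_of_ae hnn)
    (fun f hf => lintegral_afterOneVac hV hf) ?_ ?_
  · filter_upwards [hgood] with ω hω
    refine eq_add_indicator (fun (h : vs ω 0 < xs ω 0) => ?_) (fun (h : ¬ (vs ω 0 < xs ω 0)) => ?_)
    · have h' : ω ∉ {ω : Stream | xs ω 0 ≤ vs ω 0} := not_le.2 h
      rw [bufAge_of_lt hω h, indicator_of_notMem h', zero_add]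
    · have h' : ω ∈ {ω : Stream | xs ω 0 ≤ vs ω 0} := not_lt.1 h
      rw [indicator_of_mem h']
  · have hmj : ∀ j, MeasurableSet {ω : Stream | arrivalTime (xs ω) j ≤ vs ω 0} := fun j =>
      measurableSet_le (by fun_prop) (by fun_prop)
    have hmU : ∀ j, MeasurableSet {ω : Stream | vs ω 0 - arrivalTime (xs ω) j < xs ω (j + 1)} :=
      fun j => measurableSet_lt (by fun_prop) (by fun_prop)
    have hgj : ∀ j, Measurable ({ω : Stream | arrivalTime (xs ω) j ≤ vs ω 0}.indicator fun ω =>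
        ENNReal.ofReal (vs ω 0 - arrivalTime (xs ω) j)) := fun j =>
      Measurable.indicator (by fun_prop) (hmj j)
    -- Exactly one arrival, number `lastArr ω`, is followed by a gap reaching past the end of the
    -- vacation; the event that something arrives is split accordingly.
    have e1 : ∫⁻ ω, {ω : Stream | xs ω 0 ≤ vs ω 0}.indicator
        (fun ω => ENNReal.ofReal (bufAge ω)) ω ∂𝓛 =
        ∑' j, ∫⁻ ω, {ω : Stream | arrivalTime (xs ω) j ≤ vs ω 0}.indicator (fun ω =>
          ENNReal.ofReal (vs ω 0 - arrivalTime (xs ω) j)) ω *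
            {ω : Stream | vs ω 0 - arrivalTime (xs ω) j < xs ω (j + 1)}.indicator
              (fun _ => (1 : ℝ≥0∞)) ω ∂𝓛 := by
      have hprod : ∀ j, Measurable fun ω : Stream =>
          {ω : Stream | arrivalTime (xs ω) j ≤ vs ω 0}.indicator (fun ω =>
          ENNReal.ofReal (vs ω 0 - arrivalTime (xs ω) j)) ω *
            {ω : Stream | vs ω 0 - arrivalTime (xs ω) j < xs ω (j + 1)}.indicator
              (fun _ => (1 : ℝ≥0∞)) ω := fun j =>
        (hgj j).mul (measurable_const.indicator (hmU j))
      rw [← lintegral_tsum fun j => (hprod j).aemeasurable]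
      refine lintegral_congr_ae ?_
      filter_upwards [hgood] with ω hω
      by_cases h : xs ω 0 ≤ vs ω 0
      · have hv : vacTime ω = vs ω 0 := vacTime_of_le h
        have h0 : ω ∈ {ω : Stream | xs ω 0 ≤ vs ω 0} := h
        rw [indicator_of_mem h0, tsum_eq_single (lastArr ω)]
        · have h1 := (hω.lastArr_eq_iff _).1 rfl
          rw [hv, arrivalTime_succ] at h1
          have h2 : ω ∈ {ω' : Stream | arrivalTime (xs ω') (lastArr ω) ≤ vs ω' 0} := h1.1
          have h3 : ω ∈ {ω' : Stream | vs ω' 0 - arrivalTime (xs ω') (lastArr ω) <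
            xs ω' (lastArr ω + 1)} := sub_lt_iff_lt_add'.2 h1.2
          rw [indicator_of_mem h2, indicator_of_mem h3, mul_one, bufAge, hv]
        · intro j hj
          have h1 := mt (hω.lastArr_eq_iff j).2 (Ne.symm hj)
          rw [hv, arrivalTime_succ] at h1
          by_cases h2 : arrivalTime (xs ω) j ≤ vs ω 0
          · have h3 : ω ∉ {ω' : Stream | vs ω' 0 - arrivalTime (xs ω') j < xs ω' (j + 1)} :=
              fun h3 => h1 ⟨h2, sub_lt_iff_lt_add'.1 h3⟩
            rw [indicator_of_notMem h3, mul_zero]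
          · have h3 : ω ∉ {ω' : Stream | arrivalTime (xs ω') j ≤ vs ω' 0} := h2
            rw [indicator_of_notMem h3, zero_mul]
      · have h0 : ω ∉ {ω : Stream | xs ω 0 ≤ vs ω 0} := h
        rw [indicator_of_notMem h0, eq_comm, ENNReal.tsum_eq_zero]
        intro j
        have h1 : ω ∉ {ω' : Stream | arrivalTime (xs ω') j ≤ vs ω' 0} := by
          intro h1
          have h2 := hω.strictMono_arrivalTime.monotone (Nat.zero_le j)
          rw [arrivalTime_zero] at h2
          exact h (h2.trans h1)
        rw [indicator_of_notMem h1, zero_mul]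
    have hF : Measurable (Function.uncurry fun v s : ℝ => (Iic v).indicator (fun s =>
        ENNReal.ofReal (v - s) * ENNReal.ofReal (Real.exp (-(lam * (v - s))))) s) := by
      have hms : MeasurableSet {z : ℝ × ℝ | z.2 ≤ z.1} := measurableSet_le (by fun_prop)
          (by fun_prop)
      exact Measurable.indicator (f := fun z : ℝ × ℝ => ENNReal.ofReal (z.1 - z.2) *
        ENNReal.ofReal (Real.exp (-(lam * (z.1 - z.2))))) (by fun_prop) hms
    -- Integrating out inter-arrival time j + 1 replaces the event of no further arrival by its
    -- conditional probability.
    have e2 : ∀ j, ∫⁻ ω, {ω : Stream | arrivalTime (xs ω) j ≤ vs ω 0}.indicator (fun ω =>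
          ENNReal.ofReal (vs ω 0 - arrivalTime (xs ω) j)) ω *
            {ω : Stream | vs ω 0 - arrivalTime (xs ω) j < xs ω (j + 1)}.indicator
              (fun _ => (1 : ℝ≥0∞)) ω ∂𝓛 =
        ∫⁻ ω, (Iic (vs ω 0)).indicator (fun s => ENNReal.ofReal (vs ω 0 - s) *
          ENNReal.ofReal (Real.exp (-(lam * (vs ω 0 - s))))) (arrivalTime (xs ω) j) ∂𝓛 := by
      intro j
      have hp : ∀ ω, arrivalTime (xs (past (j + 1) 0 1 ω)) j = arrivalTime (xs ω) j :=
        arrivalTime_past (Nat.lt_succ_self j)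
      have hpv : ∀ ω, vs (past (j + 1) 0 1 ω) 0 = vs ω 0 := fun ω => rfl
      rw [lintegral_mul_delay_shift (j + 1) 0 1 (f := fun _ => 1) (hgj j)
        (U := fun ω => vs ω 0 - arrivalTime (xs ω) j) (by fun_prop) measurable_const (fun ω => ?_)
        (fun ω => by rw [hp, hpv]) (Eventually.of_forall fun ω h => ?_)]
      · simp only [lintegral_const, measure_univ, mul_one]
        refine lintegral_congr fun ω => ?_
        by_cases h : arrivalTime (xs ω) j ≤ vs ω 0
        · have h1 : ω ∈ {ω' : Stream | arrivalTime (xs ω') j ≤ vs ω' 0} := h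
          have h2 : arrivalTime (xs ω) j ∈ Iic (vs ω 0) := h
          rw [indicator_of_mem h1, indicator_of_mem h2]
        · have h1 : ω ∉ {ω' : Stream | arrivalTime (xs ω') j ≤ vs ω' 0} := h
          have h2 : arrivalTime (xs ω) j ∉ Iic (vs ω 0) := h
          rw [indicator_of_notMem h1, indicator_of_notMem h2, zero_mul]
      · have h0 : past (j + 1) 0 1 ω ∈ {ω' : Stream | arrivalTime (xs ω') j ≤ vs ω' 0} ↔
            ω ∈ {ω' : Stream | arrivalTime (xs ω') j ≤ vs ω' 0} := by
          change arrivalTime (xs (past (j + 1) 0 1 ω)) j ≤ vs (past (j + 1) 0 1 ω) 0 ↔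
            arrivalTime (xs ω) j ≤ vs ω 0
          rw [hp, hpv]
        by_cases h : ω ∈ {ω' : Stream | arrivalTime (xs ω') j ≤ vs ω' 0}
        · rw [indicator_of_mem h, indicator_of_mem (h0.2 h), hp, hpv]
        · rw [indicator_of_notMem h, indicator_of_notMem (mt h0.1 h)]
      · have h0 : ω ∈ {ω' : Stream | arrivalTime (xs ω') j ≤ vs ω' 0} := mem_of_indicator_ne_zero h
        exact sub_nonneg.2 h0
    have hm2 : Measurable fun v => ∫⁻ s in Ioi 0, (Iic v).indicator (fun s =>
        ENNReal.ofReal (v - s) * ENNReal.ofReal (Real.exp (-(lam * (v - s))))) s :=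
      Measurable.lintegral_prod_right' (ν := volume.restrict (Ioi (0 : ℝ))) hF
    rw [e1]
    simp_rw [e2]
    rw [tsum_lintegral_arrivalTime hgood hF, ofReal_integral_eq_lintegral_ofReal hint hnn,
      ← lintegral_const_mul _ hm2]
    refine lintegral_congr_ae ?_
    filter_upwards [hV] with v hv using lintegral_Ioi_expMoment hv

end VacationMoments

section CycleMoments

variable {lam : ℝ} {μH μV : Measure ℝ} [hlam : Fact (0 < lam)] [IsProbabilityMeasure μH]
  [IsProbabilityMeasure μV]

local notation "𝓛" => streamLaw lam μH μV

/-! ### Moments of the cycle -/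

/-- the mean length of the vacation period -/
noncomputable def meanVac (lam : ℝ) (μV : Measure ℝ) : ℝ := (∫ x, x ∂μV) / (1 - lst μV lam)

/-- the mean length of the busy period -/
noncomputable def meanSvc (lam : ℝ) (μH : Measure ℝ) : ℝ := (1 - lst μH lam) / lam / lst μH lam

/-- the second moment of the length of the vacation period -/
noncomputable def meanVacSq (lam : ℝ) (μV : Measure ℝ) : ℝ :=
  (∫ x, x ^ 2 ∂μV + 2 * (∫ x, x * Real.exp (-(lam * x)) ∂μV) * meanVac lam μV) / (1 - lst μV lam)

/-- the second moment of the length of the busy period -/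
noncomputable def meanSvcSq (lam : ℝ) (μH : Measure ℝ) : ℝ :=
  (2 / lam * ((1 - lst μH lam) / lam - ∫ x, x * Real.exp (-(lam * x)) ∂μH) +
    2 * ((1 - lst μH lam) / lam - ∫ x, x * Real.exp (-(lam * x)) ∂μH) * meanSvc lam μH) /
      lst μH lam

/-- the mean age of the buffered packet at the end of the vacations -/
noncomputable def meanBuf (lam : ℝ) (μV : Measure ℝ) : ℝ :=
  ((1 - lst μV lam) / lam - ∫ x, x * Real.exp (-(lam * x)) ∂μV) / (1 - lst μV lam)

/-- the mean system time of a packet that completes -/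
noncomputable def meanSys (lam : ℝ) (μH μV : Measure ℝ) : ℝ :=
  meanBuf lam μV * lst μH lam + (∫ x, x * Real.exp (-(lam * x)) ∂μH) / lst μH lam

lemma integrable_of_lintegral_ofReal {Ω : Type*} [MeasurableSpace Ω] {P : Measure Ω} {f : Ω → ℝ}
    {c : ℝ} (hf : Measurable f) (hf0 : 0 ≤ᵐ[P] f) (hc : 0 ≤ c)
    (h : ∫⁻ ω, ENNReal.ofReal (f ω) ∂P = ENNReal.ofReal c) :
    Integrable f P ∧ ∫ ω, f ω ∂P = c := by
  refine ⟨⟨hf.aestronglyMeasurable, ?_⟩, ?_⟩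
  · rw [hasFiniteIntegral_iff_ofReal hf0, h]
    exact ENNReal.ofReal_lt_top
  · rw [integral_eq_lintegral_of_nonneg_ae hf0 hf.aestronglyMeasurable, h, ENNReal.toReal_ofReal hc]

lemma svcTime_nonneg {ω : Stream} (hω : Good ω) : 0 ≤ svcTime ω :=
  hω.lastSvc_nonneg.trans hω.lastSvc_le

lemma ae_good_pair (hgood : ∀ᵐ ω ∂𝓛, Good ω) : ∀ᵐ ω ∂𝓛, Good ω ∧ Good (afterVac ω) := by
  filter_upwards [ae_good_iterate hgood] with ω hω using hω 0

lemma meanSvc_nonneg (hH : ∀ᵐ x ∂μH, 0 ≤ x) : 0 ≤ meanSvc lam μH :=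
  div_nonneg (div_nonneg (sub_nonneg.2 (lst_le_one μH hH hlam.out.le)) hlam.out.le)
    (lst_pos μH hH hlam.out.le).le

lemma meanVac_pos (hV : ∀ᵐ x ∂μV, 0 ≤ x) (hVpos : 0 < μV (Ioi 0)) (hV1 : Integrable
    (fun x => x) μV) : 0 < meanVac lam μV :=
  div_pos (integral_id_pos μV hV hVpos hV1) (sub_pos.2 (lst_lt_one μV hV hVpos hlam.out))

lemma lintegral_comp_afterVac (hgood : ∀ᵐ ω ∂𝓛, Good ω) {f : Stream → ℝ≥0∞} (hf : Measurable f) :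
    ∫⁻ ω, f (afterVac ω) ∂𝓛 = ∫⁻ ω, f ω ∂𝓛 := by
  rw [← lintegral_map hf measurable_afterVac, (indepFun_afterVac hgood).2]

lemma integral_cycleTime (hgood : ∀ᵐ ω ∂𝓛, Good ω) (hH : ∀ᵐ x ∂μH, 0 ≤ x) (hV : ∀ᵐ x ∂μV, 0 ≤ x)
    (hVpos : 0 < μV (Ioi 0)) (hV1 : Integrable (fun x => x) μV) :
    Integrable cycleTime 𝓛 ∧ ∫ ω, cycleTime ω ∂𝓛 = meanVac lam μV + meanSvc lam μH := by
  have h1 := (meanVac_pos (lam := lam) hV hVpos hV1).le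
  have h2 := meanSvc_nonneg (lam := lam) hH
  refine integrable_of_lintegral_ofReal (by fun_prop) ?_ (add_nonneg h1 h2) ?_
  · filter_upwards [ae_good_pair hgood] with ω hω using (hω.1.cycleTime_pos hω.2).le
  · rw [ENNReal.ofReal_add h1 h2, meanVac, meanSvc, ← lintegral_vacTime hgood hV hVpos hV1,
      ← lintegral_svcTime hgood hH, ← lintegral_comp_afterVac hgood (f := fun ω => ENNReal.ofReal
          (svcTime ω)) (by fun_prop),
      ← lintegral_add_left (by fun_prop)]
    refine lintegral_congr_ae ?_
    filter_upwards [ae_good_pair hgood] with ω hω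
    rw [cycleTime, ENNReal.ofReal_add hω.1.vacTime_pos.le (svcTime_nonneg hω.2)]

lemma integral_cycleTime_sq (hgood : ∀ᵐ ω ∂𝓛, Good ω) (hH : ∀ᵐ x ∂μH, 0 ≤ x) (hV : ∀ᵐ x ∂μV,
    0 ≤ x) (hVpos : 0 < μV (Ioi 0)) (hV1 : Integrable (fun x => x) μV) (hV2 : Integrable
    (fun x => x ^ 2) μV) :
    Integrable (fun ω => cycleTime ω ^ 2) 𝓛 ∧ ∫ ω, cycleTime ω ^ 2 ∂𝓛 =
      meanVacSq lam μV + 2 * meanVac lam μV * meanSvc lam μH + meanSvcSq lam μH := by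
  have h1 := (meanVac_pos (lam := lam) hV hVpos hV1).le
  have h2 := meanSvc_nonneg (lam := lam) hH
  obtain ⟨h0, hsq⟩ := lintegral_svcTime_sq hgood hH rfl
  have hη := lst_pos μH hH hlam.out.le
  have hl := hlam.out
  have h3 : 0 ≤ meanSvcSq lam μH := by
    rw [meanSvcSq]
    positivity
  have hm1 : 0 ≤ ∫ x, x * Real.exp (-(lam * x)) ∂μV := integral_nonneg_of_ae (by
    filter_upwards [hV] with x hx
    exact mul_nonneg hx (Real.exp_pos _).le)
  have h4 : 0 ≤ meanVacSq lam μV := by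
    have := sub_pos.2 (lst_lt_one μV hV hVpos hlam.out)
    have : 0 ≤ ∫ x, x ^ 2 ∂μV := integral_nonneg fun x => sq_nonneg x
    rw [meanVacSq]
    positivity
  refine integrable_of_lintegral_ofReal (by fun_prop) (Eventually.of_forall fun ω => sq_nonneg _)
    (by positivity) ?_
  -- The cross moment factors because the busy period is a function of the stream after the
  -- vacations, which is independent of their length.
  have hmul : ∫⁻ ω, ENNReal.ofReal (vacTime ω) * ENNReal.ofReal (svcTime (afterVac ω)) ∂𝓛 =
      ENNReal.ofReal (meanVac lam μV) * ENNReal.ofReal (meanSvc lam μH) := by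
    rw [meanVac, meanSvc, ← lintegral_vacTime hgood hV hVpos hV1, ← lintegral_svcTime hgood hH,
      ← lintegral_comp_afterVac hgood (f := fun ω => ENNReal.ofReal (svcTime ω)) (by fun_prop)]
    exact lintegral_mul_eq_lintegral_mul_lintegral_of_indepFun (by fun_prop) (by fun_prop)
      ((indepFun_afterVac hgood).1.comp (φ := fun z : ℝ × ℝ => ENNReal.ofReal z.1)
        (ψ := fun ω => ENNReal.ofReal (svcTime ω)) (by fun_prop) (by fun_prop))
  rw [ENNReal.ofReal_add (by positivity) h3, ENNReal.ofReal_add h4 (by positivity),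
    ENNReal.ofReal_mul (by positivity), ENNReal.ofReal_mul zero_le_two, mul_assoc, ← hmul,
    meanSvcSq, meanSvc, ← hsq, meanVacSq, meanVac, ← lintegral_vacTime_sq hgood hV hVpos hV1 hV2,
    ← lintegral_comp_afterVac hgood (f := fun ω => ENNReal.ofReal (svcTime ω ^ 2)) (by fun_prop),
    ← lintegral_const_mul _ (by fun_prop), ← lintegral_add_left (by fun_prop),
    ← lintegral_add_left (by fun_prop)]
  refine lintegral_congr_ae ?_
  filter_upwards [ae_good_pair hgood] with ω hω
  have hv := hω.1.vacTime_pos.le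
  have hs := svcTime_nonneg hω.2
  rw [cycleTime, ← ENNReal.ofReal_mul hv, ← ENNReal.ofReal_mul zero_le_two,
    ← ENNReal.ofReal_add (by positivity) (by positivity),
    ← ENNReal.ofReal_add (by positivity) (by positivity)]
  congr 1
  ring

/-- Whether a preemption occurs is decided by the stream after the vacations, which is independent
of `bufAge`; hence the factor H*(λ) on the mean buffered age. -/
lemma integral_sysTime (hgood : ∀ᵐ ω ∂𝓛, Good ω) (hH : ∀ᵐ x ∂μH, 0 ≤ x) (hV : ∀ᵐ x ∂μV, 0 ≤ x)
    (hVpos : 0 < μV (Ioi 0)) :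
    Integrable sysTime 𝓛 ∧ ∫ ω, sysTime ω ∂𝓛 = meanSys lam μH μV ∧ 0 ≤ meanSys lam μH μV := by
  have hη := lst_pos μH hH hlam.out.le
  have h1 : 0 ≤ meanBuf lam μV := by
    rw [meanBuf, ← (integral_expMoment μV hV).2]
    exact div_nonneg (integral_nonneg (expMoment_nonneg hlam.out))
      (sub_pos.2 (lst_lt_one μV hV hVpos hlam.out)).le
  have h2 : 0 ≤ (∫ x, x * Real.exp (-(lam * x)) ∂μH) / lst μH lam :=
    div_nonneg (integral_nonneg_of_ae (by
      filter_upwards [hH] with x hx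
      exact mul_nonneg hx (Real.exp_pos _).le)) hη.le
  have h3 : 0 ≤ meanSys lam μH μV := add_nonneg (mul_nonneg h1 hη.le) h2
  have hset : MeasurableSet {ω : Stream | numPre ω = 0} := measurable_numPre
      (measurableSet_singleton 0)
  suffices h : Integrable sysTime 𝓛 ∧ ∫ ω, sysTime ω ∂𝓛 = meanSys lam μH μV from ⟨h.1, h.2, h3⟩
  refine integrable_of_lintegral_ofReal (by fun_prop) ?_ h3 ?_
  · filter_upwards [ae_good_pair hgood] with ω hω using hω.1.sysTime_nonneg hω.2
  have hind : Measurable ({ω : Stream | numPre ω = 0}.indicator (1 : Stream → ℝ≥0∞)) :=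
    measurable_one.indicator hset
  have hmul : ∫⁻ ω, ENNReal.ofReal (bufAge ω) *
      {ω : Stream | numPre ω = 0}.indicator (1 : Stream → ℝ≥0∞) (afterVac ω) ∂𝓛 =
      ENNReal.ofReal (meanBuf lam μV) * ENNReal.ofReal (lst μH lam) := by
    rw [meanBuf, ← lintegral_bufAge hgood hV hVpos, ← measure_numPre_eq_zero hgood hH,
      ← lintegral_indicator_one hset, ← lintegral_comp_afterVac hgood hind]
    exact lintegral_mul_eq_lintegral_mul_lintegral_of_indepFun (by fun_prop)
      (hind.comp measurable_afterVac)
      ((indepFun_afterVac hgood).1.comp (φ := fun z : ℝ × ℝ => ENNReal.ofReal z.2)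
          (by fun_prop) hind)
  rw [meanSys, ENNReal.ofReal_add (mul_nonneg h1 hη.le) h2, ENNReal.ofReal_mul h1, ← hmul,
    ← lintegral_lastSvc hgood hH,
    ← lintegral_comp_afterVac hgood (f := fun ω => ENNReal.ofReal (lastSvc ω)) (by fun_prop),
    ← lintegral_add_right _ (by fun_prop)]
  refine lintegral_congr_ae ?_
  filter_upwards [ae_good_pair hgood] with ω hω
  have hb := hω.1.bufAge_nonneg
  have hs := hω.2.lastSvc_nonneg
  by_cases h : numPre (afterVac ω) = 0
  · have h' : afterVac ω ∈ {ω : Stream | numPre ω = 0} := h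
    rw [sysTime, if_pos h, indicator_of_mem h', ENNReal.ofReal_add hb hs, Pi.one_apply, mul_one]
  · have h' : afterVac ω ∉ {ω : Stream | numPre ω = 0} := h
    rw [sysTime, if_neg h, indicator_of_notMem h', mul_zero, zero_add, zero_add]

/-! ### The closed forms -/

lemma paoiValue_eq (hH : ∀ᵐ x ∂μH, 0 ≤ x) (hV : ∀ᵐ x ∂μV, 0 ≤ x) (hVpos : 0 < μV (Ioi 0))
    (hV1 : Integrable (fun x => x) μV) :
    paoiValue lam μH μV = meanVac lam μV + meanSvc lam μH + meanSys lam μH μV := by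
  have hl := hlam.out
  have hη := (lst_pos μH hH hl.le).ne'
  have hq := (sub_pos.2 (lst_lt_one μV hV hVpos hl)).ne'
  rw [paoiValue, lstDeriv_one_of_pos μH hH hl, lstDeriv_one_of_pos μV hV hl,
    lstDeriv_one_of_integrable μV hV hV1 le_rfl, meanSys, meanVac, meanSvc, meanBuf]
  simp only [zero_mul, neg_zero, Real.exp_zero, mul_one]
  -- Once derivatives are replaced by moments, a rational identity remains in the transforms and
  -- moments.
  have hl' := hl.ne'
  generalize ∫ x, x * Real.exp (-(lam * x)) ∂μH = A
  generalize ∫ x, x * Real.exp (-(lam * x)) ∂μV = B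
  generalize ∫ x, x ∂μV = D
  generalize lst μH lam = E at *
  generalize lst μV lam = F at *
  field_simp
  ring

/-- In the closed form, the prefactor is 1/(2 E[Y]), the brace is E[Y²], and the terms outside it
sum to E[D]. -/
lemma aoiValue_eq (hH : ∀ᵐ x ∂μH, 0 ≤ x) (hV : ∀ᵐ x ∂μV, 0 ≤ x) (hVpos : 0 < μV (Ioi 0))
    (hV1 : Integrable (fun x => x) μV) (hV2 : Integrable (fun x => x ^ 2) μV) :
    aoiValue lam μH μV = (meanSys lam μH μV * (meanVac lam μV + meanSvc lam μH) +
      (meanVacSq lam μV + 2 * meanVac lam μV * meanSvc lam μH + meanSvcSq lam μH) / 2) /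
        (meanVac lam μV + meanSvc lam μH) := by
  have hl := hlam.out
  have hη := (lst_pos μH hH hl.le).ne'
  have hq := (sub_pos.2 (lst_lt_one μV hV hVpos hl)).ne'
  have hl' := hl.ne'
  have hm : meanVac lam μV + meanSvc lam μH ≠ 0 :=
    (add_pos_of_pos_of_nonneg (meanVac_pos (lam := lam) hV hVpos hV1) (meanSvc_nonneg hH)).ne'
  have e1 : -(-(∫ x, x ∂μV) / (1 - lst μV lam)) + (1 - lst μH lam) / (lam * lst μH lam) =
      meanVac lam μV + meanSvc lam μH := by
    rw [meanVac, meanSvc]; field_simp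
  rw [aoiValue, lstDeriv_one_of_pos μH hH hl, lstDeriv_one_of_pos μV hV hl,
    lstDeriv_one_of_integrable μV hV hV1 le_rfl, lstDeriv_two_zero μV hV hV1 hV2]
  simp only [zero_mul, neg_zero, Real.exp_zero, mul_one]
  rw [e1]
  generalize hm' : meanVac lam μV + meanSvc lam μH = m at *
  have e4 : (meanVacSq lam μV + 2 * meanVac lam μV * meanSvc lam μH + meanSvcSq lam μH) =
      (∫ x, x ^ 2 ∂μV) / (1 - lst μV lam) + 2 * (-(∫ x, x ∂μV) *
      -(∫ x, x * Real.exp (-(lam * x)) ∂μV) / (1 - lst μV lam) ^ 2) -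
      2 * (-(∫ x, x ∂μV) / (1 - lst μV lam)) * ((1 - lst μH lam) / (lam * lst μH lam)) +
      2 / (lam * lst μH lam ^ 2) *
        (1 / lam - lst μH lam / lam + -(∫ x, x * Real.exp (-(lam * x)) ∂μH)) := by
    clear hm' e1
    rw [meanVacSq, meanSvcSq, meanSvc, meanVac]
    generalize ∫ x, x * Real.exp (-(lam * x)) ∂μH = A
    generalize ∫ x, x * Real.exp (-(lam * x)) ∂μV = B
    generalize ∫ x, x ^ 2 ∂μV = C
    generalize ∫ x, x ∂μV = D
    generalize lst μH lam = E at *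
    generalize lst μV lam = F at *
    field_simp
    ring
  rw [e4, meanSys, meanBuf]
  clear hm' e1 e4
  generalize ∫ x, x * Real.exp (-(lam * x)) ∂μH = A
  generalize ∫ x, x * Real.exp (-(lam * x)) ∂μV = B
  generalize ∫ x, x ^ 2 ∂μV = C
  generalize ∫ x, x ∂μV = D
  generalize lst μH lam = E at *
  generalize lst μV lam = F at *
  field_simp
  ring

end CycleMoments

section RenewalAge

/-! ### The age process on a renewal sample path -/

/-- The `l`-th renewal epoch, for cycles of lengths `Y 0, Y 1, …`. -/
noncomputable def renewalTime (Y : ℕ → ℝ) (l : ℕ) : ℝ := ∑ i ∈ Finset.range l, Y i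

/-- The age at the `l`-th renewal epoch: `a` at the start, then the system time `D (l - 1)`. -/
def ageAt (a : ℝ) (D : ℕ → ℝ) : ℕ → ℝ
  | 0 => a
  | l + 1 => D l

@[simp] lemma ageAt_zero (a : ℝ) (D : ℕ → ℝ) : ageAt a D 0 = a := rfl

@[simp] lemma ageAt_succ (a : ℝ) (D : ℕ → ℝ) (l : ℕ) : ageAt a D (l + 1) = D l := rfl

/-- The age process of a renewal sample path. -/
noncomputable def renewalAge (a : ℝ) (Y D : ℕ → ℝ) (t : ℝ) : ℝ :=
  t - sSup {r : ℝ | ∃ l, renewalTime Y l ≤ t ∧ renewalTime Y l - ageAt a D l = r}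

/-- The area below the age process in the `l`-th cycle. -/
noncomputable def cycleArea (a : ℝ) (Y D : ℕ → ℝ) (l : ℕ) : ℝ :=
  ageAt a D l * Y l + Y l ^ 2 / 2

/-- Cycles have positive length, and the age at their end does not exceed this length. -/
def Regular (Y D : ℕ → ℝ) : Prop := ∀ l, 0 < Y l ∧ 0 ≤ D l ∧ D l ≤ Y l

variable {a : ℝ} {Y D : ℕ → ℝ}

@[simp] lemma renewalTime_zero (Y : ℕ → ℝ) : renewalTime Y 0 = 0 := by simp [renewalTime]

lemma renewalTime_succ (Y : ℕ → ℝ) (l : ℕ) : renewalTime Y (l + 1) = renewalTime Y l + Y l :=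
  Finset.sum_range_succ _ _

namespace Regular

lemma ageAt_nonneg (h : Regular Y D) (ha : 0 ≤ a) : ∀ l, 0 ≤ ageAt a D l
  | 0 => ha
  | l + 1 => (h l).2.1

lemma strictMono (h : Regular Y D) : StrictMono (renewalTime Y) :=
  strictMono_nat_of_lt_succ fun l => by
    rw [renewalTime_succ]; linarith [(h l).1]

lemma renewalTime_nonneg (h : Regular Y D) (l : ℕ) : 0 ≤ renewalTime Y l := by
  simpa using h.strictMono.monotone (Nat.zero_le l)

/-- Since D_l ≤ Y_l, a packet completing in cycle l was generated after that cycle began, hence no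
earlier than its predecessor. The latest completion therefore carries the freshest packet, and the
supremum in the age is attained there. -/
lemma monotone_gen (h : Regular Y D) (ha : 0 ≤ a) :
    Monotone fun l => renewalTime Y l - ageAt a D l :=
  monotone_nat_of_le_succ fun l => by
    have h1 := h.ageAt_nonneg ha l
    have h2 := (h l).2.2
    rw [renewalTime_succ]
    simp only [ageAt_succ]
    linarith

lemma renewalAge_eq (h : Regular Y D) (ha : 0 ≤ a) {l : ℕ} {t : ℝ} (h1 : renewalTime Y l ≤ t)
    (h2 : t < renewalTime Y (l + 1)) :
    renewalAge a Y D t = t - renewalTime Y l + ageAt a D l := by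
  have hg : IsGreatest {r : ℝ | ∃ l, renewalTime Y l ≤ t ∧ renewalTime Y l - ageAt a D l = r}
      (renewalTime Y l - ageAt a D l) := by
    refine ⟨⟨l, h1, rfl⟩, ?_⟩
    rintro r ⟨j, hj, rfl⟩
    exact h.monotone_gen ha (Nat.lt_succ_iff.1 (h.strictMono.lt_iff_lt.1 (hj.trans_lt h2)))
  rw [renewalAge, hg.csSup_eq]
  ring

lemma tendsto_renewalAge (h : Regular Y D) (ha : 0 ≤ a) (l : ℕ) :
    Tendsto (renewalAge a Y D) (𝓝[<] renewalTime Y (l + 1)) (𝓝 (Y l + ageAt a D l)) := by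
  have hlt : renewalTime Y l < renewalTime Y (l + 1) := h.strictMono (Nat.lt_succ_self l)
  have h1 : Tendsto (fun t => t - renewalTime Y l + ageAt a D l) (𝓝[<] renewalTime Y (l + 1))
      (𝓝 (renewalTime Y (l + 1) - renewalTime Y l + ageAt a D l)) :=
    (Continuous.tendsto (by fun_prop) _).mono_left nhdsWithin_le_nhds
  rw [renewalTime_succ, add_sub_cancel_left] at h1
  rw [renewalTime_succ]
  refine h1.congr' ?_
  rw [← renewalTime_succ]
  filter_upwards [Ioo_mem_nhdsLT hlt] with t ht
  exact (h.renewalAge_eq ha ht.1.le ht.2).symm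

/-- Almost everywhere only: at the right endpoint the age has already dropped. -/
lemma ae_eq_renewalAge (h : Regular Y D) (ha : 0 ≤ a) (l : ℕ) :
    ∀ᵐ t, t ∈ uIoc (renewalTime Y l) (renewalTime Y (l + 1)) →
      t - renewalTime Y l + ageAt a D l = renewalAge a Y D t := by
  have hlt : renewalTime Y l < renewalTime Y (l + 1) := h.strictMono (Nat.lt_succ_self l)
  have : ∀ᵐ t : ℝ, t ≠ renewalTime Y (l + 1) := by
    simp [ae_iff]
  filter_upwards [this] with t ht ht'
  rw [uIoc_of_le hlt.le] at ht'
  exact (h.renewalAge_eq ha ht'.1.le (lt_of_le_of_ne ht'.2 ht)).symm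

lemma intervalIntegrable_cycle (h : Regular Y D) (ha : 0 ≤ a) (l : ℕ) :
    IntervalIntegrable (renewalAge a Y D) volume (renewalTime Y l) (renewalTime Y (l + 1)) := by
  refine (Continuous.intervalIntegrable (by fun_prop) _ _ :
    IntervalIntegrable (fun t => t - renewalTime Y l + ageAt a D l) volume _ _).congr_ae ?_
  rw [EventuallyEq, ae_restrict_iff' measurableSet_uIoc]
  exact h.ae_eq_renewalAge ha l

lemma integral_cycle (h : Regular Y D) (ha : 0 ≤ a) (l : ℕ) :
    ∫ t in renewalTime Y l..renewalTime Y (l + 1), renewalAge a Y D t = cycleArea a Y D l := by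
  have h1 : ∫ t in renewalTime Y l..renewalTime Y (l + 1), renewalAge a Y D t =
      ∫ t in renewalTime Y l..renewalTime Y (l + 1), (t + (ageAt a D l - renewalTime Y l)) := by
    refine intervalIntegral.integral_congr_ae ?_
    filter_upwards [h.ae_eq_renewalAge ha l] with t ht ht'
    rw [← ht ht']
    ring
  rw [h1, intervalIntegral.integral_add (by simp) (by simp), integral_id,
    intervalIntegral.integral_const, cycleArea, renewalTime_succ, smul_eq_mul]
  ring

lemma intervalIntegrable_renewalTime (h : Regular Y D) (ha : 0 ≤ a) (n : ℕ) :
    IntervalIntegrable (renewalAge a Y D) volume 0 (renewalTime Y n) := by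
  rw [← renewalTime_zero Y]
  exact IntervalIntegrable.trans_iterate fun l _ => h.intervalIntegrable_cycle ha l

lemma integral_renewalTime (h : Regular Y D) (ha : 0 ≤ a) (n : ℕ) :
    ∫ t in (0 : ℝ)..renewalTime Y n, renewalAge a Y D t =
      ∑ l ∈ Finset.range n, cycleArea a Y D l := by
  have h1 := intervalIntegral.sum_integral_adjacent_intervals (μ := volume) (n := n)
    (f := renewalAge a Y D) (a := renewalTime Y) fun l _ => h.intervalIntegrable_cycle ha l
  rw [renewalTime_zero] at h1
  rw [← h1]
  exact Finset.sum_congr rfl fun l _ => h.integral_cycle ha l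

/-- The number of completed cycles. -/
lemma exists_count (h : Regular Y D) (hC : Tendsto (renewalTime Y) atTop atTop) :
    ∃ N : ℝ → ℕ, (∀ t, 0 ≤ t → renewalTime Y (N t) ≤ t ∧ t < renewalTime Y (N t + 1)) ∧
      Tendsto N atTop atTop := by
  have hex : ∀ t, ∃ n, t < renewalTime Y (n + 1) := fun t =>
    (((tendsto_add_atTop_iff_nat 1).2 hC).eventually_gt_atTop t).exists
  classical
  have hN : ∀ t, 0 ≤ t → renewalTime Y (Nat.find (hex t)) ≤ t ∧
      t < renewalTime Y (Nat.find (hex t) + 1) := fun t ht => by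
    refine ⟨?_, Nat.find_spec (hex t)⟩
    rcases hn : Nat.find (hex t) with _ | n
    · simpa using ht
    · exact not_lt.1 (Nat.find_min (hex t) (m := n) (by omega))
  refine ⟨fun t => Nat.find (hex t), hN, tendsto_atTop.2 fun k => ?_⟩
  filter_upwards [eventually_ge_atTop (renewalTime Y k)] with t ht
  exact Nat.lt_succ_iff.1 (h.strictMono.lt_iff_lt.1 (ht.trans_lt
    (hN t ((h.renewalTime_nonneg k).trans ht)).2))

lemma renewalAge_mem (h : Regular Y D) (ha : 0 ≤ a) (hC : Tendsto (renewalTime Y) atTop atTop)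
    {t : ℝ} (ht : 0 ≤ t) : 0 ≤ renewalAge a Y D t ∧ renewalAge a Y D t ≤ t + a := by
  obtain ⟨N, hN, -⟩ := h.exists_count hC
  obtain ⟨h1, h2⟩ := hN t ht
  have h3 := h.monotone_gen ha (Nat.zero_le (N t))
  have h4 := h.ageAt_nonneg ha (N t)
  simp only [renewalTime_zero, ageAt_zero] at h3
  rw [h.renewalAge_eq ha h1 h2]
  constructor <;> linarith

lemma intervalIntegrable (h : Regular Y D) (ha : 0 ≤ a)
    (hC : Tendsto (renewalTime Y) atTop atTop) {t : ℝ} (ht : 0 ≤ t) :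
    IntervalIntegrable (renewalAge a Y D) volume 0 t := by
  obtain ⟨n, hn⟩ := (hC.eventually_ge_atTop t).exists
  refine (h.intervalIntegrable_renewalTime ha n).mono_set ?_
  rw [uIcc_of_le ht, uIcc_of_le (ht.trans hn)]
  exact Icc_subset_Icc_right hn

/-- The renewal-reward theorem on a sample path. -/
lemma tendsto_average (h : Regular Y D) (ha : 0 ≤ a) {m g : ℝ} (hm : 0 < m)
    (hY : Tendsto (fun n : ℕ => renewalTime Y n / n) atTop (𝓝 m))
    (hG : Tendsto (fun n : ℕ => (∑ l ∈ Finset.range n, cycleArea a Y D l) / n) atTop (𝓝 g)) :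
    Tendsto (fun T : ℝ => (1 / T) * ∫ t in (0 : ℝ)..T, renewalAge a Y D t) atTop
      (𝓝 (g / m)) := by
  have hC : Tendsto (renewalTime Y) atTop atTop := by
    refine (hY.pos_mul_atTop hm tendsto_natCast_atTop_atTop).congr' ?_
    filter_upwards [eventually_gt_atTop 0] with n hn
    have : (n : ℝ) ≠ 0 := by positivity
    field_simp
  obtain ⟨N, hN, hNtop⟩ := h.exists_count hC
  set S : ℕ → ℝ := fun n => ∑ l ∈ Finset.range n, cycleArea a Y D l with hS
  have hone : Tendsto (fun n : ℕ => ((n + 1 : ℕ) : ℝ) / n) atTop (𝓝 1) := by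
    have := tendsto_natCast_div_add_atTop (1 : ℝ)
    have h2 := this.inv₀ one_ne_zero
    rw [inv_one] at h2
    refine h2.congr fun n => ?_
    rw [inv_div]; push_cast; rfl
  -- As the age is nonnegative, the average at time T lies between S(N)/C(N+1) and S(N+1)/C(N),
  -- where N counts the completed cycles; both bounds tend to g/m.
  have hlow : Tendsto (fun n => S n / renewalTime Y (n + 1)) atTop (𝓝 (g / m)) := by
    have h1 := hG.div (((tendsto_add_atTop_iff_nat 1).2 hY).mul hone) (by simpa using hm.ne')
    rw [mul_one] at h1
    refine h1.congr' ?_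
    filter_upwards [eventually_gt_atTop 0] with n hn
    have h2 : (n : ℝ) ≠ 0 := by positivity
    have h3 : ((n + 1 : ℕ) : ℝ) ≠ 0 := by positivity
    simp only [Pi.div_apply, hS]
    field_simp
  have hup : Tendsto (fun n => S (n + 1) / renewalTime Y n) atTop (𝓝 (g / m)) := by
    have h1 := (((tendsto_add_atTop_iff_nat 1).2 hG).mul hone).div hY hm.ne'
    rw [mul_one] at h1
    refine h1.congr' ?_
    filter_upwards [eventually_gt_atTop 0] with n hn
    have h2 : (n : ℝ) ≠ 0 := by positivity
    have h3 : ((n + 1 : ℕ) : ℝ) ≠ 0 := by positivity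
    simp only [Pi.div_apply, hS]
    field_simp
  have hmono : ∀ s t, 0 ≤ s → s ≤ t → ∫ u in (0 : ℝ)..s, renewalAge a Y D u ≤
      ∫ u in (0 : ℝ)..t, renewalAge a Y D u := by
    intro s t hs hst
    refine intervalIntegral.integral_mono_interval le_rfl hs hst ?_
      (h.intervalIntegrable ha hC (hs.trans hst))
    rw [EventuallyLE, ae_restrict_iff' measurableSet_Ioc]
    exact Eventually.of_forall fun u hu => (h.renewalAge_mem ha hC hu.1.le).1
  have hG0 : ∀ n, 0 ≤ S n := fun n => Finset.sum_nonneg fun l _ => by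
    have := h.ageAt_nonneg ha l
    have := (h l).1.le
    rw [cycleArea]; positivity
  refine tendsto_of_tendsto_of_tendsto_of_le_of_le' (hlow.comp hNtop) (hup.comp hNtop) ?_ ?_
  · filter_upwards [eventually_gt_atTop 0] with T hT
    obtain ⟨h1, h2⟩ := hN T hT.le
    have h3 := hmono _ _ (h.renewalTime_nonneg (N T)) h1
    rw [h.integral_renewalTime ha] at h3
    rw [one_div, inv_mul_eq_div]
    exact div_le_div₀ ((hG0 _).trans h3) h3 hT h2.le
  · filter_upwards [eventually_gt_atTop 0, hNtop.eventually_gt_atTop 0] with T hT hn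
    obtain ⟨h1, h2⟩ := hN T hT.le
    have h3 := hmono _ _ hT.le h2.le
    rw [h.integral_renewalTime ha] at h3
    rw [one_div, inv_mul_eq_div]
    have h4 : 0 < renewalTime Y (N T) := by simpa using h.strictMono hn
    exact div_le_div₀ (hG0 _) h3 h4 h1

end Regular

end RenewalAge

section RenewalCycles

/-! ### Independent and identically distributed cycles -/

/-- Cycles of lengths `Y l`, which are completed with age `D l`, are independent and identically
distributed, with finite mean. -/
structure RenewalCycles {Ω : Type*} [MeasurableSpace Ω] (P : Measure Ω) (Y D : ℕ → Ω → ℝ) :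
    Prop where
  measurable_length : ∀ l, Measurable (Y l)
  measurable_age : ∀ l, Measurable (D l)
  indep : iIndepFun (fun l ω => (Y l ω, D l ω)) P
  ident : ∀ l, IdentDistrib (fun ω => (Y l ω, D l ω)) (fun ω => (Y 0 ω, D 0 ω)) P P
  regular : ∀ᵐ ω ∂P, Regular (Y · ω) (D · ω)
  integrable_length : Integrable (Y 0) P
  integrable_age : Integrable (D 0) P

lemma tendsto_of_even_odd {α : Type*} {u : ℕ → α} {l : Filter α}
    (he : Tendsto (fun n => u (2 * n)) atTop l) (ho : Tendsto (fun n => u (2 * n + 1)) atTop l) :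
    Tendsto u atTop l := by
  intro s hs
  obtain ⟨n₁, h₁⟩ := eventually_atTop.1 (he hs)
  obtain ⟨n₂, h₂⟩ := eventually_atTop.1 (ho hs)
  refine eventually_atTop.2 ⟨2 * (n₁ + n₂) + 1, fun n hn => ?_⟩
  obtain ⟨k, rfl | rfl⟩ := Nat.even_or_odd' n
  · exact h₁ k (by omega)
  · exact h₂ k (by omega)

lemma tendsto_div_succ {u : ℕ → ℝ} {c : ℝ} (b : ℝ) (h : Tendsto (fun n : ℕ => u n / n) atTop
    (𝓝 c)) :
    Tendsto (fun n : ℕ => (b + u n) / ((n + 1 : ℕ) : ℝ)) atTop (𝓝 c) := by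
  have h1 := tendsto_natCast_div_add_atTop (1 : ℝ)
  have h2 : Tendsto (fun n : ℕ => b / ((n + 1 : ℕ) : ℝ)) atTop (𝓝 0) :=
    (tendsto_add_atTop_iff_nat 1).2 (tendsto_const_div_atTop_nhds_zero_nat b)
  have h3 := h2.add (h.mul h1)
  rw [zero_add, mul_one] at h3
  refine h3.congr' ?_
  filter_upwards [eventually_gt_atTop 0] with n hn
  have h4 : (n : ℝ) ≠ 0 := by positivity
  have h5 : (n : ℝ) + 1 ≠ 0 := by positivity
  push_cast
  field_simp

/-- Alternating the terms of two sequences with the same mean. -/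
lemma tendsto_average_of_even_odd {w : ℕ → ℝ} {c : ℝ}
    (he : Tendsto (fun n : ℕ => (∑ k ∈ Finset.range n, w (2 * k)) / n) atTop (𝓝 c))
    (ho : Tendsto (fun n : ℕ => (∑ k ∈ Finset.range n, w (2 * k + 1)) / n) atTop (𝓝 c)) :
    Tendsto (fun n : ℕ => (∑ k ∈ Finset.range n, w k) / n) atTop (𝓝 c) := by
  have hsum : ∀ n, ∑ k ∈ Finset.range (2 * n), w k =
      ∑ k ∈ Finset.range n, w (2 * k) + ∑ k ∈ Finset.range n, w (2 * k + 1) := by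
    intro n
    induction n with
    | zero => simp
    | succ n ih =>
      rw [Nat.mul_succ, Finset.sum_range_succ, Finset.sum_range_succ, ih, Finset.sum_range_succ,
        Finset.sum_range_succ]
      ring
  have h2 : Tendsto (fun n : ℕ => (∑ k ∈ Finset.range (2 * n), w k) / ((2 * n : ℕ) : ℝ)) atTop
      (𝓝 c) := by
    have h := (he.add ho).div_const 2
    rw [add_self_div_two] at h
    refine h.congr fun n => ?_
    rw [hsum]; push_cast; field_simp
  refine tendsto_of_even_odd h2 ?_
  have h3 : Tendsto (fun n : ℕ => ((n + 1 : ℕ) : ℝ) / ((2 * n + 1 : ℕ) : ℝ)) atTop (𝓝 (1 / 2)) := by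
    have h := ((tendsto_one_div_add_atTop_nhds_zero_nat (𝕜 := ℝ)).const_sub 2).inv₀ (by norm_num)
    rw [sub_zero, ← one_div] at h
    refine h.congr fun n => ?_
    have h6 : (n : ℝ) + 1 ≠ 0 := by positivity
    rw [show (2 : ℝ) - 1 / (n + 1) = (2 * n + 1) / (n + 1) by field_simp; ring, inv_div]
    push_cast
    rfl
  have h4 := ((((tendsto_add_atTop_iff_nat 1).2 he).add (tendsto_div_succ 0 ho)).mul h3)
  have h5 : (c + c) * (1 / 2) = c := by ring
  rw [h5] at h4
  refine h4.congr fun n => ?_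
  rw [Finset.sum_range_succ, Finset.sum_range_succ (fun k => w k) (2 * n), hsum]
  have h6 : ((n + 1 : ℕ) : ℝ) ≠ 0 := by positivity
  have h7 : ((2 * n + 1 : ℕ) : ℝ) ≠ 0 := by positivity
  field_simp
  ring

namespace RenewalCycles

variable {Ω : Type*} [MeasurableSpace Ω] {P : Measure Ω} {Y D : ℕ → Ω → ℝ}

lemma ident_length (h : RenewalCycles P Y D) (l : ℕ) : IdentDistrib (Y l) (Y 0) P P :=
  (h.ident l).comp measurable_fst

lemma ident_age (h : RenewalCycles P Y D) (l : ℕ) : IdentDistrib (D l) (D 0) P P :=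
  (h.ident l).comp measurable_snd

lemma measurable_pair (h : RenewalCycles P Y D) (l : ℕ) : Measurable fun ω => (Y l ω, D l ω) :=
  (h.measurable_length l).prodMk (h.measurable_age l)

lemma tendsto_average_comp (h : RenewalCycles P Y D) {f : ℝ × ℝ → ℝ} (hf : Measurable f)
    (hint : Integrable (fun ω => f (Y 0 ω, D 0 ω)) P) :
    ∀ᵐ ω ∂P, Tendsto (fun n : ℕ => (∑ l ∈ Finset.range n, f (Y l ω, D l ω)) / n) atTop
      (𝓝 (∫ ω, f (Y 0 ω, D 0 ω) ∂P)) :=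
  strong_law_ae_real (fun l ω => f (Y l ω, D l ω)) hint
    (fun _ _ hij => (h.indep.indepFun hij).comp hf hf) fun l => (h.ident l).comp hf

lemma indepFun_age_length (h : RenewalCycles P Y D) {i j : ℕ} (hij : i ≠ j) :
    IndepFun (D i) (Y j) P :=
  (h.indep.indepFun hij).comp measurable_snd measurable_fst

lemma integral_age_mul_length (h : RenewalCycles P Y D) {i j : ℕ} (hij : i ≠ j) :
    Integrable (fun ω => D i ω * Y j ω) P ∧
      ∫ ω, D i ω * Y j ω ∂P = (∫ ω, D 0 ω ∂P) * ∫ ω, Y 0 ω ∂P := by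
  have h1 := (h.ident_age i).integrable_iff.2 h.integrable_age
  have h2 := (h.ident_length j).integrable_iff.2 h.integrable_length
  refine ⟨(h.indepFun_age_length hij).integrable_mul h1 h2, ?_⟩
  rw [(h.indepFun_age_length hij).integral_fun_mul_eq_mul_integral h1.aestronglyMeasurable
    h2.aestronglyMeasurable, (h.ident_age i).integral_eq, (h.ident_length j).integral_eq]

/-- Consecutive products D_k Y_{k+1} share a cycle and need not be independent. With stride two they
involve disjoint pairs of cycles, and the strong law applies. -/
lemma tendsto_average_mul_of_stride [IsProbabilityMeasure P] (h : RenewalCycles P Y D) (b : ℕ) :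
    ∀ᵐ ω ∂P, Tendsto (fun n : ℕ => (∑ k ∈ Finset.range n,
      D (2 * k + b) ω * Y (2 * k + b + 1) ω) / n) atTop
      (𝓝 ((∫ ω, D 0 ω ∂P) * ∫ ω, Y 0 ω ∂P)) := by
  obtain ⟨hint, hval⟩ := h.integral_age_mul_length (i := 2 * 0 + b) (j := 2 * 0 + b + 1) (by omega)
  rw [← hval]
  have hf : Measurable fun z : (ℝ × ℝ) × (ℝ × ℝ) => z.1.2 * z.2.1 := by fun_prop
  refine strong_law_ae_real (fun k ω => D (2 * k + b) ω * Y (2 * k + b + 1) ω) hint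
    (fun i j hij => ?_) fun k => ?_
  · exact (h.indep.indepFun_prodMk_prodMk h.measurable_pair (2 * i + b) (2 * i + b + 1)
      (2 * j + b) (2 * j + b + 1) (by omega) (by omega) (by omega) (by omega)).comp hf hf
  · exact (((h.ident (2 * k + b)).trans (h.ident (2 * 0 + b)).symm).prodMk
      ((h.ident (2 * k + b + 1)).trans (h.ident (2 * 0 + b + 1)).symm)
      (h.indep.indepFun (by omega)) (h.indep.indepFun (by omega))).comp hf

lemma tendsto_average_mul [IsProbabilityMeasure P] (h : RenewalCycles P Y D) :
    ∀ᵐ ω ∂P, Tendsto (fun n : ℕ => (∑ k ∈ Finset.range n, D k ω * Y (k + 1) ω) / n) atTop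
      (𝓝 ((∫ ω, D 0 ω ∂P) * ∫ ω, Y 0 ω ∂P)) := by
  filter_upwards [h.tendsto_average_mul_of_stride 0, h.tendsto_average_mul_of_stride 1] with ω h0 h1
  exact tendsto_average_of_even_odd h0 h1

lemma integral_length_pos [IsProbabilityMeasure P] (h : RenewalCycles P Y D) : 0 < ∫ ω,
    Y 0 ω ∂P := by
  have hpos : ∀ᵐ ω ∂P, 0 < Y 0 ω := h.regular.mono fun ω hω => (hω 0).1
  rw [integral_pos_iff_support_of_nonneg_ae (hpos.mono fun ω hω => hω.le) h.integrable_length]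
  have : Function.support (Y 0) =ᵐ[P] univ := by
    filter_upwards [hpos] with ω hω
    exact eq_true hω.ne'
  rw [measure_congr this, measure_univ]
  exact one_pos

lemma tendsto_renewalTime_div (h : RenewalCycles P Y D) :
    ∀ᵐ ω ∂P, Tendsto (fun n : ℕ => renewalTime (Y · ω) n / n) atTop (𝓝 (∫ ω, Y 0 ω ∂P)) := by
  have h1 := h.tendsto_average_comp (f := fun z => z.1) measurable_fst h.integrable_length
  simpa only [renewalTime] using h1

lemma tendsto_renewalTime [IsProbabilityMeasure P] (h : RenewalCycles P Y D) :
    ∀ᵐ ω ∂P, Tendsto (renewalTime (Y · ω)) atTop atTop := by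
  filter_upwards [h.tendsto_renewalTime_div] with ω hω
  refine (hω.pos_mul_atTop h.integral_length_pos tendsto_natCast_atTop_atTop).congr' ?_
  filter_upwards [eventually_gt_atTop 0] with n hn
  have : (n : ℝ) ≠ 0 := by positivity
  field_simp

lemma tendsto_average_ageAt (h : RenewalCycles P Y D) (a : ℝ) :
    ∀ᵐ ω ∂P, Tendsto (fun n : ℕ => (∑ l ∈ Finset.range n, ageAt a (D · ω) l) / n) atTop
      (𝓝 (∫ ω, D 0 ω ∂P)) := by
  filter_upwards [h.tendsto_average_comp measurable_snd h.integrable_age] with ω hω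
  refine (tendsto_add_atTop_iff_nat 1).1 ((tendsto_div_succ a hω).congr fun n => ?_)
  rw [Finset.sum_range_succ', add_comm a]
  rfl

lemma tendsto_average_peak [IsProbabilityMeasure P] (h : RenewalCycles P Y D) (a : ℝ) :
    ∀ᵐ ω ∂P, Tendsto (fun n : ℕ => (1 / (n : ℝ)) *
      ∑ l ∈ Finset.range n, (Y l ω + ageAt a (D · ω) l)) atTop
      (𝓝 (∫ ω, Y 0 ω ∂P + ∫ ω, D 0 ω ∂P)) := by
  filter_upwards [h.tendsto_average_ageAt a, h.tendsto_renewalTime_div] with ω h1 h2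
  refine (h2.add h1).congr fun n => ?_
  rw [Finset.sum_add_distrib, renewalTime]
  ring

lemma integral_peak [IsProbabilityMeasure P] (h : RenewalCycles P Y D) (a : ℝ) (l : ℕ) :
    Integrable (fun ω => Y l ω + ageAt a (D · ω) l) P ∧
      ∫ ω, (Y (l + 1) ω + ageAt a (D · ω) (l + 1)) ∂P = ∫ ω, Y 0 ω ∂P + ∫ ω, D 0 ω ∂P := by
  have hY := fun l => (h.ident_length l).integrable_iff.2 h.integrable_length
  have hD := fun l => (h.ident_age l).integrable_iff.2 h.integrable_age
  constructor
  · rcases l with _ | l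
    · exact (hY 0).add (integrable_const a)
    · exact (hY _).add (hD l)
  · simp only [ageAt_succ]
    rw [integral_add (hY _) (hD l), (h.ident_length _).integral_eq, (h.ident_age l).integral_eq]

/-- The mean area below the age process in a cycle that is not the first one. -/
lemma tendsto_average_cycleArea [IsProbabilityMeasure P] (h : RenewalCycles P Y D) (a : ℝ)
    (hsq : Integrable (fun ω => Y 0 ω ^ 2) P) :
    ∀ᵐ ω ∂P, Tendsto (fun n : ℕ => (∑ l ∈ Finset.range n, cycleArea a (Y · ω) (D · ω) l) / n) atTop
      (𝓝 ((∫ ω, D 0 ω ∂P) * (∫ ω, Y 0 ω ∂P) + (∫ ω, Y 0 ω ^ 2 ∂P) / 2)) := by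
  filter_upwards [h.tendsto_average_mul,
    h.tendsto_average_comp (f := fun z => z.1 ^ 2) (by fun_prop) hsq] with ω h1 h2
  have h3 : Tendsto (fun n : ℕ => (∑ l ∈ Finset.range n, ageAt a (D · ω) l * Y l ω) / n) atTop
      (𝓝 ((∫ ω, D 0 ω ∂P) * (∫ ω, Y 0 ω ∂P))) := by
    refine (tendsto_add_atTop_iff_nat 1).1 ((tendsto_div_succ (a * Y 0 ω) h1).congr fun n => ?_)
    rw [Finset.sum_range_succ', add_comm (a * Y 0 ω)]
    rfl
  refine (h3.add (h2.div_const 2)).congr fun n => ?_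
  simp only [cycleArea]
  rw [Finset.sum_add_distrib, ← Finset.sum_div]
  ring

lemma tendsto_average_renewalAge [IsProbabilityMeasure P] (h : RenewalCycles P Y D) {a : ℝ}
    (ha : 0 ≤ a)
    (hsq : Integrable (fun ω => Y 0 ω ^ 2) P) :
    ∀ᵐ ω ∂P, Tendsto (fun T : ℝ => (1 / T) * ∫ t in (0 : ℝ)..T, renewalAge a (Y · ω) (D · ω) t)
      atTop (𝓝 (((∫ ω, D 0 ω ∂P) * (∫ ω, Y 0 ω ∂P) + (∫ ω, Y 0 ω ^ 2 ∂P) / 2) /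
        ∫ ω, Y 0 ω ∂P)) := by
  filter_upwards [h.regular, h.tendsto_renewalTime_div, h.tendsto_average_cycleArea a hsq]
    with ω h1 h2 h3
  exact h1.tendsto_average ha h.integral_length_pos h2 h3

end RenewalCycles

end RenewalCycles

section LimitingMean

/-! ### The limiting mean of the age -/

/-- Cesàro means of a locally bounded function. -/
lemma tendsto_average_of_tendsto {m : ℝ → ℝ} {d a : ℝ} (hm : ∀ t, 0 ≤ t → |m t| ≤ t + a)
    (hmeas : Measurable m)
    (hd : Tendsto m atTop (𝓝 d)) :
    Tendsto (fun n : ℕ => (1 / (n : ℝ)) * ∫ t in (0 : ℝ)..n, m t) atTop (𝓝 d) := by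
  obtain ⟨t₀, ht₀⟩ := eventually_atTop.1
    ((hd.abs.eventually (gt_mem_nhds (lt_add_one |d|))).and (eventually_ge_atTop 0))
  have ht₀0 := (ht₀ t₀ le_rfl).2
  have ha : 0 ≤ a := by have := (abs_nonneg _).trans (hm 0 le_rfl); linarith
  -- Up to `t₀` the linear bound applies, and beyond it the function is within 1 of its limit in
  -- absolute value. After rescaling to [0, 1] this constant is the dominating function.
  have hB : ∀ t, 0 ≤ t → ‖m t‖ ≤ (t₀ + a) + (|d| + 1) := by
    intro t ht
    rw [Real.norm_eq_abs]
    rcases le_total t t₀ with h | h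
    · have := hm t ht
      have := abs_nonneg d
      linarith
    · have := (ht₀ t h).1
      linarith
  have h1 : Tendsto (fun n : ℕ => ∫ s in (0 : ℝ)..1, m (s * n)) atTop (𝓝 (∫ s in (0 : ℝ)..1,
      d)) := by
    refine intervalIntegral.tendsto_integral_filter_of_dominated_convergence
      (fun _ => (t₀ + a) + (|d| + 1)) ?_ ?_ (by simp) ?_
    · exact Eventually.of_forall fun n => (by fun_prop : Measurable _).aestronglyMeasurable
    · refine Eventually.of_forall fun n => Eventually.of_forall fun s hs => ?_
      rw [uIoc_of_le zero_le_one] at hs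
      exact hB _ (mul_nonneg hs.1.le n.cast_nonneg)
    · refine Eventually.of_forall fun s hs => ?_
      rw [uIoc_of_le zero_le_one] at hs
      exact hd.comp (tendsto_natCast_atTop_atTop.const_mul_atTop hs.1)
  rw [intervalIntegral.integral_const, sub_zero, one_smul] at h1
  refine h1.congr' ?_
  filter_upwards [eventually_gt_atTop 0] with n hn
  have hn' : (n : ℝ) ≠ 0 := by positivity
  rw [intervalIntegral.integral_comp_mul_right _ hn', zero_mul, one_mul, smul_eq_mul, one_div]

/-- The age process as a jointly measurable function. -/
noncomputable def cycleSum (a : ℝ) (Y D : ℕ → ℝ) (t : ℝ) : ℝ≥0∞ :=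
  ∑' l, (Ico (renewalTime Y l) (renewalTime Y (l + 1))).indicator
    (fun t => ENNReal.ofReal (t - renewalTime Y l + ageAt a D l)) t

lemma Regular.cycleSum_eq {a : ℝ} {Y D : ℕ → ℝ} (h : Regular Y D) (ha : 0 ≤ a)
    (hC : Tendsto (renewalTime Y) atTop atTop) {t : ℝ} (ht : 0 ≤ t) :
    cycleSum a Y D t = ENNReal.ofReal (renewalAge a Y D t) := by
  obtain ⟨N, hN, -⟩ := h.exists_count hC
  obtain ⟨h1, h2⟩ := hN t ht
  rw [cycleSum, tsum_eq_single (N t), indicator_of_mem (mem_Ico.2 ⟨h1, h2⟩),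
    h.renewalAge_eq ha h1 h2]
  intro l hl
  refine indicator_of_notMem (fun hlt : t ∈ Ico _ _ => hl ?_) _
  have h3 := h.strictMono.lt_iff_lt.1 (hlt.1.trans_lt h2)
  have h4 := h.strictMono.lt_iff_lt.1 (h1.trans_lt hlt.2)
  omega

/-- A cycle begun by time `T` is counted with its full area, even past `T`. The remaining indicator
depends only on earlier cycles, which makes expectations factor. -/
lemma Regular.lintegral_cycle_le {a : ℝ} {Y D : ℕ → ℝ} (h : Regular Y D) (ha : 0 ≤ a) (T : ℝ)
    (l : ℕ) :
    ∫⁻ t in Ioc 0 T, (Ico (renewalTime Y l) (renewalTime Y (l + 1))).indicator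
      (fun t => ENNReal.ofReal (t - renewalTime Y l + ageAt a D l)) t ≤
        (Iic T).indicator 1 (renewalTime Y l) * ENNReal.ofReal (cycleArea a Y D l) := by
  have hlt : renewalTime Y l < renewalTime Y (l + 1) := h.strictMono (Nat.lt_succ_self l)
  by_cases hT : renewalTime Y l ≤ T
  · rw [indicator_of_mem (mem_Iic.2 hT), Pi.one_apply, one_mul]
    refine (lintegral_mono' Measure.restrict_le_self le_rfl).trans ?_
    rw [lintegral_indicator measurableSet_Ico, ← h.integral_cycle ha l,
      intervalIntegral.integral_of_le hlt.le, ofReal_integral_eq_lintegral_ofReal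
        (h.intervalIntegrable_cycle ha l).1, restrict_Ico_eq_restrict_Ioc]
    · refine le_of_eq (lintegral_congr_ae ?_)
      rw [EventuallyEq, ae_restrict_iff' measurableSet_Ioc]
      filter_upwards [h.ae_eq_renewalAge ha l] with t ht ht'
      rw [uIoc_of_le hlt.le] at ht
      rw [ht ht']
    · rw [EventuallyLE, ae_restrict_iff' measurableSet_Ioc]
      filter_upwards [h.ae_eq_renewalAge ha l] with t ht ht'
      rw [uIoc_of_le hlt.le] at ht
      rw [← ht ht']
      have := ht'.1
      have := h.ageAt_nonneg ha l
      simp only [Pi.zero_apply]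
      linarith
  · refine le_of_eq_of_le ((setLIntegral_congr_fun (g := fun _ => 0) measurableSet_Ioc
      fun t ht => indicator_of_notMem (fun h' => hT (h'.1.trans ht.2)) _).trans (by simp)) zero_le

/-- The number of renewals up to time `T`, weighted by the truncated cycle lengths. -/
lemma Regular.tsum_min_le {Y D : ℕ → ℝ} (h : Regular Y D) {T c : ℝ} (hT : 0 ≤ T) (hc : 0 ≤ c) :
    ∑' l, (Iic T).indicator 1 (renewalTime Y l) * ENNReal.ofReal (min (Y l) c) ≤
      ENNReal.ofReal (T + c) := by
  -- While C_n ≤ T, passing to C_{n+1} raises min(C, T + c) by at least min(Y_n, c); the last cycle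
  -- begun may overshoot `T`, but adds at most c.
  have hind : ∀ n, ∑ l ∈ Finset.range n, (Iic T).indicator 1 (renewalTime Y l) *
      ENNReal.ofReal (min (Y l) c) ≤
        ENNReal.ofReal (min (renewalTime Y n) (T + c)) := by
    intro n
    induction n with
    | zero => simp
    | succ n ih =>
      rw [Finset.sum_range_succ]
      have h0 := h.renewalTime_nonneg n
      have h1 := (h n).1
      by_cases hn : renewalTime Y n ≤ T
      · rw [indicator_of_mem (mem_Iic.2 hn), Pi.one_apply, one_mul]
        refine (add_le_add_left ih _).trans ?_
        rw [← ENNReal.ofReal_add (le_min h0 (by positivity)) (le_min h1.le hc), renewalTime_succ]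
        refine ENNReal.ofReal_le_ofReal (le_min ?_ ?_)
        · exact add_le_add (min_le_left _ _) (min_le_left _ _)
        · exact add_le_add ((min_le_left _ _).trans hn) (min_le_right _ _)
      · rw [indicator_of_notMem (fun h' => hn (mem_Iic.1 h')), zero_mul, add_zero]
        refine ih.trans (ENNReal.ofReal_le_ofReal (min_le_min_right _ ?_))
        exact (h.strictMono (Nat.lt_succ_self n)).le
  exact ENNReal.tsum_le_of_sum_range_le fun n =>
    (hind n).trans (ENNReal.ofReal_le_ofReal (min_le_right _ _))

end LimitingMean

/-! ### Upper bound for the expected area by a Wald-type argument -/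

namespace RenewalCycles

variable {Ω : Type*} [MeasurableSpace Ω] {P : Measure Ω} {Y D : ℕ → Ω → ℝ} {a : ℝ}

lemma measurable_renewalTime (h : RenewalCycles P Y D) (l : ℕ) :
    Measurable fun ω => renewalTime (Y · ω) l :=
  Finset.measurable_fun_sum _ fun i _ => h.measurable_length i

lemma measurable_ageAt (h : RenewalCycles P Y D) (a : ℝ) :
    ∀ l, Measurable fun ω => ageAt a (D · ω) l
  | 0 => measurable_const
  | l + 1 => h.measurable_age l

lemma measurable_cycleSum (h : RenewalCycles P Y D) (a : ℝ) :
    Measurable fun z : ℝ × Ω => cycleSum a (Y · z.2) (D · z.2) z.1 := by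
  refine Measurable.tsum fun l => ?_
  have h0 : Measurable fun z : ℝ × Ω => renewalTime (Y · z.2) l :=
    (h.measurable_renewalTime l).comp measurable_snd
  have h1 : Measurable fun z : ℝ × Ω => renewalTime (Y · z.2) (l + 1) :=
    (h.measurable_renewalTime (l + 1)).comp measurable_snd
  have h2 : Measurable fun z : ℝ × Ω => ageAt a (D · z.2) l :=
    (h.measurable_ageAt a l).comp measurable_snd
  have hs : MeasurableSet {z : ℝ × Ω | renewalTime (Y · z.2) l ≤ z.1 ∧
      z.1 < renewalTime (Y · z.2) (l + 1)} :=
    (measurableSet_le h0 measurable_fst).inter (measurableSet_lt measurable_fst h1)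
  exact Measurable.indicator (f := fun z : ℝ × Ω => ENNReal.ofReal
    (z.1 - renewalTime (Y · z.2) l + ageAt a (D · z.2) l))
    ((measurable_fst.sub h0).add h2).ennreal_ofReal hs

/-- A functional of the first `l` cycles is independent of the cycle after them. -/
lemma lintegral_past_mul [IsProbabilityMeasure P] (h : RenewalCycles P Y D) {l : ℕ}
    {ψ : (Finset.range l → ℝ × ℝ) → ℝ≥0∞} (hψ : Measurable ψ) {f : ℝ × ℝ → ℝ≥0∞}
    (hf : Measurable f) :
    ∫⁻ ω, ψ (fun i => (Y i ω, D i ω)) * f (Y l ω, D l ω) ∂P =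
      (∫⁻ ω, ψ (fun i => (Y i ω, D i ω)) ∂P) * ∫⁻ ω, f (Y 0 ω, D 0 ω) ∂P := by
  have hind := h.indep.indepFun_finset (Finset.range l) {l} (by simp) h.measurable_pair
  have hind' := hind.comp (φ := ψ)
    (ψ := fun p : ({l} : Finset ℕ) → ℝ × ℝ => f (p ⟨l, Finset.mem_singleton_self l⟩)) hψ
    (hf.comp (measurable_pi_apply _))
  have hm : Measurable fun ω (i : Finset.range l) => (Y i ω, D i ω) :=
    measurable_pi_lambda _ fun i => h.measurable_pair i
  have he : ∫⁻ ω, f (Y l ω, D l ω) ∂P = ∫⁻ ω, f (Y 0 ω, D 0 ω) ∂P :=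
    ((h.ident l).comp hf).lintegral_eq
  rw [← he]
  exact lintegral_mul_eq_lintegral_mul_lintegral_of_indepFun (hψ.comp hm)
    (hf.comp (h.measurable_pair l)) hind'

/-- The event that the `l`-th renewal is not after `T`. -/
noncomputable def renewed (Y : ℕ → Ω → ℝ) (T : ℝ) (l : ℕ) (ω : Ω) : ℝ≥0∞ :=
  (Iic T).indicator 1 (renewalTime (Y · ω) l)

lemma measurable_renewed (h : RenewalCycles P Y D) (T : ℝ) (l : ℕ) : Measurable (renewed Y T l) :=
  (measurable_one.indicator measurableSet_Iic).comp (h.measurable_renewalTime l)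

/-- The event C_l ≤ T is decided by cycles before l, hence is independent of cycle l. -/
lemma lintegral_renewed_mul [IsProbabilityMeasure P] (h : RenewalCycles P Y D) (T : ℝ) (l : ℕ)
    {f : ℝ × ℝ → ℝ≥0∞} (hf : Measurable f) :
    ∫⁻ ω, renewed Y T l ω * f (Y l ω, D l ω) ∂P =
      (∫⁻ ω, renewed Y T l ω ∂P) * ∫⁻ ω, f (Y 0 ω, D 0 ω) ∂P := by
  have hψ : Measurable fun p : Finset.range l → ℝ × ℝ =>
      (Iic T).indicator (1 : ℝ → ℝ≥0∞) (∑ i, (p i).1) :=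
    (measurable_one.indicator measurableSet_Iic).comp (by fun_prop)
  have hsum : ∀ ω, ∑ i : Finset.range l, Y i ω = renewalTime (Y · ω) l := fun ω =>
    Finset.sum_coe_sort (Finset.range l) fun i => Y i ω
  have h1 := h.lintegral_past_mul hψ hf
  simp only [hsum] at h1
  exact h1

/-- The indicator is taken at l, not l + 1: C_{l+1} contains Y_l, which may depend on D_l, whereas
C_l, D_l and Y_{l+1} involve disjoint sets of cycles. -/
lemma lintegral_renewed_mul_age_mul [IsProbabilityMeasure P] (h : RenewalCycles P Y D) (T : ℝ)
    (l : ℕ) {f g : ℝ → ℝ≥0∞} (hf : Measurable f) (hg : Measurable g) :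
    ∫⁻ ω, renewed Y T l ω * f (D l ω) * g (Y (l + 1) ω) ∂P =
      (∫⁻ ω, renewed Y T l ω ∂P) * (∫⁻ ω, f (D 0 ω) ∂P) * ∫⁻ ω, g (Y 0 ω) ∂P := by
  -- A functional of the first l + 1 cycles is needed, so C_l is written as the sum of their lengths
  -- minus the last one.
  have hψ : Measurable fun p : Finset.range (l + 1) → ℝ × ℝ =>
      (Iic T).indicator (1 : ℝ → ℝ≥0∞)
        (∑ i, (p i).1 - (p ⟨l, Finset.self_mem_range_succ l⟩).1) *
          f (p ⟨l, Finset.self_mem_range_succ l⟩).2 :=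
    ((measurable_one.indicator measurableSet_Iic).comp (by fun_prop)).mul (by fun_prop)
  have hsum : ∀ ω, ∑ i : Finset.range (l + 1), Y i ω - Y l ω = renewalTime (Y · ω) l := fun ω => by
    rw [Finset.sum_coe_sort (Finset.range (l + 1)) fun i => Y i ω, Finset.sum_range_succ,
      add_sub_cancel_right, renewalTime]
  have h1 := h.lintegral_past_mul hψ (f := fun z => g z.1) (by fun_prop)
  simp only [hsum] at h1
  exact h1.trans (congrArg (· * _) (h.lintegral_renewed_mul T l (f := fun z => f z.2)
      (by fun_prop)))

/-- A bound for the renewal function. -/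
lemma tsum_renewed_mul_le [IsProbabilityMeasure P] (h : RenewalCycles P Y D) {T c : ℝ}
    (hT : 0 ≤ T) (hc : 0 ≤ c) :
    (∑' l, ∫⁻ ω, renewed Y T l ω ∂P) * ∫⁻ ω, ENNReal.ofReal (min (Y 0 ω) c) ∂P ≤
      ENNReal.ofReal (T + c) := by
  have hm := fun l => h.measurable_renewed T l
  have hY := h.measurable_length
  have h1 : ∀ l, (∫⁻ ω, renewed Y T l ω ∂P) * ∫⁻ ω, ENNReal.ofReal (min (Y 0 ω) c) ∂P =
      ∫⁻ ω, renewed Y T l ω * ENNReal.ofReal (min (Y l ω) c) ∂P := fun l =>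
    (h.lintegral_renewed_mul T l (f := fun z => ENNReal.ofReal (min z.1 c)) (by fun_prop)).symm
  rw [← ENNReal.tsum_mul_right, tsum_congr h1, ← lintegral_tsum fun l => by fun_prop]
  calc _ ≤ ∫⁻ _, ENNReal.ofReal (T + c) ∂P := lintegral_mono_ae (by
        filter_upwards [h.regular] with ω hω using hω.tsum_min_le hT hc)
    _ = _ := by simp

/-- The expected area is at most the mean area per cycle times the expected number of cycles begun
by `T`, plus a correction for the initial age `a`. -/
lemma lintegral_lintegral_cycleSum_le [IsProbabilityMeasure P] (h : RenewalCycles P Y D)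
    (ha : 0 ≤ a) (hsq : Integrable (fun ω => Y 0 ω ^ 2) P) (T : ℝ) :
    ∫⁻ ω, (∫⁻ t in Ioc 0 T, cycleSum a (Y · ω) (D · ω) t) ∂P ≤
      ENNReal.ofReal (a * ∫ ω, Y 0 ω ∂P) + (∑' l, ∫⁻ ω, renewed Y T l ω ∂P) *
        ENNReal.ofReal ((∫ ω, D 0 ω ∂P) * (∫ ω, Y 0 ω ∂P) + (∫ ω, Y 0 ω ^ 2 ∂P) / 2) := by
  have hm := fun l => h.measurable_renewed T l
  have hY := h.measurable_length
  have hD := h.measurable_age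
  have hY0 : 0 ≤ᵐ[P] Y 0 := h.regular.mono fun ω hω => (hω 0).1.le
  have hD0 : 0 ≤ᵐ[P] D 0 := h.regular.mono fun ω hω => (hω 0).2.1
  have hEY : 0 ≤ ∫ ω, Y 0 ω ∂P := integral_nonneg_of_ae hY0
  have hED : 0 ≤ ∫ ω, D 0 ω ∂P := integral_nonneg_of_ae hD0
  have hEY2 : 0 ≤ ∫ ω, Y 0 ω ^ 2 ∂P := integral_nonneg fun ω => sq_nonneg _
  set U := ∑' l, ∫⁻ ω, renewed Y T l ω ∂P with hU
  have e1 : ENNReal.ofReal (∫ ω, Y 0 ω ∂P) = ∫⁻ ω, ENNReal.ofReal (Y 0 ω) ∂P :=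
    ofReal_integral_eq_lintegral_ofReal h.integrable_length hY0
  have e2 : ENNReal.ofReal (∫ ω, D 0 ω ∂P) = ∫⁻ ω, ENNReal.ofReal (D 0 ω) ∂P :=
    ofReal_integral_eq_lintegral_ofReal h.integrable_age hD0
  have e3 : ENNReal.ofReal ((∫ ω, Y 0 ω ^ 2 ∂P) / 2) = ∫⁻ ω, ENNReal.ofReal (Y 0 ω ^ 2 / 2) ∂P := by
    rw [← integral_div]
    exact ofReal_integral_eq_lintegral_ofReal (hsq.div_const 2)
      (Eventually.of_forall fun ω => by positivity)
  -- the contributions of the age at the start of a cycle and of its growth within the cycle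
  set A : ℕ → Ω → ℝ≥0∞ := fun l ω =>
    renewed Y T l ω * ENNReal.ofReal (ageAt a (D · ω) l) * ENNReal.ofReal (Y l ω) with hA
  set B : ℕ → Ω → ℝ≥0∞ := fun l ω => renewed Y T l ω * ENNReal.ofReal (Y l ω ^ 2 / 2) with hB
  have hmA : ∀ l, Measurable (A l) := fun l =>
    ((hm l).mul (h.measurable_ageAt a l).ennreal_ofReal).mul (hY l).ennreal_ofReal
  have hmB : ∀ l, Measurable (B l) := fun l => by fun_prop
  have hle : ∀ᵐ ω ∂P, ∫⁻ t in Ioc 0 T, cycleSum a (Y · ω) (D · ω) t ≤ ∑' l, A l ω + ∑' l,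
      B l ω := by
    filter_upwards [h.regular] with ω hω
    simp only [cycleSum]
    rw [lintegral_tsum fun l => (Measurable.indicator (by fun_prop) measurableSet_Ico).aemeasurable,
      ← ENNReal.tsum_add]
    refine ENNReal.tsum_le_tsum fun l => (hω.lintegral_cycle_le ha T l).trans (le_of_eq ?_)
    have h1 := hω.ageAt_nonneg ha l
    have h2 := (hω l).1.le
    rw [cycleArea, ENNReal.ofReal_add (mul_nonneg h1 h2) (by positivity), ENNReal.ofReal_mul h1,
      mul_add, ← mul_assoc]
    rfl
  have hB' : ∫⁻ ω, ∑' l, B l ω ∂P = U * ENNReal.ofReal ((∫ ω, Y 0 ω ^ 2 ∂P) / 2) := by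
    rw [lintegral_tsum fun l => (hmB l).aemeasurable, e3, hU, ← ENNReal.tsum_mul_right]
    exact tsum_congr fun l =>
      h.lintegral_renewed_mul T l (f := fun z => ENNReal.ofReal (z.1 ^ 2 / 2)) (by fun_prop)
  have hA' : ∫⁻ ω, ∑' l, A l ω ∂P ≤ ENNReal.ofReal (a * ∫ ω, Y 0 ω ∂P) +
      U * ENNReal.ofReal ((∫ ω, D 0 ω ∂P) * ∫ ω, Y 0 ω ∂P) := by
    rw [lintegral_tsum fun l => (hmA l).aemeasurable, tsum_eq_zero_add' ENNReal.summable,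
      ENNReal.ofReal_mul ha, ENNReal.ofReal_mul hED, hU, ← ENNReal.tsum_mul_right, e1, e2]
    refine add_le_add ?_ (ENNReal.tsum_le_tsum fun l => ?_)
    · rw [← lintegral_const_mul _ (by fun_prop)]
      refine lintegral_mono fun ω => ?_
      simp only [hA, ageAt_zero]
      gcongr
      refine (mul_le_mul_left (indicator_le_self' (fun _ _ => zero_le) _) _).trans ?_
      simp
    · rw [← mul_assoc, ← h.lintegral_renewed_mul_age_mul T l (f := ENNReal.ofReal)
        (g := ENNReal.ofReal) (by fun_prop) (by fun_prop)]
      refine lintegral_mono_ae ?_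
      filter_upwards [h.regular] with ω hω
      simp only [hA, ageAt_succ]
      gcongr
      -- The event C_{l+1} ≤ T is enlarged to C_l ≤ T, so that it becomes independent of D_l.
      by_cases hT : renewalTime (Y · ω) (l + 1) ≤ T
      · have hT' := (hω.strictMono (Nat.lt_succ_self l)).le.trans hT
        rw [renewed, renewed, indicator_of_mem (mem_Iic.2 hT), indicator_of_mem (mem_Iic.2 hT')]
        rfl
      · rw [renewed, indicator_of_notMem (fun h' => hT (mem_Iic.1 h'))]
        exact zero_le
  calc _ ≤ ∫⁻ ω, (∑' l, A l ω + ∑' l, B l ω) ∂P := lintegral_mono_ae hle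
    _ = ∫⁻ ω, ∑' l, A l ω ∂P + ∫⁻ ω, ∑' l, B l ω ∂P :=
      lintegral_add_left (Measurable.tsum hmA) _
    _ ≤ _ := by
      rw [ENNReal.ofReal_add (mul_nonneg hED hEY) (by positivity), mul_add, ← add_assoc, hB']
      gcongr

end RenewalCycles

/-! ### The mean age and the limit of its averages -/

namespace RenewalCycles

variable {Ω : Type*} [MeasurableSpace Ω] {P : Measure Ω} {Y D : ℕ → Ω → ℝ} {a : ℝ}

lemma ae_cycleSum_eq [IsProbabilityMeasure P] (h : RenewalCycles P Y D) (ha : 0 ≤ a) :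
    ∀ᵐ ω ∂P, ∀ t, 0 ≤ t →
      cycleSum a (Y · ω) (D · ω) t = ENNReal.ofReal (renewalAge a (Y · ω) (D · ω) t) := by
  filter_upwards [h.regular, h.tendsto_renewalTime] with ω h1 h2 t ht using h1.cycleSum_eq ha h2 ht

lemma ae_renewalAge_mem [IsProbabilityMeasure P] (h : RenewalCycles P Y D) (ha : 0 ≤ a) :
    ∀ᵐ ω ∂P, ∀ t, 0 ≤ t → 0 ≤ renewalAge a (Y · ω) (D · ω) t ∧
      renewalAge a (Y · ω) (D · ω) t ≤ t + a := by
  filter_upwards [h.regular,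
      h.tendsto_renewalTime] with ω h1 h2 t ht using h1.renewalAge_mem ha h2 ht

lemma measurable_cycleSum_right (h : RenewalCycles P Y D) (a t : ℝ) :
    Measurable fun ω => cycleSum a (Y · ω) (D · ω) t :=
  (h.measurable_cycleSum a).comp (measurable_const.prodMk measurable_id)

lemma integrable_renewalAge [IsProbabilityMeasure P] (h : RenewalCycles P Y D) (ha : 0 ≤ a)
    {t : ℝ} (ht : 0 ≤ t) : Integrable (fun ω => renewalAge a (Y · ω) (D · ω) t) P := by
  have h1 : (fun ω => (cycleSum a (Y · ω) (D · ω) t).toReal) =ᵐ[P]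
      fun ω => renewalAge a (Y · ω) (D · ω) t := by
    filter_upwards [h.ae_cycleSum_eq ha, h.ae_renewalAge_mem ha] with ω h1 h2
    rw [h1 t ht, ENNReal.toReal_ofReal (h2 t ht).1]
  refine Integrable.of_bound
    ((h.measurable_cycleSum_right a t).ennreal_toReal.aestronglyMeasurable.congr h1) (t + a) ?_
  filter_upwards [h.ae_renewalAge_mem ha] with ω h2
  rw [Real.norm_of_nonneg (h2 t ht).1]
  exact (h2 t ht).2

/-- The mean age as a measurable function of time. -/
noncomputable def meanAge (P : Measure Ω) (a : ℝ) (Y D : ℕ → Ω → ℝ) (t : ℝ) : ℝ :=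
  (∫⁻ ω, cycleSum a (Y · ω) (D · ω) t ∂P).toReal

lemma lintegral_cycleSum [IsProbabilityMeasure P] (h : RenewalCycles P Y D) (ha : 0 ≤ a)
    {t : ℝ} (ht : 0 ≤ t) : ∫⁻ ω, cycleSum a (Y · ω) (D · ω) t ∂P =
      ENNReal.ofReal (∫ ω, renewalAge a (Y · ω) (D · ω) t ∂P) := by
  rw [ofReal_integral_eq_lintegral_ofReal (h.integrable_renewalAge ha ht)]
  · refine lintegral_congr_ae ?_
    filter_upwards [h.ae_cycleSum_eq ha] with ω h1 using h1 t ht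
  · filter_upwards [h.ae_renewalAge_mem ha] with ω h1 using (h1 t ht).1

lemma integral_renewalAge_nonneg [IsProbabilityMeasure P] (h : RenewalCycles P Y D) (ha : 0 ≤ a)
    {t : ℝ} (ht : 0 ≤ t) : 0 ≤ ∫ ω, renewalAge a (Y · ω) (D · ω) t ∂P :=
  integral_nonneg_of_ae (by
    filter_upwards [h.ae_renewalAge_mem ha] with ω h1 using (h1 t ht).1)

lemma meanAge_eq [IsProbabilityMeasure P] (h : RenewalCycles P Y D) (ha : 0 ≤ a)
    {t : ℝ} (ht : 0 ≤ t) : meanAge P a Y D t = ∫ ω, renewalAge a (Y · ω) (D · ω) t ∂P := by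
  rw [meanAge, h.lintegral_cycleSum ha ht, ENNReal.toReal_ofReal
      (h.integral_renewalAge_nonneg ha ht)]

lemma abs_meanAge_le [IsProbabilityMeasure P] (h : RenewalCycles P Y D) (ha : 0 ≤ a)
    {t : ℝ} (ht : 0 ≤ t) : |meanAge P a Y D t| ≤ t + a := by
  rw [h.meanAge_eq ha ht, ← Real.norm_eq_abs]
  have h1 : ∀ᵐ ω ∂P, ‖renewalAge a (Y · ω) (D · ω) t‖ ≤ t + a := by
    filter_upwards [h.ae_renewalAge_mem ha] with ω h2
    rw [Real.norm_of_nonneg (h2 t ht).1]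
    exact (h2 t ht).2
  simpa using norm_integral_le_of_norm_le_const h1

lemma measurable_meanAge [IsProbabilityMeasure P] (h : RenewalCycles P Y D) (a : ℝ) :
    Measurable (meanAge P a Y D) :=
  (h.measurable_cycleSum a).lintegral_prod_right'.ennreal_toReal

lemma intervalIntegrable_meanAge [IsProbabilityMeasure P] (h : RenewalCycles P Y D) (ha : 0 ≤ a)
    {T : ℝ} (hT : 0 ≤ T) : IntervalIntegrable (meanAge P a Y D) volume 0 T := by
  rw [intervalIntegrable_iff_integrableOn_Ioc_of_le hT]
  refine Integrable.of_bound (h.measurable_meanAge a).aestronglyMeasurable (T + a) ?_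
  rw [ae_restrict_iff' measurableSet_Ioc]
  refine Eventually.of_forall fun t ht => ?_
  rw [Real.norm_eq_abs]
  have := h.abs_meanAge_le ha ht.1.le
  have := ht.2
  linarith

lemma lintegral_lintegral_cycleSum [IsProbabilityMeasure P] (h : RenewalCycles P Y D) (ha : 0 ≤ a)
    {T : ℝ} (hT : 0 ≤ T) : ∫⁻ ω, (∫⁻ t in Ioc 0 T, cycleSum a (Y · ω) (D · ω) t) ∂P =
      ENNReal.ofReal (∫ t in (0 : ℝ)..T, meanAge P a Y D t) := by
  rw [lintegral_lintegral_swap (f := fun ω t => cycleSum a (Y · ω) (D · ω) t)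
    ((h.measurable_cycleSum a).comp measurable_swap).aemeasurable,
    intervalIntegral.integral_of_le hT,
    ofReal_integral_eq_lintegral_ofReal (h.intervalIntegrable_meanAge ha hT).1]
  · refine setLIntegral_congr_fun measurableSet_Ioc fun t ht => ?_
    rw [h.lintegral_cycleSum ha ht.1.le, h.meanAge_eq ha ht.1.le]
  · exact Eventually.of_forall fun t => ENNReal.toReal_nonneg

lemma tendsto_integral_min [IsProbabilityMeasure P] (h : RenewalCycles P Y D) :
    Tendsto (fun k : ℕ => ∫ ω, min (Y 0 ω) k ∂P) atTop (𝓝 (∫ ω, Y 0 ω ∂P)) := by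
  have hY := h.measurable_length 0
  refine tendsto_integral_of_dominated_convergence (Y 0) (fun k => by fun_prop)
    h.integrable_length (fun k => ?_) ?_
  · filter_upwards [h.regular] with ω hω
    rw [Real.norm_of_nonneg (le_min (hω 0).1.le k.cast_nonneg)]
    exact min_le_left _ _
  · refine Eventually.of_forall fun ω => tendsto_const_nhds.congr' ?_
    filter_upwards [tendsto_natCast_atTop_atTop.eventually_ge_atTop (Y 0 ω)] with k hk
    exact (min_eq_left hk).symm

/-- If the mean age converges, then its limit is the time average of the age. -/
theorem eq_of_tendsto_integral [IsProbabilityMeasure P] (h : RenewalCycles P Y D) (ha : 0 ≤ a)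
    (hsq : Integrable (fun ω => Y 0 ω ^ 2) P) {d : ℝ}
    (hd : Tendsto (fun t => ∫ ω, renewalAge a (Y · ω) (D · ω) t ∂P) atTop (𝓝 d)) :
    d = ((∫ ω, D 0 ω ∂P) * (∫ ω, Y 0 ω ∂P) + (∫ ω, Y 0 ω ^ 2 ∂P) / 2) / ∫ ω, Y 0 ω ∂P := by
  have hav := tendsto_average_of_tendsto (fun t ht => h.abs_meanAge_le ha ht)
      (h.measurable_meanAge a)
    (hd.congr' (by
      filter_upwards [eventually_ge_atTop 0] with t ht using (h.meanAge_eq ha ht).symm))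
  have hd0 : 0 ≤ d := ge_of_tendsto hd (by
    filter_upwards [eventually_ge_atTop 0] with t ht using h.integral_renewalAge_nonneg ha ht)
  have hmean := h.integral_length_pos
  have hY0 : 0 ≤ᵐ[P] Y 0 := h.regular.mono fun ω hω => (hω 0).1.le
  have hED : 0 ≤ ∫ ω, D 0 ω ∂P := integral_nonneg_of_ae (h.regular.mono fun ω hω => (hω 0).2.1)
  have hEY2 : 0 ≤ ∫ ω, Y 0 ω ^ 2 ∂P := integral_nonneg fun ω => sq_nonneg _
  have hg : 0 ≤ (∫ ω, D 0 ω ∂P) * (∫ ω, Y 0 ω ∂P) + (∫ ω, Y 0 ω ^ 2 ∂P) / 2 := by positivity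
  have htime := h.tendsto_average_renewalAge ha hsq
  have hupper := h.lintegral_lintegral_cycleSum_le ha hsq
  generalize (∫ ω, D 0 ω ∂P) * (∫ ω, Y 0 ω ∂P) + (∫ ω, Y 0 ω ^ 2 ∂P) / 2 = g at *
  refine le_antisymm ?_ ?_
  -- Upper bound: it suffices to show d E[min(Y, k)] ≤ g for every k, since the truncated means tend
  -- to E[Y].
  · rw [le_div_iff₀ hmean]
    refine le_of_tendsto ((tendsto_const_nhds (x := d)).mul h.tendsto_integral_min) ?_
    refine Eventually.of_forall fun k => ?_
    set μ := ∫ ω, min (Y 0 ω) k ∂P with hμ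
    have hmin0 : 0 ≤ᵐ[P] fun ω => min (Y 0 ω) k := by
      filter_upwards [hY0] with ω hω using le_min hω k.cast_nonneg
    have hμ0 : 0 ≤ μ := integral_nonneg_of_ae hmin0
    have hμ' : ENNReal.ofReal μ = ∫⁻ ω, ENNReal.ofReal (min (Y 0 ω) k) ∂P :=
      ofReal_integral_eq_lintegral_ofReal (h.integrable_length.inf (integrable_const _)) hmin0
    -- The area bound times E[min(Y, k)], combined with the bound n + k for the renewal function
    -- times this truncated mean. Dividing by n removes the terms in a and k.
    have hkey : ∀ n : ℕ, μ * ∫ t in (0 : ℝ)..n, meanAge P a Y D t ≤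
        μ * (a * ∫ ω, Y 0 ω ∂P) + (n + k) * g := by
      intro n
      have h1 := mul_le_mul_right (hupper n) (ENNReal.ofReal μ)
      rw [h.lintegral_lintegral_cycleSum ha n.cast_nonneg, mul_add, ← ENNReal.ofReal_mul hμ0,
        ← ENNReal.ofReal_mul hμ0, mul_left_comm (ENNReal.ofReal μ), ← mul_assoc (∑' _, _),
            hμ'] at h1
      have h2 := h1.trans (add_le_add_right (mul_le_mul_left
        (h.tsum_renewed_mul_le (n.cast_nonneg (α := ℝ)) k.cast_nonneg) (ENNReal.ofReal g)) _)
      rw [← ENNReal.ofReal_mul (by positivity), ← ENNReal.ofReal_add (by positivity)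
          (by positivity),
        ENNReal.ofReal_le_ofReal_iff (by positivity)] at h2
      exact h2
    have hlim : Tendsto (fun n : ℕ => (μ * (a * ∫ ω, Y 0 ω ∂P) + k * g) / n + g) atTop
        (𝓝 (0 + g)) := (tendsto_const_div_atTop_nhds_zero_nat _).add tendsto_const_nhds
    rw [zero_add] at hlim
    refine le_of_tendsto_of_tendsto (hav.mul_const μ) hlim ?_
    filter_upwards [eventually_gt_atTop 0] with n hn
    have hn' : (0 : ℝ) < n := by exact_mod_cast hn
    have h3 := div_le_div_of_nonneg_right (hkey n) hn'.le
    refine (le_of_eq ?_).trans (h3.trans (le_of_eq ?_))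
    · ring
    · field_simp
      ring
  -- Lower bound: Fatou's lemma applied to the pathwise time averages, whose almost sure limit is
  -- the constant g / E[Y].
  · rw [← ENNReal.ofReal_le_ofReal_iff hd0]
    have hlim : ∀ᵐ ω ∂P, Tendsto (fun n : ℕ => ENNReal.ofReal (1 / (n : ℝ)) *
        ∫⁻ t in Ioc 0 (n : ℝ), cycleSum a (Y · ω) (D · ω) t) atTop
          (𝓝 (ENNReal.ofReal (g / ∫ ω, Y 0 ω ∂P))) := by
      filter_upwards [htime, h.regular, h.tendsto_renewalTime] with ω h1 h2 h3
      refine (ENNReal.tendsto_ofReal (h1.comp tendsto_natCast_atTop_atTop)).congr fun n => ?_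
      have hn : (0 : ℝ) ≤ n := n.cast_nonneg
      simp only [Function.comp_apply]
      rw [ENNReal.ofReal_mul (by positivity), intervalIntegral.integral_of_le hn,
        ofReal_integral_eq_lintegral_ofReal (h2.intervalIntegrable ha h3 hn).1]
      · congr 1
        exact setLIntegral_congr_fun measurableSet_Ioc fun t ht =>
          (h2.cycleSum_eq ha h3 ht.1.le).symm
      · rw [EventuallyLE, ae_restrict_iff' measurableSet_Ioc]
        exact Eventually.of_forall fun t ht => (h2.renewalAge_mem ha h3 ht.1.le).1
    have hmeas : ∀ n : ℕ, Measurable fun ω => ENNReal.ofReal (1 / (n : ℝ)) *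
        ∫⁻ t in Ioc 0 (n : ℝ), cycleSum a (Y · ω) (D · ω) t := fun n =>
      ((h.measurable_cycleSum a).comp measurable_swap).lintegral_prod_right'.const_mul _
    calc ENNReal.ofReal (g / ∫ ω, Y 0 ω ∂P)
        = ∫⁻ ω, liminf (fun n : ℕ => ENNReal.ofReal (1 / (n : ℝ)) *
            ∫⁻ t in Ioc 0 (n : ℝ), cycleSum a (Y · ω) (D · ω) t) atTop ∂P := by
          rw [lintegral_congr_ae (g := fun _ => ENNReal.ofReal (g / ∫ ω, Y 0 ω ∂P))]
          · simp
          · filter_upwards [hlim] with ω hω using hω.liminf_eq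
      _ ≤ liminf (fun n : ℕ => ∫⁻ ω, (ENNReal.ofReal (1 / (n : ℝ)) *
            ∫⁻ t in Ioc 0 (n : ℝ), cycleSum a (Y · ω) (D · ω) t) ∂P) atTop :=
          lintegral_liminf_le hmeas
      _ = ENNReal.ofReal d := by
          refine Tendsto.liminf_eq ((ENNReal.tendsto_ofReal hav).congr fun n => ?_)
          rw [lintegral_const_mul' _ _ ENNReal.ofReal_ne_top,
            h.lintegral_lintegral_cycleSum ha n.cast_nonneg, ENNReal.ofReal_mul (by positivity)]

end RenewalCycles

section Conclusion

/-! ### The age process of the stream -/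

/-- the lengths of the successive cycles -/
noncomputable def cycleTimes (l : ℕ) (ω : Stream) : ℝ := cycleTime (nextCycle^[l] ω)

/-- the system times of the successive packets that complete -/
noncomputable def sysTimes (l : ℕ) (ω : Stream) : ℝ := sysTime (nextCycle^[l] ω)

variable {lam : ℝ} {μH μV : Measure ℝ} [hlam : Fact (0 < lam)] [IsProbabilityMeasure μH]
  [IsProbabilityMeasure μV]

local notation "𝓛" => streamLaw lam μH μV

lemma renewalCycles_stream (hH : ∀ᵐ x ∂μH, 0 ≤ x) (hV : ∀ᵐ x ∂μV, 0 ≤ x)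
    (hVpos : 0 < μV (Ioi 0)) (hV1 : Integrable (fun x => x) μV) :
    RenewalCycles 𝓛 cycleTimes sysTimes := by
  have hgood : ∀ᵐ ω ∂𝓛, Good ω := ae_good hH hV hVpos
  have hit : ∀ l, Measurable (nextCycle^[l]) := fun l => measurable_nextCycle.iterate l
  have hY : ∀ l, Measurable (cycleTimes l) := fun l => measurable_cycleTime.comp (hit l)
  have hD : ∀ l, Measurable (sysTimes l) := fun l => measurable_sysTime.comp (hit l)
  have hmap : ∀ l, (𝓛).map (nextCycle^[l]) = 𝓛 := fun l =>
    map_iterate measurable_nextCycle (indepFun_nextCycle hgood).2 l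
  refine ⟨hY, hD, iIndepFun_cycles hgood, fun l => ⟨((hY l).prodMk (hD l)).aemeasurable,
    ((hY 0).prodMk (hD 0)).aemeasurable, ?_⟩, ?_, (integral_cycleTime hgood hH hV hVpos hV1).1,
    (integral_sysTime hgood hH hV hVpos).1⟩
  · have h1 : Measurable fun ω : Stream => (cycleTime ω, sysTime ω) :=
      measurable_cycleTime.prodMk measurable_sysTime
    have h2 := Measure.map_map (μ := 𝓛) h1 (hit l)
    rw [hmap l] at h2
    exact h2.symm
  · filter_upwards [ae_good_iterate hgood] with ω hω l
    exact ⟨(hω l).1.cycleTime_pos (hω l).2, (hω l).1.sysTime_nonneg (hω l).2,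
      (hω l).1.sysTime_le (hω l).2⟩

lemma ae_completion_eq (hgood : ∀ᵐ ω ∂𝓛, Good ω) (a : ℝ) :
    ∀ᵐ ω ∂𝓛, ∀ l, completion a (xs ω) (hs ω) (vs ω) l = renewalTime (cycleTimes · ω) l ∧
      generation a (xs ω) (hs ω) (vs ω) l =
        renewalTime (cycleTimes · ω) l - ageAt a (sysTimes · ω) l := by
  filter_upwards [ae_good_iterate hgood] with ω hω
  have h1 := completion_eq (a := a) (fun l => (hω l).1) fun l => (hω l).2
  have h2 := generation_succ (a := a) (fun l => (hω l).1) fun l => (hω l).2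
  intro l
  refine ⟨h1 l, ?_⟩
  rcases l with _ | l
  · simp [generation, epoch]
  · rw [h2, h1]
    rfl

lemma ae_age_eq (hgood : ∀ᵐ ω ∂𝓛, Good ω) (a : ℝ) :
    ∀ᵐ ω ∂𝓛, age a (xs ω) (hs ω) (vs ω) = renewalAge a (cycleTimes · ω) (sysTimes · ω) := by
  filter_upwards [ae_completion_eq hgood a] with ω hω
  funext t
  rw [age, renewalAge]
  simp only [(hω _).1, (hω _).2]

lemma ae_peak_eq (hgood : ∀ᵐ ω ∂𝓛, Good ω) (a : ℝ) :
    ∀ᵐ ω ∂𝓛, ∀ l, peak a (xs ω) (hs ω) (vs ω) l = cycleTimes l ω + ageAt a (sysTimes · ω) l := by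
  filter_upwards [ae_completion_eq hgood a] with ω hω l
  rw [peak, (hω _).1, (hω _).2, renewalTime_succ]
  ring

omit hlam [IsProbabilityMeasure μH] [IsProbabilityMeasure μV] in
/-- The joint law of the random variables that drive the system. -/
lemma map_eq_streamLaw {Ω : Type*} [MeasurableSpace Ω] {P : Measure Ω} {X H V : ℕ → Ω → ℝ}
    (hX_law : ∀ i, HasLaw (X i) (expMeasure lam) P) (hH_law : ∀ i, HasLaw (H i) μH P)
    (hV_law : ∀ i, HasLaw (V i) μV P) (hX_meas : ∀ i, Measurable (X i))
    (hH_meas : ∀ i, Measurable (H i)) (hV_meas : ∀ i, Measurable (V i))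
    (h_indep : iIndepFun (Sum.elim X (Sum.elim H V)) P) :
    Measurable (fun ω i => Sum.elim X (Sum.elim H V) i ω) ∧
      P.map (fun ω i => Sum.elim X (Sum.elim H V) i ω) = 𝓛 := by
  have hm : Measurable (fun ω i => Sum.elim X (Sum.elim H V) i ω) := by
    refine measurable_pi_lambda _ fun i => ?_
    rcases i with i | i | i
    exacts [hX_meas i, hH_meas i, hV_meas i]
  refine ⟨hm, (h_indep.hasLaw_infinitePi (μ := coordLaw lam μH μV) (fun i => ?_)
    hm.aemeasurable).map_eq⟩
  rcases i with i | i | i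
  exacts [hX_law i, hH_law i, hV_law i]

end Conclusion

end CBSP

/-! ### Transfer from the stream to the given random variables -/

theorem mainTheorem3
    {Ω : Type*} [MeasurableSpace Ω] (P : Measure Ω) [IsProbabilityMeasure P]
    (lam : ℝ) (hlam : 0 < lam)
    (μH μV : Measure ℝ) [IsProbabilityMeasure μH] [IsProbabilityMeasure μV]
    (hH_nonneg : ∀ᵐ x ∂μH, 0 ≤ x) (hV_nonneg : ∀ᵐ x ∂μV, 0 ≤ x)
    (hV_pos : 0 < μV (Set.Ioi 0))
    (hV_mean : Integrable (fun x : ℝ => x) μV)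
    (X H V : ℕ → Ω → ℝ)
    (hX_law : ∀ i, HasLaw (X i) (expMeasure lam) P)
    (hH_law : ∀ i, HasLaw (H i) μH P)
    (hV_law : ∀ i, HasLaw (V i) μV P)
    (hX_meas : ∀ i, Measurable (X i)) (hH_meas : ∀ i, Measurable (H i))
    (hV_meas : ∀ i, Measurable (V i))
    (h_indep : iIndepFun (Sum.elim X (Sum.elim H V)) P)
    (a : ℝ) (ha : 0 ≤ a) :
    -- the numbers `A_l` are the peaks of the age process
    (∀ᵐ ω ∂P, ∀ l : ℕ,
      Tendsto (CBSP.age a (X · ω) (H · ω) (V · ω))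
        (𝓝[<] CBSP.completion a (X · ω) (H · ω) (V · ω) (l + 1))
        (𝓝 (CBSP.peak a (X · ω) (H · ω) (V · ω) l))) ∧
    -- peak age of information: time average and limiting mean
    (∀ᵐ ω ∂P, Tendsto
      (fun k : ℕ => (1 / (k : ℝ)) *
        ∑ l ∈ Finset.range k, CBSP.peak a (X · ω) (H · ω) (V · ω) l)
      atTop (𝓝 (CBSP.paoiValue lam μH μV))) ∧
    (∀ l : ℕ, Integrable (fun ω => CBSP.peak a (X · ω) (H · ω) (V · ω) l) P) ∧
    Tendsto (fun l : ℕ => ∫ ω, CBSP.peak a (X · ω) (H · ω) (V · ω) l ∂P)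
      atTop (𝓝 (CBSP.paoiValue lam μH μV)) ∧
    -- age of information: time average, and limiting mean whenever the means converge
    (Integrable (fun x : ℝ => x ^ 2) μV →
      (∀ᵐ ω ∂P, Tendsto
        (fun T : ℝ => (1 / T) * ∫ t in (0 : ℝ)..T, CBSP.age a (X · ω) (H · ω) (V · ω) t)
        atTop (𝓝 (CBSP.aoiValue lam μH μV))) ∧
      (∀ t : ℝ, 0 ≤ t → Integrable (fun ω => CBSP.age a (X · ω) (H · ω) (V · ω) t) P) ∧
      (∀ d : ℝ,
        Tendsto (fun t : ℝ => ∫ ω, CBSP.age a (X · ω) (H · ω) (V · ω) t ∂P) atTop (𝓝 d) →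
        d = CBSP.aoiValue lam μH μV)) := by
  have : Fact (0 < lam) := ⟨hlam⟩
  obtain ⟨hW, hmap⟩ := CBSP.map_eq_streamLaw hX_law hH_law hV_law hX_meas hH_meas hV_meas h_indep
  set W : Ω → CBSP.Stream := fun ω i => Sum.elim X (Sum.elim H V) i ω with hWdef
  have hgood : ∀ᵐ ω ∂(CBSP.streamLaw lam μH μV), CBSP.Good ω :=
    CBSP.ae_good hH_nonneg hV_nonneg hV_pos
  have hcyc := CBSP.renewalCycles_stream (lam := lam) hH_nonneg hV_nonneg hV_pos hV_mean
  have hEY := (CBSP.integral_cycleTime hgood hH_nonneg hV_nonneg hV_pos hV_mean).2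
  have hED := (CBSP.integral_sysTime hgood hH_nonneg hV_nonneg hV_pos).2.1
  have hEY' : ∫ ω, CBSP.cycleTimes 0 ω ∂(CBSP.streamLaw lam μH μV) =
    CBSP.meanVac lam μV + CBSP.meanSvc lam μH := hEY
  have hED' : ∫ ω, CBSP.sysTimes 0 ω ∂(CBSP.streamLaw lam μH μV) = CBSP.meanSys lam μH μV := hED
  have hcompl := CBSP.ae_completion_eq hgood a
  have hage := CBSP.ae_age_eq hgood a
  have hpeak := CBSP.ae_peak_eq hgood a
  -- The driving variables enter only through `W`, whose law is `streamLaw`; almost sure statements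
  -- and integrals are pulled back along it.
  have transfer : ∀ {p : CBSP.Stream → Prop}, (∀ᵐ ω ∂(CBSP.streamLaw lam μH μV), p ω) →
      ∀ᵐ ω ∂P, p (W ω) := fun hp => ae_of_ae_map hW.aemeasurable (hmap ▸ hp)
  have hint : ∀ {f : CBSP.Stream → ℝ}, Integrable f (CBSP.streamLaw lam μH μV) →
      Integrable (fun ω => f (W ω)) P ∧
        ∫ ω, f (W ω) ∂P = ∫ ω, f ω ∂(CBSP.streamLaw lam μH μV) := fun hf => by
    rw [← hmap] at hf ⊢
    exact ⟨hf.comp_measurable hW, (integral_map hW.aemeasurable hf.1).symm⟩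
  have hpaoi := CBSP.paoiValue_eq (lam := lam) hH_nonneg hV_nonneg hV_pos hV_mean
  have hpeak_int : ∀ l, Integrable (fun ω => CBSP.peak a (CBSP.xs ω) (CBSP.hs ω) (CBSP.vs ω) l)
      (CBSP.streamLaw lam μH μV) := fun l =>
    (hcyc.integral_peak a l).1.congr (hpeak.mono fun ω hω => (hω l).symm)
  refine ⟨transfer (p := fun ω => ∀ l : ℕ, Tendsto (CBSP.age a (CBSP.xs ω) (CBSP.hs ω) (CBSP.vs ω))
      (𝓝[<] CBSP.completion a (CBSP.xs ω) (CBSP.hs ω) (CBSP.vs ω) (l + 1))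
      (𝓝 (CBSP.peak a (CBSP.xs ω) (CBSP.hs ω) (CBSP.vs ω) l))) ?_,
    transfer (p := fun ω => Tendsto (fun k : ℕ => (1 / (k : ℝ)) *
      ∑ l ∈ Finset.range k, CBSP.peak a (CBSP.xs ω) (CBSP.hs ω) (CBSP.vs ω) l)
      atTop (𝓝 (CBSP.paoiValue lam μH μV))) ?_,
    fun l => (hint (hpeak_int l)).1, ?_, fun hV2 => ?_⟩
  · filter_upwards [hcyc.regular, hcompl, hage, hpeak] with ω h1 h2 h3 h4 l
    rw [(h2 _).1, h3, h4]
    exact h1.tendsto_renewalAge ha l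
  · filter_upwards [hpeak, hcyc.tendsto_average_peak a] with ω h1 h2
    rw [hpaoi, ← hEY', ← hED']
    simpa only [h1] using h2
  -- The means are constant from index 1 on; only the peak with index 0 involves the initial age
  -- `a`.
  · refine tendsto_const_nhds.congr' ?_
    filter_upwards [eventually_ge_atTop 1] with l hl
    obtain ⟨l, rfl⟩ := Nat.exists_eq_add_of_le' hl
    refine Eq.trans ?_ (hint (hpeak_int (l + 1))).2.symm
    rw [integral_congr_ae (hpeak.mono fun ω hω => hω (l + 1)), (hcyc.integral_peak a l).2, hEY',
      hED', hpaoi]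
  have hsq := CBSP.integral_cycleTime_sq hgood hH_nonneg hV_nonneg hV_pos hV_mean hV2
  have hsq' : ∫ ω, CBSP.cycleTimes 0 ω ^ 2 ∂(CBSP.streamLaw lam μH μV) = CBSP.meanVacSq lam μV +
    2 * CBSP.meanVac lam μV * CBSP.meanSvc lam μH + CBSP.meanSvcSq lam μH := hsq.2
  have haoi := CBSP.aoiValue_eq (lam := lam) hH_nonneg hV_nonneg hV_pos hV_mean hV2
  rw [← hEY', ← hED', ← hsq'] at haoi
  have hage_int : ∀ t, 0 ≤ t → Integrable (fun ω => CBSP.age a (CBSP.xs ω) (CBSP.hs ω)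
      (CBSP.vs ω) t)
      (CBSP.streamLaw lam μH μV) := fun t ht =>
    (hcyc.integrable_renewalAge ha ht).congr (hage.mono fun ω hω => (congrFun hω t).symm)
  refine ⟨transfer (p := fun ω => Tendsto (fun T : ℝ => (1 / T) * ∫ t in (0 : ℝ)..T,
      CBSP.age a (CBSP.xs ω) (CBSP.hs ω) (CBSP.vs ω) t) atTop (𝓝 (CBSP.aoiValue lam μH μV))) ?_,
    fun t ht => (hint (hage_int t ht)).1, fun d hd => ?_⟩
  · filter_upwards [hage, hcyc.tendsto_average_renewalAge ha hsq.1] with ω h1 h2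
    rw [haoi, h1]
    exact h2
  · rw [haoi]
    refine hcyc.eq_of_tendsto_integral ha hsq.1 (hd.congr' ?_)
    filter_upwards [eventually_ge_atTop 0] with t ht
    refine (hint (hage_int t ht)).2.trans (integral_congr_ae ?_)
    exact hage.mono fun ω hω => congrFun hω t
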